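/- **Round-UFPP.** An instance consists of a path with vertices $0,1,\dots,m$ ($m\ge 1$) whose edges $e_j=\{j-1,j\}$, $1\le j\le m$, have positive real capacities $c_j$, and of a finite family of $n$ flows $f_i=(s_i,t_i,\sigma_i)$ with vertices $s_i<t_i$ and real size $\sigma_i>0$. The flow $f_i$ uses $e_j$ if $s_i<j\le t_i$, and $\sigma_i$ is at most the capacity of each edge that $f_i$ uses (so that every flow can be scheduled by itself); no relation between the sizes and the capacities of the other edges (no "no-bottleneck assumption") is required. A set of flows is feasible if for every edge the total size of the flows of the set that use this edge is at most its capacity. The goal is to partition the flows into as few feasible sets (rounds) as possible; $\chi$ denotes the minimum number of rounds. Let $c_{\max}$ and $c_{\min}$ be the largest and smallest capacity of the path (under the usual normalization $c_{\min}=1$ the ratio $c_{\max}/c_{\min}$ is just $c_{\max}$). **Theorem.** There is an absolute constant $C$ such that the following holds. (When $c_{\max}=c_{\min}$, both maxima below are read as $1$; $\log 0$ for $n=0$ is immaterial, as then no round is needed.) (a) *(Online.)* There is a deterministic online algorithm, which knows the path and its capacities in advance, receives the flows one at a time in an arbitrary order, and irrevocably assigns each flow to a round on arrival, knowing neither the later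 flows nor their number, such that on every instance all rounds are feasible and the number of rounds used is at most $$C\cdot\max\Bigl(1,\ \min\bigl(\log m,\ \log\log\tfrac{c_{\max}}{c_{\min}}\bigr)\Bigr)\cdot\chi .$$ (b) *(Offline.)* There is a polynomial-time algorithm that, given the whole instance, computes a partition of the flows into feasible rounds whose number is at most $$C\cdot\max\Bigl(1,\ \min\bigl(\log n,\ \log m,\ \log\log\tfrac{c_{\max}}{c_{\min}}\bigr)\Bigr)\cdot\chi .$$ Here the algorithm is a fixed program of a random access machine whose operations are addition, subtraction and comparison of integers (used for indices and counters) and of real numbers, together with indexed memory access, and the number of executed steps is bounded by a polynomial in $n+m$. (On rational data in binary this is polynomial time in the usual sense.) -/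

import Mathlib

/-! ## The problem: unsplittable flows on a path, scheduled in rounds -/

namespace RoundUFPP

/-- A path with vertices `0, …, m` and `m ≥ 1` edges; edge `j : Fin m` joins the vertices
`j` and `j + 1` and has a positive real capacity. -/
structure CapPath where
  m : ℕ
  m_pos : 0 < m
  cap : Fin m → ℝ
  cap_pos : ∀ j, 0 < cap j

/-- The largest edge capacity. -/
noncomputable def CapPath.capMax (P : CapPath) : ℝ :=
  Finset.univ.sup' ⟨⟨0, P.m_pos⟩, Finset.mem_univ _⟩ P.cap

/-- The smallest edge capacity. -/
noncomputable def CapPath.capMin (P : CapPath) : ℝ :=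
  Finset.univ.inf' ⟨⟨0, P.m_pos⟩, Finset.mem_univ _⟩ P.cap

/-- A flow on `P`: it runs from vertex `src` to vertex `snk` with `src < snk`, thus uses the edges
`j` with `src ≤ j < snk`.  Its size is positive and at most its bottleneck capacity (otherwise
it could not be scheduled in any round). -/
structure Flow (P : CapPath) where
  src : ℕ
  snk : ℕ
  src_lt_snk : src < snk
  snk_le : snk ≤ P.m
  size : ℝ
  size_pos : 0 < size
  size_le : ∀ j : Fin P.m, src ≤ j.val → j.val < snk → size ≤ P.cap j

/-- The flow `f` uses the edge `j`. -/
def Flow.Uses {P : CapPath} (f : Flow P) (j : Fin P.m) : Prop :=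
  f.src ≤ j.val ∧ j.val < f.snk

open scoped Classical in
/-- An assignment of the flows to rounds (`col i` is the round of the `i`-th flow) is feasible
if in every round and on every edge the total size of the flows of this round that use the edge
is at most the capacity of the edge. -/
def Feasible {P : CapPath} (F : List (Flow P)) (col : Fin F.length → ℕ) : Prop :=
  ∀ (r : ℕ) (j : Fin P.m),
    ∑ i ∈ Finset.univ.filter (fun i => col i = r ∧ (F.get i).Uses j), (F.get i).size ≤ P.cap j

/-- The number of (non-empty) rounds that an assignment uses. -/
def numRounds {n : ℕ} (col : Fin n → ℕ) : ℕ :=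
  (Finset.univ.image col).card

/-- `χ(F)`: the least number of rounds of a feasible assignment. -/
noncomputable def chromaticNumber {P : CapPath} (F : List (Flow P)) : ℕ :=
  sInf {k : ℕ | ∃ col : Fin F.length → ℕ, Feasible F col ∧ numRounds col = k}

/-- The infimum in `chromaticNumber` is over a non-empty set: one round per flow is feasible. -/
theorem exists_feasible {P : CapPath} (F : List (Flow P)) :
    ∃ col : Fin F.length → ℕ, Feasible F col := by
  classical
  refine ⟨fun i => i.val, fun r j => ?_⟩
  by_cases h : ∃ i : Fin F.length, i.val = r ∧ (F.get i).Uses j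
  · obtain ⟨i, hi⟩ := h
    rw [Finset.sum_eq_single i]
    · exact (F.get i).size_le j hi.2.1 hi.2.2
    · intro b hb hbi
      exact absurd (Fin.ext ((Finset.mem_filter.1 hb).2.1.trans hi.1.symm)) hbi
    · intro hn
      simp only [Finset.mem_filter, Finset.mem_univ, true_and] at hn
      exact absurd hi hn
  · rw [Finset.sum_eq_zero]
    · exact (P.cap_pos j).le
    · intro i hi
      exact absurd ⟨i, (Finset.mem_filter.1 hi).2⟩ h

/-! ## Online algorithms -/

/-- A deterministic online algorithm knows the capacitated path in advance.  When a flow arrives, it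
irrevocably chooses the round of that flow from the path, the list of the flows that arrived before,
and the flow itself; it knows neither the later flows nor their number. -/
def OnlineAlgorithm : Type :=
  (P : CapPath) → List (Flow P) → Flow P → ℕ

/-- The assignment that an online algorithm produces if the flows arrive in the order of `F`. -/
def OnlineAlgorithm.assignment (A : OnlineAlgorithm) {P : CapPath} (F : List (Flow P)) :
    Fin F.length → ℕ :=
  fun i => A P (F.take i.val) (F.get i)

/-! ## Offline algorithms: programs of an additive random access machine

The memory consists of arrays of natural numbers (for counters, indices and rounds) and arrays of
real numbers (for capacities and sizes).  The arithmetic operations are addition and subtraction,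
so a run of `t` steps increases the bit length of rational data by `O(t)` only, and a
number of steps polynomial in `n + m` is also polynomial time in the usual bit model. -/

/-- A memory state: `s.nat a k` and `s.real a k` are the `k`-th entries of the `a`-th array of
natural numbers and of the `a`-th array of real numbers. -/
structure Store where
  nat : ℕ → ℕ → ℕ
  real : ℕ → ℕ → ℝ

/-- Expressions with values in the natural numbers; `sub` is truncated subtraction. -/
inductive NatExpr : Type
  | const (k : ℕ)
  | read (a : ℕ) (i : NatExpr)
  | add (e₁ e₂ : NatExpr)
  | sub (e₁ e₂ : NatExpr)

/-- Expressions with real values. -/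
inductive RealExpr : Type
  | const (k : ℕ)
  | read (a : ℕ) (i : NatExpr)
  | add (e₁ e₂ : RealExpr)
  | sub (e₁ e₂ : RealExpr)

/-- Tests. -/
inductive Test : Type
  | natLT (e₁ e₂ : NatExpr)
  | realLT (e₁ e₂ : RealExpr)
  | neg (b : Test)
  | conj (b₁ b₂ : Test)

/-- Programs; `setNat a i e` and `setReal a i e` store the value of `e` in the entry `i` of
the array `a`, and `loop b c` repeats `c` as long as the test `b` holds. -/
inductive Prog : Type
  | skip
  | setNat (a : ℕ) (i : NatExpr) (e : NatExpr)
  | setReal (a : ℕ) (i : NatExpr) (e : RealExpr)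
  | seq (c₁ c₂ : Prog)
  | branch (b : Test) (c₁ c₂ : Prog)
  | loop (b : Test) (c : Prog)

/-- The value of a natural number expression. -/
def NatExpr.eval (s : Store) : NatExpr → ℕ
  | .const k => k
  | .read a i => s.nat a (i.eval s)
  | .add e₁ e₂ => e₁.eval s + e₂.eval s
  | .sub e₁ e₂ => e₁.eval s - e₂.eval s

/-- The value of a real expression. -/
def RealExpr.eval (s : Store) : RealExpr → ℝ
  | .const k => (k : ℝ)
  | .read a i => s.real a (i.eval s)
  | .add e₁ e₂ => e₁.eval s + e₂.eval s
  | .sub e₁ e₂ => e₁.eval s - e₂.eval s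

/-- The truth of a test. -/
def Test.Holds (s : Store) : Test → Prop
  | .natLT e₁ e₂ => e₁.eval s < e₂.eval s
  | .realLT e₁ e₂ => e₁.eval s < e₂.eval s
  | .neg b => ¬ b.Holds s
  | .conj b₁ b₂ => b₁.Holds s ∧ b₂.Holds s

/-- The store after writing `v` into the entry `k` of the natural number array `a`. -/
def Store.putNat (s : Store) (a k v : ℕ) : Store :=
  { s with nat := Function.update s.nat a (Function.update (s.nat a) k v) }

/-- The store after writing `v` into the entry `k` of the real array `a`. -/
def Store.putReal (s : Store) (a k : ℕ) (v : ℝ) : Store :=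
  { s with real := Function.update s.real a (Function.update (s.real a) k v) }

/-- `Run c s t s'`: the program `c`, started in the state `s`, halts after `t` steps in the
state `s'`.  Every execution of `skip`, of an assignment and of a test is one step. -/
inductive Run : Prog → Store → ℕ → Store → Prop
  | skip (s : Store) : Run .skip s 1 s
  | setNat (a : ℕ) (i e : NatExpr) (s : Store) :
      Run (.setNat a i e) s 1 (s.putNat a (i.eval s) (e.eval s))
  | setReal (a : ℕ) (i : NatExpr) (e : RealExpr) (s : Store) :
      Run (.setReal a i e) s 1 (s.putReal a (i.eval s) (e.eval s))
  | seq {c₁ c₂ : Prog} {s s' s'' : Store} {t₁ t₂ : ℕ} :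
      Run c₁ s t₁ s' → Run c₂ s' t₂ s'' → Run (.seq c₁ c₂) s (t₁ + t₂) s''
  | branch_true {b : Test} {c₁ c₂ : Prog} {s s' : Store} {t : ℕ} :
      b.Holds s → Run c₁ s t s' → Run (.branch b c₁ c₂) s (t + 1) s'
  | branch_false {b : Test} {c₁ c₂ : Prog} {s s' : Store} {t : ℕ} :
      ¬ b.Holds s → Run c₂ s t s' → Run (.branch b c₁ c₂) s (t + 1) s'
  | loop_done {b : Test} {c : Prog} {s : Store} :
      ¬ b.Holds s → Run (.loop b c) s 1 s
  | loop_step {b : Test} {c : Prog} {s s' s'' : Store} {t₁ t₂ : ℕ} :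
      b.Holds s → Run c s t₁ s' → Run (.loop b c) s' t₂ s'' →
        Run (.loop b c) s (t₁ + t₂ + 1) s''

/-- Programs are deterministic: the final state and the number of steps are unique. -/
theorem Run.unique {c : Prog} {s s₁ s₂ : Store} {t₁ t₂ : ℕ}
    (h₁ : Run c s t₁ s₁) (h₂ : Run c s t₂ s₂) : t₁ = t₂ ∧ s₁ = s₂ := by
  induction h₁ generalizing t₂ s₂ with
  | skip s => cases h₂; exact ⟨rfl, rfl⟩
  | setNat a i e s => cases h₂; exact ⟨rfl, rfl⟩
  | setReal a i e s => cases h₂; exact ⟨rfl, rfl⟩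
  | seq _ _ ih₁ ih₂ =>
    cases h₂ with
    | seq k₁ k₂ =>
      obtain ⟨rfl, rfl⟩ := ih₁ k₁
      obtain ⟨rfl, rfl⟩ := ih₂ k₂
      exact ⟨rfl, rfl⟩
  | branch_true hb _ ih =>
    cases h₂ with
    | branch_true _ k => obtain ⟨rfl, rfl⟩ := ih k; exact ⟨rfl, rfl⟩
    | branch_false hb' _ => exact absurd hb hb'
  | branch_false hb _ ih =>
    cases h₂ with
    | branch_true hb' _ => exact absurd hb' hb
    | branch_false _ k => obtain ⟨rfl, rfl⟩ := ih k; exact ⟨rfl, rfl⟩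
  | loop_done hb =>
    cases h₂ with
    | loop_done _ => exact ⟨rfl, rfl⟩
    | loop_step hb' _ _ => exact absurd hb' hb
  | loop_step hb _ _ ih₁ ih₂ =>
    cases h₂ with
    | loop_done hb' => exact absurd hb hb'
    | loop_step _ k₁ k₂ =>
      obtain ⟨rfl, rfl⟩ := ih₁ k₁
      obtain ⟨rfl, rfl⟩ := ih₂ k₂
      exact ⟨rfl, rfl⟩

/-- The initial memory for the flows `F` on the path `P`: natural number array `0` holds
`m, n`, arrays `1` and `2` hold the sources and the sinks, real array `0` holds the capacities
and real array `1` the sizes; all other entries are `0`. -/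
def inputStore {P : CapPath} (F : List (Flow P)) : Store where
  nat := fun a k =>
    if a = 0 then (if k = 0 then P.m else if k = 1 then F.length else 0)
    else if h : k < F.length then
      (if a = 1 then (F.get ⟨k, h⟩).src else if a = 2 then (F.get ⟨k, h⟩).snk else 0)
    else 0
  real := fun a k =>
    if a = 0 then (if h : k < P.m then P.cap ⟨k, h⟩ else 0)
    else if a = 1 then (if h : k < F.length then (F.get ⟨k, h⟩).size else 0)
    else 0

/-- The assignment written by a program: the round of the `i`-th flow is the `i`-th entry of the
natural number array `3` at the end of the run. -/
def outputAssignment (s : Store) (n : ℕ) : Fin n → ℕ :=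
  fun i => s.nat 3 i.val

/-! ## The performance guarantees -/

/-- `max (1, min (log m, log log (c_max / c_min)))`.  (If `c_max = c_min`, the value is `1`.) -/
noncomputable def onlineBound (P : CapPath) : ℝ :=
  max 1 (min (Real.log P.m) (Real.log (Real.log (P.capMax / P.capMin))))

/-- `max (1, min (log n, log m, log log (c_max / c_min)))`.
(If `c_max = c_min`, the value is `1`.) -/
noncomputable def offlineBound (P : CapPath) (n : ℕ) : ℝ :=
  max 1 (min (Real.log n)
    (min (Real.log P.m) (Real.log (Real.log (P.capMax / P.capMin)))))

/-- The online algorithm `A` always produces a feasible assignment, and the number of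
rounds is at most `ρ P` times the optimum. -/
def IsCompetitive (A : OnlineAlgorithm) (ρ : CapPath → ℝ) : Prop :=
  ∀ (P : CapPath) (F : List (Flow P)),
    Feasible F (A.assignment F) ∧
      (numRounds (A.assignment F) : ℝ) ≤ ρ P * (chromaticNumber F : ℝ)

/-- The program `c` is a (strongly) polynomial time approximation algorithm with ratio `ρ P n`:
the number of its steps is at most a fixed polynomial in `m + n`, the assignment that it writes is
feasible, and the number of rounds is at most `ρ P n` times the optimum. -/
def IsPolyTimeApprox (c : Prog) (ρ : CapPath → ℕ → ℝ) : Prop :=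
  ∃ p : Polynomial ℕ, ∀ (P : CapPath) (F : List (Flow P)),
    ∃ (t : ℕ) (s : Store), Run c (inputStore F) t s ∧ t ≤ p.eval (P.m + F.length) ∧
      Feasible F (outputAssignment s F.length) ∧
      (numRounds (outputAssignment s F.length) : ℝ) ≤
        ρ P F.length * (chromaticNumber F : ℝ)

end RoundUFPP

/-!
One algorithm serves both parts; only the values from which its *anchors* are selected differ.

**Anchors.** From the capacities of the path (online) or the bottleneck capacities of the flows
(offline) a greedy selection keeps values that pairwise differ by a factor of at least two, such
that every bottleneck capacity `b` is within a factor of two of an anchor.  Their number `A` is at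
most `m`, at most `1 + log₂ (c_max / c_min)`, and offline at most `n`.  This yields all terms of the
minimum at once, since the algorithm loses a factor of `O(log A)`.

**Small flows** (`32 σ ≤ b`) are grouped by an anchor `a` near `b`.  Every group gets the capacity
`a / 4` on each edge of a round; the anchors form a geometric sum, so that all groups fit into the
same rounds.  **Large flows** are drawn as rectangles of height `[b - σ, b]` over their edges. Flows
whose rectangles are disjoint may share a round (`sum_size_le_of_stacked`).  A large flow is
assigned to that one among the anchors near its height interval whose rank has the largest two-adic
valuation, its node.  Two flows with different nodes of ranks of equal valuation have disjoint
heights (`node_eq_of_common_anchor`), because between the two ranks there is one of larger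
valuation.  Hence all nodes whose ranks have the same valuation share a palette of rounds,
and there are at most `1 + log₂ A` palettes.

**Within a group** the flows are coloured online as intervals, following Kierstead and Trotter: a
flow goes to the lowest level `h` such that the levels up to `h` have weight at most `h + 1` units
on its edges.  Then each flow has a marked edge on which its own level weighs less than two units
(`exists_marked`).  For small flows a level therefore has weight at most four units everywhere, and
is a round.  For large flows, which are counted, the marked edge is private, so that a flow meets at
most two others of its level and first fit needs three colours.

**Comparison with the optimum.**  The weight of a group on an edge bounds the number of levels.  In
a feasible set, consider the flows of a group that use an edge `e` and have their bottleneck to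
the left of `e`.  All of them use the bottleneck edge nearest to `e`.  For small flows
this bounds their total size by `2 a`; for large flows, the flow owning this bottleneck leaves less
than `2 a` to the others, each of which is larger than `a / 64`, so that there are `O(1)` of them.

**The program.**  The offline part asks for a program of the random access machine.  The functions
that such programs compute in polynomial time are closed under arithmetic, case distinctions,
bounded sums and bounded search (`NatComp`, `RealComp`, `PropComp`), and a program may fill a table
whose entries depend on the previous ones (`Stage.fillNat`).  The algorithm is a sequence of eleven
such tables.
-/

namespace RoundUFPP

open Finset

/-! ### Least elements and course-of-values recursion -/

open scoped Classical in
/-- The least `j < n` with `P j`, and `n` if there is none. -/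
noncomputable def leastBelow (n : ℕ) (P : ℕ → Prop) : ℕ :=
  Nat.find (p := fun j => P j ∨ n ≤ j) ⟨n, Or.inr le_rfl⟩

theorem leastBelow_spec {n : ℕ} {P : ℕ → Prop} (h : ∃ j < n, P j) :
    leastBelow n P < n ∧ P (leastBelow n P) := by
  classical
  obtain ⟨j, hj, hP⟩ := h
  have hlt : leastBelow n P < n := lt_of_le_of_lt (Nat.find_min' _ (Or.inl hP)) hj
  refine ⟨hlt, ?_⟩
  have h := Nat.find_spec (p := fun j => P j ∨ n ≤ j) ⟨n, Or.inr le_rfl⟩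
  exact h.resolve_right (not_le.2 hlt)

theorem not_of_lt_leastBelow {n : ℕ} {P : ℕ → Prop} {j : ℕ} (h : j < leastBelow n P) : ¬ P j := by
  classical
  intro hP
  exact Nat.find_min _ h (Or.inl hP)

theorem leastBelow_le {n : ℕ} {P : ℕ → Prop} {j : ℕ} (h : P j) : leastBelow n P ≤ j := by
  classical
  exact Nat.find_min' _ (Or.inl h)

theorem leastBelow_le_bound (n : ℕ) (P : ℕ → Prop) : leastBelow n P ≤ n := by
  classical
  exact Nat.find_min' _ (Or.inr le_rfl)

open scoped Classical in
/-- `leastBelow` counts the numbers below `n` that are not preceded by an element of `P`. -/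
theorem leastBelow_eq_sum (n : ℕ) (P : ℕ → Prop) :
    leastBelow n P = ∑ j ∈ range n, if ∀ j' < j + 1, ¬ P j' then 1 else 0 := by
  have h : (range n).filter (fun j => ∀ j' < j + 1, ¬ P j') = range (leastBelow n P) := by
    ext j
    simp only [mem_filter, mem_range]
    constructor
    · rintro ⟨hj, hP⟩
      by_contra hle
      rw [not_lt] at hle
      have := Nat.find_spec (p := fun j => P j ∨ n ≤ j) ⟨n, Or.inr le_rfl⟩
      rcases this with h | h
      · exact hP _ (Nat.lt_succ_of_le hle) h
      · exact absurd (h.trans hle) (not_le.2 hj)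
    · intro hj
      exact ⟨hj.trans_le (leastBelow_le_bound n P),
        fun j' hj' => not_of_lt_leastBelow (n := n) (lt_of_le_of_lt (Nat.lt_succ_iff.1 hj') hj)⟩
  rw [← Finset.sum_filter, h]
  simp

/-- The state of the course-of-values recursion after the first `N` values. -/
def fillUpTo (step : ℕ → (ℕ → ℕ) → ℕ) : ℕ → ℕ → ℕ
  | 0 => fun _ => 0
  | i + 1 => Function.update (fillUpTo step i) i (step i (fillUpTo step i))

/-- Course-of-values recursion: the value at `i` is computed by `step i` from the values below `i`
(the function that `step i` sees is `0` from `i` on). -/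
def fill (step : ℕ → (ℕ → ℕ) → ℕ) (i : ℕ) : ℕ :=
  fillUpTo step (i + 1) i

theorem fillUpTo_eq (step : ℕ → (ℕ → ℕ) → ℕ) (N : ℕ) :
    fillUpTo step N = fun i => if i < N then fill step i else 0 := by
  induction N with
  | zero => simp [fillUpTo]
  | succ N ih =>
    funext i
    by_cases hi : i = N
    · subst hi; simp [fill]
    · rw [fillUpTo, Function.update_of_ne hi, ih]
      have : i < N + 1 ↔ i < N := by omega
      simp [this]

theorem fill_eq (step : ℕ → (ℕ → ℕ) → ℕ) (i : ℕ) :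
    fill step i = step i (fun k => if k < i then fill step k else 0) := by
  rw [fill, fillUpTo, Function.update_self, fillUpTo_eq]

theorem fill_congr {step step' : ℕ → (ℕ → ℕ) → ℕ} {N : ℕ}
    (h : ∀ i < N, ∀ g, step i g = step' i g) : ∀ i < N, fill step i = fill step' i := by
  intro i
  induction i using Nat.strong_induction_on with
  | _ i ih =>
    intro hi
    rw [fill_eq, fill_eq step', h i hi]
    congr 1
    funext k
    split_ifs with hk
    · exact ih k hk (hk.trans hi)
    · rfl

/-! ### Two-adic valuations -/

theorem padicValNat_two_two_mul {j : ℕ} (hj : j ≠ 0) :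
    padicValNat 2 (2 * j) = padicValNat 2 j + 1 := by
  rw [padicValNat.mul (by norm_num) hj]
  simp [add_comm]

theorem padicValNat_two_odd (j : ℕ) : padicValNat 2 (2 * j + 1) = 0 :=
  padicValNat.eq_zero_of_not_dvd (by omega)

/-- Between two numbers of equal valuation there is one of larger valuation. -/
theorem exists_between_padicValNat_gt (x : ℕ) : ∀ y, 0 < x → x < y →
    padicValNat 2 x = padicValNat 2 y → ∃ z, x < z ∧ z < y ∧ padicValNat 2 x < padicValNat 2 z := by
  induction x using Nat.strong_induction_on with
  | _ x ih =>
    intro y hx hxy hv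
    obtain ⟨a, rfl | rfl⟩ := Nat.even_or_odd' x
    · obtain ⟨b, rfl | rfl⟩ := Nat.even_or_odd' y
      · rw [padicValNat_two_two_mul (by omega), padicValNat_two_two_mul (by omega)] at hv
        obtain ⟨z, h1, h2, h3⟩ := ih a (by omega) b (by omega) (by omega) (by omega)
        refine ⟨2 * z, by omega, by omega, ?_⟩
        rw [padicValNat_two_two_mul (by omega), padicValNat_two_two_mul (by omega)]
        omega
      · rw [padicValNat_two_two_mul (by omega), padicValNat_two_odd] at hv
        omega
    · obtain ⟨b, rfl | rfl⟩ := Nat.even_or_odd' y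
      · rw [padicValNat_two_two_mul (by omega), padicValNat_two_odd] at hv
        omega
      · refine ⟨2 * (a + 1), by omega, by omega, ?_⟩
        rw [padicValNat_two_two_mul (by omega), padicValNat_two_odd]
        omega

theorem padicValNat_two_lt {k : ℕ} (hk : 0 < k) : padicValNat 2 k < k := by
  have h : 2 ^ padicValNat 2 k ≤ k := Nat.le_of_dvd hk pow_padicValNat_dvd
  exact lt_of_lt_of_le Nat.lt_two_pow_self h

/-! ### The algorithm -/

/-- Two positive reals are near each other if their ratio lies strictly between `1 / 2` and `2`. -/
def Near (x y : ℝ) : Prop := x < 2 * y ∧ y < 2 * x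

theorem Near.symm {x y : ℝ} (h : Near x y) : Near y x := ⟨h.2, h.1⟩

/-- The data from which the algorithm computes its rounds.  The flows are numbered in the order in
which they arrive; the flow `i` uses the edges `e` with `src i ≤ e < snk i`, has the size `size i`,
and its smallest capacity is `bot i`.  The values `val j`, `j < K`, are those from which
the anchors are selected; they have to contain all bottleneck capacities. -/
structure Data where
  K : ℕ
  val : ℕ → ℝ
  src : ℕ → ℕ
  snk : ℕ → ℕ
  size : ℕ → ℝ
  bot : ℕ → ℝ

namespace Data

open scoped Classical

variable (D : Data)

/-- The flow `i` uses the edge `e`. -/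
def Uses (i e : ℕ) : Prop := D.src i ≤ e ∧ e < D.snk i

/-- The recursion step of `Data.anchor`. -/
noncomputable def anchorStep (i : ℕ) (g : ℕ → ℕ) : ℕ :=
  if ∀ j < i, g j = 1 → ¬ Near (D.val j) (D.val i) then 1 else 0

/-- Greedy selection of anchors: `anchor i = 1` if `val i` is near no earlier anchor, and `0`
otherwise. -/
noncomputable def anchor : ℕ → ℕ := fill D.anchorStep

/-- The position of `val j` among the anchors, counted from `1` if `j` is an anchor. -/
noncomputable def rank (j : ℕ) : ℕ :=
  ∑ k ∈ range D.K, if D.anchor k = 1 ∧ D.val k ≤ D.val j then 1 else 0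

/-- The height interval `[bot i - size i, bot i]` of the flow `i` comes within a factor of two of
the anchor `j`. -/
def Meets (i j : ℕ) : Prop :=
  D.anchor j = 1 ∧ D.bot i - D.size i < 2 * D.val j ∧ D.val j < 2 * D.bot i

/-- Among the anchors that the flow `i` meets, one whose rank has the largest valuation. -/
noncomputable def node (i : ℕ) : ℕ :=
  leastBelow D.K (fun j => D.Meets i j ∧
    ∀ k < D.K, D.Meets i k → padicValNat 2 (D.rank k) ≤ padicValNat 2 (D.rank j))

/-- An anchor near the bottleneck capacity of the flow `i`. -/
noncomputable def cls (i : ℕ) : ℕ :=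
  leastBelow D.K (fun j => D.anchor j = 1 ∧ Near (D.val j) (D.bot i))

/-- The group of a flow: a small flow belongs to its class, a large one to its node (shifted
by `K` to keep the two kinds apart).  The threshold makes the weight `16 * size i` of a small flow
less than its anchor. -/
noncomputable def group (i : ℕ) : ℕ :=
  if 32 * D.size i ≤ D.bot i then D.cls i else D.K + D.node i

/-- Small flows are weighted by their size and large flows are counted.  With the factor `16`, four
units of weight amount to a total size of a quarter of the anchor. -/
noncomputable def weight (i : ℕ) : ℝ := if D.group i < D.K then 16 * D.size i else 1

/-- The load that a group may add per level. -/
noncomputable def unit (i : ℕ) : ℝ := if D.group i < D.K then D.val (D.group i) else 1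

/-- The recursion step of `Data.level`. -/
noncomputable def levelStep (i : ℕ) (g : ℕ → ℕ) : ℕ :=
  leastBelow (i + 1) (fun h => ∀ e < D.snk i, D.src i ≤ e →
    (∑ j ∈ range i, if D.group j = D.group i ∧ g j ≤ h ∧ D.Uses j e then D.weight j else 0)
      + D.weight i ≤ ∑ _x ∈ range (h + 1), D.unit i)

/-- The level of the flow `i`: the least `h` such that on every edge of the flow, the flows of its
group on the levels `≤ h`, including the new one, have weight at most `(h + 1) * unit i`. -/
noncomputable def level : ℕ → ℕ := fill D.levelStep

/-- The recursion step of `Data.color`. -/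
noncomputable def colorStep (i : ℕ) (g : ℕ → ℕ) : ℕ :=
  leastBelow 3 (fun c => D.K ≤ D.group i → ∀ j < i, D.group j = D.group i →
    D.level j = D.level i → g j = c → ¬ (D.src j < D.snk i ∧ D.src i < D.snk j))

/-- First-fit colours inside the levels of the groups of large flows; small flows get colour `0`. -/
noncomputable def color : ℕ → ℕ := fill D.colorStep

/-- The palette of a flow: `0` for the small flows, and determined by the valuation of the rank of
the node for the large ones. -/
noncomputable def key (i : ℕ) : ℕ :=
  if D.group i < D.K then 0 else padicValNat 2 (D.rank (D.group i - D.K)) + 1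

/-- The round of a flow encodes its palette, colour and level. -/
noncomputable def round (i : ℕ) : ℕ := D.key i + (D.K + 1) * (D.color i + 3 * D.level i)

/-- The conditions under which the first `n` flows of the data are flows on the path with `m` edges
of capacities `cap`. -/
structure Valid (D : Data) (m n : ℕ) (cap : ℕ → ℝ) : Prop where
  src_lt_snk : ∀ i < n, D.src i < D.snk i
  snk_le : ∀ i < n, D.snk i ≤ m
  size_pos : ∀ i < n, 0 < D.size i
  size_le : ∀ i < n, D.size i ≤ D.bot i
  exists_bot : ∀ i < n, ∃ e, D.Uses i e ∧ cap e = D.bot i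
  bot_le : ∀ i < n, ∀ e, D.Uses i e → D.bot i ≤ cap e
  val_pos : ∀ j < D.K, 0 < D.val j
  exists_val : ∀ i < n, ∃ j < D.K, D.val j = D.bot i

/-- A set of flows is feasible for the capacities. -/
def FeasibleSet (m : ℕ) (cap : ℕ → ℝ) (S : Finset ℕ) : Prop :=
  ∀ e < m, ∑ i ∈ S with D.Uses i e, D.size i ≤ cap e

variable {D} {m n : ℕ} {cap : ℕ → ℝ}

/-! ### Anchors -/

theorem anchor_eq_one_iff {i : ℕ} :
    D.anchor i = 1 ↔ ∀ j < i, D.anchor j = 1 → ¬ Near (D.val j) (D.val i) := by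
  rw [anchor, fill_eq, anchorStep]
  split_ifs with h
  · simp only [true_iff]
    intro j hj h1
    exact h j hj (by rw [if_pos hj]; exact h1)
  · simp only [false_iff]
    intro h'
    apply h
    intro j hj h1
    rw [if_pos hj] at h1
    exact h' j hj h1

theorem not_near_of_anchor {i j : ℕ} (hi : D.anchor i = 1) (hj : D.anchor j = 1) (hij : i ≠ j) :
    ¬ Near (D.val i) (D.val j) := by
  rcases lt_or_gt_of_ne hij with h | h
  · exact anchor_eq_one_iff.1 hj i h hi
  · exact fun hn => anchor_eq_one_iff.1 hi j h hj hn.symm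

theorem exists_anchor_near {j : ℕ} (hj : 0 < D.val j) :
    ∃ k ≤ j, D.anchor k = 1 ∧ Near (D.val k) (D.val j) := by
  by_cases h : D.anchor j = 1
  · exact ⟨j, le_rfl, h, by constructor <;> linarith⟩
  · rw [anchor_eq_one_iff] at h
    push Not at h
    obtain ⟨k, hk, h1, h2⟩ := h
    exact ⟨k, hk.le, h1, h2⟩

/-- The larger one of two anchors is at least twice as large. -/
theorem two_mul_le_of_anchor_lt {i j : ℕ} (hi : D.anchor i = 1) (hj : D.anchor j = 1)
    (h0 : 0 < D.val j) (h : D.val i < D.val j) : 2 * D.val i ≤ D.val j := by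
  by_contra hlt
  push Not at hlt
  exact not_near_of_anchor hi hj (by rintro rfl; exact lt_irrefl _ h) ⟨by linarith, hlt⟩

theorem anchor_injOn {i j : ℕ} (hi : D.anchor i = 1) (hj : D.anchor j = 1)
    (h0 : 0 < D.val i) (h : D.val i = D.val j) : i = j := by
  by_contra hne
  exact not_near_of_anchor hi hj hne ⟨by linarith, by linarith⟩

variable (D) in
/-- The set of the anchors. -/
noncomputable def anchors : Finset ℕ := (range D.K).filter (fun j => D.anchor j = 1)

theorem rank_eq_card (j : ℕ) : D.rank j = #{k ∈ D.anchors | D.val k ≤ D.val j} := by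
  rw [rank, anchors, Finset.filter_filter, Finset.card_filter]

theorem rank_pos {j : ℕ} (hj : j ∈ D.anchors) : 0 < D.rank j := by
  rw [rank_eq_card, Finset.card_pos]
  exact ⟨j, by simp [hj]⟩

theorem rank_le (j : ℕ) : D.rank j ≤ #D.anchors := by
  rw [rank_eq_card]
  exact Finset.card_filter_le _ _

theorem rank_lt_of_val_lt {i j : ℕ} (hj : j ∈ D.anchors) (h : D.val i < D.val j) :
    D.rank i < D.rank j := by
  rw [rank_eq_card, rank_eq_card]
  apply Finset.card_lt_card
  rw [Finset.ssubset_iff_of_subset]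
  · exact ⟨j, by simp [hj], by simp [hj, h]⟩
  · intro k hk
    simp only [mem_filter] at hk ⊢
    exact ⟨hk.1, hk.2.trans h.le⟩

theorem val_lt_of_rank_lt {i j : ℕ} (hi : i ∈ D.anchors) (h : D.rank i < D.rank j) :
    D.val i < D.val j := by
  by_contra hle
  rw [not_lt] at hle
  rcases hle.lt_or_eq with h' | h'
  · exact absurd (rank_lt_of_val_lt hi h') (by omega)
  · rw [rank_eq_card, rank_eq_card, h'] at h
    exact lt_irrefl _ h

/-- Every number from `1` to the number of anchors is the rank of an anchor. -/
theorem exists_rank_eq (hpos : ∀ j < D.K, 0 < D.val j) {k : ℕ} (h1 : 0 < k)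
    (h2 : k ≤ #D.anchors) : ∃ j ∈ D.anchors, D.rank j = k := by
  have hinj : Set.InjOn D.rank D.anchors := by
    intro i hi j hj hij
    have hi' : i < D.K ∧ D.anchor i = 1 := by simpa [anchors] using hi
    have hj' : j < D.K ∧ D.anchor j = 1 := by simpa [anchors] using hj
    rcases lt_trichotomy (D.val i) (D.val j) with h | h | h
    · exact absurd (rank_lt_of_val_lt hj h) (by omega)
    · exact anchor_injOn hi'.2 hj'.2 (hpos i hi'.1) h
    · exact absurd (rank_lt_of_val_lt hi h) (by omega)
  have himg : D.anchors.image D.rank = Finset.Icc 1 #D.anchors := by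
    apply Finset.eq_of_subset_of_card_le
    · intro r hr
      obtain ⟨j, hj, rfl⟩ := Finset.mem_image.1 hr
      exact Finset.mem_Icc.2 ⟨rank_pos hj, rank_le j⟩
    · rw [Finset.card_image_of_injOn hinj]
      simp
  have : k ∈ D.anchors.image D.rank := by
    rw [himg]
    exact Finset.mem_Icc.2 ⟨h1, h2⟩
  obtain ⟨j, hj, hjk⟩ := Finset.mem_image.1 this
  exact ⟨j, hj, hjk⟩

/-- Anchors grow geometrically, so that their sum is at most twice an upper bound. -/
theorem sum_val_anchor_le (S : Finset ℕ) : ∀ (X : ℝ), 0 ≤ X →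
    (∀ j ∈ S, D.anchor j = 1 ∧ 0 < D.val j ∧ D.val j ≤ X) → ∑ j ∈ S, D.val j ≤ 2 * X := by
  induction S using Finset.strongInduction with
  | H S ih =>
    intro X hX h
    rcases S.eq_empty_or_nonempty with rfl | hne
    · simpa using hX
    · obtain ⟨j, hj, hmax⟩ := Finset.exists_max_image S D.val hne
      have hj' := h j hj
      have := ih (S.erase j) (Finset.erase_ssubset hj) (D.val j / 2) (by linarith) (by
        intro i hi
        have hi' := Finset.mem_erase.1 hi
        have h1 := h i hi'.2
        refine ⟨h1.1, h1.2.1, ?_⟩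
        have hlt : D.val i < D.val j := by
          refine lt_of_le_of_ne (hmax i hi'.2) fun heq => hi'.1 ?_
          exact anchor_injOn h1.1 hj'.1 h1.2.1 heq
        linarith [two_mul_le_of_anchor_lt h1.1 hj'.1 hj'.2.1 hlt])
      rw [← Finset.add_sum_erase S _ hj]
      linarith

/-- If the values lie between `c` and `C`, then there are at most `1 + log₂ (C / c)` anchors. -/
theorem two_pow_card_anchors_le (S : Finset ℕ) : ∀ (c C : ℝ), 0 < c →
    (∀ j ∈ S, D.anchor j = 1 ∧ c ≤ D.val j ∧ D.val j ≤ C) → S.Nonempty →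
    2 ^ (#S - 1) * c ≤ C := by
  induction S using Finset.strongInduction with
  | H S ih =>
    intro c C hc h hne
    obtain ⟨j, hj, hmax⟩ := Finset.exists_max_image S D.val hne
    have hj' := h j hj
    rcases (S.erase j).eq_empty_or_nonempty with he | he
    · have : #S = 1 := by
        have := Finset.card_erase_add_one hj
        rw [he] at this
        simpa using this.symm
      rw [this]
      simp
      linarith
    · have := ih (S.erase j) (Finset.erase_ssubset hj) c (D.val j / 2) hc (by
        intro i hi
        have hi' := Finset.mem_erase.1 hi
        have h1 := h i hi'.2
        refine ⟨h1.1, h1.2.1, ?_⟩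
        have hlt : D.val i < D.val j := by
          refine lt_of_le_of_ne (hmax i hi'.2) fun heq => hi'.1 ?_
          exact anchor_injOn h1.1 hj'.1 (by linarith) heq
        linarith [two_mul_le_of_anchor_lt h1.1 hj'.1 (by linarith) hlt]) he
      have hcard : #S - 1 = (#(S.erase j) - 1) + 1 := by
        rw [Finset.card_erase_of_mem hj]
        have : 0 < #(S.erase j) := Finset.card_pos.2 he
        rw [Finset.card_erase_of_mem hj] at this
        omega
      rw [hcard, pow_succ]
      linarith

/-! ### Groups, levels and colours -/

/-- The flows of `S` all use the edge `e` and each has a marked edge `p i`.  Among those whose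
marked edge lies to the left of `e`, the one with the rightmost marked edge `p i₀` has the property that
all of them use `p i₀`; and likewise on the right.  Therefore a bound for the families with such
an `i₀` costs only a factor of two on `S`. -/
theorem sum_le_two_mul_of_marked {S : Finset ℕ} {e : ℕ} {p : ℕ → ℕ} {w : ℕ → ℝ} {B : ℝ}
    (hB : 0 ≤ B) (hS : ∀ i ∈ S, D.Uses i e) (hp : ∀ i ∈ S, D.Uses i (p i))
    (h : ∀ T ⊆ S, ∀ i₀ ∈ T, (∀ j ∈ T, D.Uses j (p i₀)) → ∑ i ∈ T, w i ≤ B) :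
    ∑ i ∈ S, w i ≤ 2 * B := by
  have h1 : ∑ i ∈ S with p i ≤ e, w i ≤ B := by
    rcases (S.filter (fun i => p i ≤ e)).eq_empty_or_nonempty with he | hne
    · rw [he]; simpa using hB
    · obtain ⟨i₀, hi₀, hmax⟩ := Finset.exists_max_image _ p hne
      refine h _ (Finset.filter_subset _ _) i₀ hi₀ fun j hj => ?_
      have hj' := Finset.mem_filter.1 hj
      have hi' := Finset.mem_filter.1 hi₀
      exact ⟨(hp j hj'.1).1.trans (hmax j hj), lt_of_le_of_lt hi'.2 (hS j hj'.1).2⟩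
  have h2 : ∑ i ∈ S with ¬ p i ≤ e, w i ≤ B := by
    rcases (S.filter (fun i => ¬ p i ≤ e)).eq_empty_or_nonempty with he | hne
    · rw [he]; simpa using hB
    · obtain ⟨i₀, hi₀, hmin⟩ := Finset.exists_min_image _ p hne
      refine h _ (Finset.filter_subset _ _) i₀ hi₀ fun j hj => ?_
      have hj' := Finset.mem_filter.1 hj
      have hi' := Finset.mem_filter.1 hi₀
      exact ⟨(hS j hj'.1).1.trans (not_le.1 hi'.2).le,
        lt_of_le_of_lt (hmin j hj) (hp j hj'.1).2⟩
  rw [← Finset.sum_filter_add_sum_filter_not S (fun i => p i ≤ e)]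
  linarith

theorem cls_spec (hV : D.Valid m n cap) {i : ℕ} (hi : i < n) :
    D.cls i < D.K ∧ D.anchor (D.cls i) = 1 ∧ Near (D.val (D.cls i)) (D.bot i) := by
  obtain ⟨j, hj, hjv⟩ := hV.exists_val i hi
  obtain ⟨k, hk, h1, h2⟩ := exists_anchor_near (hV.val_pos j hj)
  exact leastBelow_spec (P := fun j => D.anchor j = 1 ∧ Near (D.val j) (D.bot i))
    ⟨k, by omega, h1, hjv ▸ h2⟩

theorem bot_pos (hV : D.Valid m n cap) {i : ℕ} (hi : i < n) : 0 < D.bot i :=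
  (hV.size_pos i hi).trans_le (hV.size_le i hi)

theorem node_spec (hV : D.Valid m n cap) {i : ℕ} (hi : i < n) :
    D.node i < D.K ∧ D.Meets i (D.node i) ∧
      ∀ k < D.K, D.Meets i k → padicValNat 2 (D.rank k) ≤ padicValNat 2 (D.rank (D.node i)) := by
  have hne : ((range D.K).filter (fun j => D.Meets i j)).Nonempty := by
    obtain ⟨h1, h2, h3⟩ := cls_spec hV hi
    refine ⟨D.cls i, ?_⟩
    simp only [mem_filter, mem_range]
    refine ⟨h1, h2, ?_, h3.1⟩
    have := hV.size_pos i hi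
    linarith [h3.2]
  obtain ⟨j, hj, hmax⟩ := Finset.exists_max_image _ (fun j => padicValNat 2 (D.rank j)) hne
  simp only [mem_filter, mem_range] at hj hmax
  exact leastBelow_spec (P := fun j => D.Meets i j ∧
    ∀ k < D.K, D.Meets i k → padicValNat 2 (D.rank k) ≤ padicValNat 2 (D.rank j))
    ⟨j, hj.1, hj.2, fun k hk hm => hmax k ⟨hk, hm⟩⟩

theorem group_lt_iff (hV : D.Valid m n cap) {i : ℕ} (hi : i < n) :
    D.group i < D.K ↔ 32 * D.size i ≤ D.bot i := by
  rw [group]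
  split_ifs with h
  · simp [h, (cls_spec hV hi).1]
  · simp [h]

theorem group_of_small (hV : D.Valid m n cap) {i : ℕ} (hi : i < n) (h : D.group i < D.K) :
    D.group i = D.cls i := by
  rw [group, if_pos ((group_lt_iff hV hi).1 h)]

theorem group_of_large (hV : D.Valid m n cap) {i : ℕ} (hi : i < n) (h : ¬ D.group i < D.K) :
    D.group i = D.K + D.node i := by
  rw [group, if_neg (fun h' => h ((group_lt_iff hV hi).2 h'))]

theorem unit_congr {i j : ℕ} (h : D.group i = D.group j) : D.unit i = D.unit j := by
  rw [unit, unit, h]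

theorem weight_pos (hV : D.Valid m n cap) {i : ℕ} (hi : i < n) : 0 < D.weight i := by
  rw [weight]
  split_ifs
  · linarith [hV.size_pos i hi]
  · norm_num

theorem weight_le_unit (hV : D.Valid m n cap) {i : ℕ} (hi : i < n) : D.weight i ≤ D.unit i := by
  rw [weight, unit]
  split_ifs with h
  · rw [group_of_small hV hi h]
    have h1 := (cls_spec hV hi).2.2.2
    have h2 := (group_lt_iff hV hi).1 h
    linarith
  · exact le_rfl

theorem unit_pos (hV : D.Valid m n cap) {i : ℕ} (hi : i < n) : 0 < D.unit i :=
  (weight_pos hV hi).trans_le (weight_le_unit hV hi)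

/-- The flows before `N` in the group `γ` that use the edge `e`. -/
noncomputable def onEdge (D : Data) (N γ e : ℕ) : Finset ℕ :=
  {j ∈ range N | D.group j = γ ∧ D.Uses j e}

theorem mem_onEdge {N γ e j : ℕ} :
    j ∈ D.onEdge N γ e ↔ j < N ∧ D.group j = γ ∧ D.Uses j e := by
  simp [onEdge]

/-- The condition under which the flow `i` fits into the levels `≤ h`. -/
def Fits (D : Data) (i h : ℕ) : Prop :=
  ∀ e, D.Uses i e →
    ∑ j ∈ D.onEdge i (D.group i) e with D.level j ≤ h, D.weight j + D.weight i ≤ (h + 1) * D.unit i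

theorem level_eq (i : ℕ) : D.level i = leastBelow (i + 1) (D.Fits i) := by
  rw [level, fill_eq, levelStep]
  congr 1
  funext h
  apply propext
  have key : ∀ e, (∑ j ∈ range i, if D.group j = D.group i ∧
      (if j < i then fill D.levelStep j else 0) ≤ h ∧ D.Uses j e then D.weight j else 0)
      = ∑ j ∈ D.onEdge i (D.group i) e with D.level j ≤ h, D.weight j := by
    intro e
    rw [onEdge, Finset.filter_filter, Finset.sum_filter]
    refine Finset.sum_congr rfl fun j hj => ?_
    rw [if_pos (Finset.mem_range.1 hj)]
    have : (D.group j = D.group i ∧ fill D.levelStep j ≤ h ∧ D.Uses j e) ↔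
        ((D.group j = D.group i ∧ D.Uses j e) ∧ D.level j ≤ h) := by
      rw [level]; tauto
    simp only [this]
  simp only [key, Fits, Finset.sum_const, Finset.card_range, nsmul_eq_mul, Nat.cast_add,
    Nat.cast_one]
  exact ⟨fun H e he => H e he.2 he.1, fun H e h1 h2 => H e ⟨h2, h1⟩⟩

theorem exists_fits (hV : D.Valid m n cap) {i : ℕ} (hi : i < n) : D.Fits i i := by
  intro e he
  have h1 : ∑ j ∈ D.onEdge i (D.group i) e with D.level j ≤ i, D.weight j
      ≤ ∑ j ∈ range i, D.unit i := by
    calc _ ≤ ∑ j ∈ D.onEdge i (D.group i) e with D.level j ≤ i, D.unit i := by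
          refine Finset.sum_le_sum fun j hj => ?_
          have hj' := mem_onEdge.1 (Finset.mem_filter.1 hj).1
          rw [← unit_congr hj'.2.1]
          exact weight_le_unit hV (hj'.1.trans hi)
      _ ≤ _ := by
          refine Finset.sum_le_sum_of_subset_of_nonneg ?_ fun _ _ _ => (unit_pos hV hi).le
          intro j hj
          exact Finset.mem_range.2 (mem_onEdge.1 (Finset.mem_filter.1 hj).1).1
  have h2 := weight_le_unit hV hi
  simp only [Finset.sum_const, Finset.card_range, nsmul_eq_mul] at h1
  linarith

theorem fits_level (hV : D.Valid m n cap) {i : ℕ} (hi : i < n) : D.Fits i (D.level i) := by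
  rw [level_eq]
  exact (leastBelow_spec ⟨i, i.lt_succ_self, exists_fits hV hi⟩).2

theorem level_le_of_fits {i h : ℕ} (hf : D.Fits i h) : D.level i ≤ h := by
  rw [level_eq]
  exact leastBelow_le hf

/-- Every flow `i` has an edge on which the lower levels, together with `i` itself, exceed their
capacity `level i * unit i`. -/
theorem exists_blocked (hV : D.Valid m n cap) {i : ℕ} (hi : i < n) :
    ∃ p, D.Uses i p ∧ D.level i * D.unit i <
      ∑ j ∈ D.onEdge i (D.group i) p with D.level j < D.level i, D.weight j + D.weight i := by
  rcases Nat.eq_zero_or_pos (D.level i) with h0 | hpos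
  · refine ⟨D.src i, ⟨le_rfl, hV.src_lt_snk i hi⟩, ?_⟩
    simp [h0, weight_pos hV hi]
  · have hn : ¬ D.Fits i (D.level i - 1) := fun hf => by
      have := level_le_of_fits hf
      omega
    simp only [Fits] at hn
    push Not at hn
    obtain ⟨p, hp, hlt⟩ := hn
    refine ⟨p, hp, ?_⟩
    have e1 : ((D.level i - 1 : ℕ) : ℝ) + 1 = D.level i := by
      rw [Nat.cast_sub hpos]; simp
    rw [e1] at hlt
    have e2 : ∀ j, D.level j ≤ D.level i - 1 ↔ D.level j < D.level i := fun j => by omega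
    simpa only [e2] using hlt

variable (D n) in
/-- The flows on the edge `e` that have the group and the level of the flow `i`. -/
noncomputable def peers (i e : ℕ) : Finset ℕ :=
  {j ∈ D.onEdge n (D.group i) e | D.level j = D.level i}

theorem mem_peers {i e j : ℕ} : j ∈ D.peers n i e ↔
    j < n ∧ D.group j = D.group i ∧ D.level j = D.level i ∧ D.Uses j e := by
  simp only [peers, mem_filter, mem_onEdge]
  tauto

/-- Every flow has a marked edge on which the flows of its group and level weigh less than two
units: the lower levels block the edge when the flow arrives, and the last flow of the level on
this edge still fits. -/
theorem exists_marked (hV : D.Valid m n cap) {i : ℕ} (hi : i < n) :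
    ∃ p, D.Uses i p ∧ ∑ j ∈ D.peers n i p, D.weight j < 2 * D.unit i := by
  obtain ⟨p, hp, hlt⟩ := exists_blocked hV hi
  refine ⟨p, hp, ?_⟩
  have hmem : i ∈ D.peers n i p := mem_peers.2 ⟨hi, rfl, rfl, hp⟩
  obtain ⟨l, hl, hmax⟩ := Finset.exists_max_image _ id ⟨i, hmem⟩
  simp only [id] at hmax
  have hl' := mem_peers.1 hl
  have hfit := fits_level hV hl'.1 p hl'.2.2.2
  rw [hl'.2.1, hl'.2.2.1, unit_congr hl'.2.1] at hfit
  have hil : i ≤ l := hmax i hmem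
  -- the peers and the blocking flows are flows of levels `≤ level i` that arrived up to `l`
  have hsplit : ∑ j ∈ D.peers n i p, D.weight j
      + ∑ j ∈ D.onEdge i (D.group i) p with D.level j < D.level i, D.weight j
      ≤ ∑ j ∈ D.onEdge l (D.group i) p with D.level j ≤ D.level i, D.weight j + D.weight l := by
    rw [← Finset.sum_erase_add _ _ hl]
    have hdisj : Disjoint ((D.peers n i p).erase l)
        ((D.onEdge i (D.group i) p).filter (fun j => D.level j < D.level i)) := by
      rw [Finset.disjoint_left]
      intro j h1 h2
      have h1' := (mem_peers.1 (Finset.mem_of_mem_erase h1)).2.2.1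
      have h2' := (Finset.mem_filter.1 h2).2
      omega
    have hle : ∑ j ∈ (D.peers n i p).erase l ∪
        (D.onEdge i (D.group i) p).filter (fun j => D.level j < D.level i), D.weight j
        ≤ ∑ j ∈ D.onEdge l (D.group i) p with D.level j ≤ D.level i, D.weight j := by
      refine Finset.sum_le_sum_of_subset_of_nonneg ?_ fun j hj _ => ?_
      · intro j hj
        rw [Finset.mem_filter, mem_onEdge]
        rcases Finset.mem_union.1 hj with h | h
        · have h' := mem_peers.1 (Finset.mem_of_mem_erase h)
          have hjl := hmax j (Finset.mem_of_mem_erase h)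
          have hne := Finset.ne_of_mem_erase h
          exact ⟨⟨by omega, h'.2.1, h'.2.2.2⟩, h'.2.2.1.le⟩
        · have h' := Finset.mem_filter.1 h
          have h'' := mem_onEdge.1 h'.1
          exact ⟨⟨by omega, h''.2⟩, h'.2.le⟩
      · exact (weight_pos hV ((mem_onEdge.1 (Finset.mem_filter.1 hj).1).1.trans hl'.1)).le
    rw [Finset.sum_union hdisj] at hle
    linarith
  have := weight_le_unit hV hi
  linarith

/-- On every edge the flows of one group and level weigh at most four units. -/
theorem sum_peers_le (hV : D.Valid m n cap) {i : ℕ} (hi : i < n) (e : ℕ) :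
    ∑ j ∈ D.peers n i e, D.weight j ≤ 4 * D.unit i := by
  have hex : ∀ j, ∃ p, j < n → D.Uses j p ∧ ∑ k ∈ D.peers n j p, D.weight k < 2 * D.unit j := by
    intro j
    by_cases hj : j < n
    · obtain ⟨p, hp⟩ := exists_marked hV hj
      exact ⟨p, fun _ => hp⟩
    · exact ⟨0, fun h => absurd h hj⟩
  choose p hp using hex
  have h2 := sum_le_two_mul_of_marked (D := D) (S := D.peers n i e) (e := e) (p := p)
    (w := D.weight) (B := 2 * D.unit i) (by linarith [unit_pos hV hi])
    (fun j hj => (mem_peers.1 hj).2.2.2) (fun j hj => (hp j (mem_peers.1 hj).1).1) (by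
      intro T hT i₀ hi₀ hall
      have h0 := mem_peers.1 (hT hi₀)
      have hlt := (hp i₀ h0.1).2
      rw [unit_congr h0.2.1] at hlt
      refine le_trans (Finset.sum_le_sum_of_subset_of_nonneg ?_ ?_) hlt.le
      · intro j hj
        have hj' := mem_peers.1 (hT hj)
        exact mem_peers.2 ⟨hj'.1, hj'.2.1.trans h0.2.1.symm, hj'.2.2.1.trans h0.2.2.1.symm,
          hall j hj⟩
      · intro j hj _
        exact (weight_pos hV (mem_peers.1 hj).1).le)
  linarith

/-- A large flow has a marked edge that no other flow of its group and level uses. -/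
theorem exists_private_edge (hV : D.Valid m n cap) {i : ℕ} (hi : i < n)
    (hlarge : ¬ D.group i < D.K) :
    ∃ p, D.Uses i p ∧ ∀ j ∈ D.peers n i p, j = i := by
  obtain ⟨p, hp, hlt⟩ := exists_marked hV hi
  refine ⟨p, hp, ?_⟩
  have h1 : ∑ j ∈ D.peers n i p, D.weight j = #(D.peers n i p) := by
    rw [Finset.card_eq_sum_ones, Nat.cast_sum]
    refine Finset.sum_congr rfl fun j hj => ?_
    rw [weight, (mem_peers.1 hj).2.1, if_neg hlarge]
    simp
  rw [h1, unit, if_neg hlarge] at hlt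
  have hcard : #(D.peers n i p) ≤ 1 := by
    have : #(D.peers n i p) < 2 := by
      have h2 : ((#(D.peers n i p) : ℕ) : ℝ) < ((2 : ℕ) : ℝ) := by push_cast; linarith
      exact_mod_cast h2
    omega
  intro j hj
  exact Finset.card_le_one.1 hcard j hj i (mem_peers.2 ⟨hi, rfl, rfl, hp⟩)

theorem color_eq (i : ℕ) : D.color i = leastBelow 3 (fun c => D.K ≤ D.group i →
    ∀ j < i, D.group j = D.group i → D.level j = D.level i → D.color j = c →
      ¬ (D.src j < D.snk i ∧ D.src i < D.snk j)) := by
  rw [color, fill_eq, colorStep]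
  congr 1
  funext c
  apply propext
  refine imp_congr Iff.rfl (forall_congr' fun j => ⟨fun h hj => ?_, fun h hj => ?_⟩)
  · have := h hj
    rwa [if_pos hj] at this
  · rw [if_pos hj]
    exact h hj

/-- Three colours suffice: among the flows of its group and level, a large flow intersects at most
one flow to the left and at most one to the right of its private edge. -/
theorem exists_color (hV : D.Valid m n cap) {i : ℕ} (hi : i < n) :
    ∃ c < 3, D.K ≤ D.group i → ∀ j < i, D.group j = D.group i → D.level j = D.level i →
      D.color j = c → ¬ (D.src j < D.snk i ∧ D.src i < D.snk j) := by
  by_cases hlarge : D.group i < D.K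
  · exact ⟨0, by norm_num, fun h => absurd hlarge (not_lt.2 h)⟩
  have hex : ∀ j, ∃ p, j < n → D.group j = D.group i →
      D.Uses j p ∧ ∀ k ∈ D.peers n j p, k = j := by
    intro j
    by_cases hj : j < n ∧ D.group j = D.group i
    · obtain ⟨p, hp⟩ := exists_private_edge hV hj.1 (by rw [hj.2]; exact hlarge)
      exact ⟨p, fun _ _ => hp⟩
    · exact ⟨0, fun h h' => absurd ⟨h, h'⟩ hj⟩
  choose p hp using hex
  let R : Finset ℕ := {j ∈ range i | D.group j = D.group i ∧ D.level j = D.level i ∧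
    (D.src j < D.snk i ∧ D.src i < D.snk j)}
  have hR : ∀ j, j ∈ R ↔ j < i ∧ D.group j = D.group i ∧ D.level j = D.level i ∧
    (D.src j < D.snk i ∧ D.src i < D.snk j) := fun j => by simp [R]
  have huses : ∀ j k, j < n → k < n → D.group j = D.group i → D.group k = D.group i →
      D.level j = D.level i → D.level k = D.level i → D.Uses j (p k) → j = k :=
    fun j k hj hk h1 h2 h3 h4 hu =>
      (hp k hk h2).2 j (mem_peers.2 ⟨hj, h1.trans h2.symm, h3.trans h4.symm, hu⟩)
  -- two neighbours on the same side would contain a private edge of each other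
  have hleft : #{j ∈ R | p j < p i} ≤ 1 := by
    rw [Finset.card_le_one]
    have aux : ∀ a ∈ R, ∀ b ∈ R, p a < p i → p b < p i → p a ≤ p b → a = b := by
      intro a ha b hb hai hbi hab
      rw [hR] at ha hb
      refine huses a b (ha.1.trans hi) (hb.1.trans hi) ha.2.1 hb.2.1 ha.2.2.1 hb.2.2.1 ?_
      have ua := (hp a (ha.1.trans hi) ha.2.1).1
      have ui := (hp i hi rfl).1
      have hnb : ¬ D.Uses i (p b) := fun h =>
        (ne_of_gt hb.1) (huses i b hi (hb.1.trans hi) rfl hb.2.1 rfl hb.2.2.1 h)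
      have : p b < D.src i := by
        by_contra hc
        exact hnb ⟨not_lt.1 hc, hbi.trans ui.2⟩
      exact ⟨ua.1.trans hab, this.trans ha.2.2.2.2⟩
    intro a ha b hb
    rw [mem_filter] at ha hb
    rcases le_total (p a) (p b) with h | h
    · exact aux a ha.1 b hb.1 ha.2 hb.2 h
    · exact (aux b hb.1 a ha.1 hb.2 ha.2 h).symm
  have hright : #{j ∈ R | ¬ p j < p i} ≤ 1 := by
    rw [Finset.card_le_one]
    have aux : ∀ a ∈ R, ∀ b ∈ R, ¬ p a < p i → ¬ p b < p i → p a ≤ p b → a = b := by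
      intro a ha b hb hai hbi hab
      rw [hR] at ha hb
      symm
      refine huses b a (hb.1.trans hi) (ha.1.trans hi) hb.2.1 ha.2.1 hb.2.2.1 ha.2.2.1 ?_
      have ub := (hp b (hb.1.trans hi) hb.2.1).1
      have ui := (hp i hi rfl).1
      have hna : ¬ D.Uses i (p a) := fun h =>
        (ne_of_gt ha.1) (huses i a hi (ha.1.trans hi) rfl ha.2.1 rfl ha.2.2.1 h)
      have : D.snk i ≤ p a := by
        by_contra hc
        exact hna ⟨ui.1.trans (not_lt.1 hai), not_le.1 hc⟩
      exact ⟨(hb.2.2.2.1.trans_le this).le, lt_of_le_of_lt hab ub.2⟩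
    intro a ha b hb
    rw [mem_filter] at ha hb
    rcases le_total (p a) (p b) with h | h
    · exact aux a ha.1 b hb.1 ha.2 hb.2 h
    · exact (aux b hb.1 a ha.1 hb.2 ha.2 h).symm
  have hcard : #(R.image D.color) < #(range 3) := by
    have := Finset.card_filter_add_card_filter_not (s := R) (fun j => p j < p i)
    have := Finset.card_image_le (s := R) (f := D.color)
    simp only [card_range]
    omega
  obtain ⟨c, hc, hcR⟩ := Finset.exists_mem_notMem_of_card_lt_card hcard
  refine ⟨c, Finset.mem_range.1 hc, fun _ j hj h1 h2 h3 h4 => hcR ?_⟩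
  exact Finset.mem_image.2 ⟨j, (hR j).2 ⟨hj, h1, h2, h4⟩, h3⟩

theorem color_lt (hV : D.Valid m n cap) {i : ℕ} (hi : i < n) : D.color i < 3 := by
  rw [color_eq]
  exact (leastBelow_spec (exists_color hV hi)).1

/-- Large flows of the same group, level and colour have no edge in common. -/
theorem color_ne (hV : D.Valid m n cap) {i j : ℕ} (hi : i < n) (hj : j < i)
    (hlarge : ¬ D.group i < D.K) (hg : D.group j = D.group i) (hl : D.level j = D.level i) {e : ℕ}
    (hie : D.Uses i e) (hje : D.Uses j e) : D.color j ≠ D.color i := by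
  intro hc
  have := (leastBelow_spec (exists_color hV hi)).2
  rw [← color_eq] at this
  exact this (not_lt.1 hlarge) j hj hg hl hc
    ⟨lt_of_le_of_lt hje.1 hie.2, lt_of_le_of_lt hie.1 hje.2⟩

/-! ### Feasibility of the rounds -/

theorem meets_cls (hV : D.Valid m n cap) {i : ℕ} (hi : i < n) : D.Meets i (D.cls i) := by
  obtain ⟨_, h2, h3⟩ := cls_spec hV hi
  have := hV.size_pos i hi
  exact ⟨h2, by linarith [h3.2], h3.1⟩

theorem node_mem_anchors (hV : D.Valid m n cap) {i : ℕ} (hi : i < n) : D.node i ∈ D.anchors := by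
  obtain ⟨h1, h2, _⟩ := node_spec hV hi
  simp [anchors, h1, h2.1]

theorem key_of_large (hV : D.Valid m n cap) {i : ℕ} (hi : i < n) (h : ¬ D.group i < D.K) :
    D.key i = padicValNat 2 (D.rank (D.node i)) + 1 := by
  rw [key, if_neg h, group_of_large hV hi h, Nat.add_sub_cancel_left]

theorem key_le (hV : D.Valid m n cap) {i : ℕ} (hi : i < n) : D.key i ≤ D.K := by
  by_cases h : D.group i < D.K
  · simp [key, h]
  · rw [key_of_large hV hi h]
    have h1 := padicValNat_two_lt (rank_pos (node_mem_anchors hV hi))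
    have h2 := rank_le (D := D) (D.node i)
    have h3 : #D.anchors ≤ D.K := by
      simpa [anchors] using Finset.card_filter_le (range D.K) (fun j => D.anchor j = 1)
    omega

/-- The round determines palette, colour and level. -/
theorem round_inj (hV : D.Valid m n cap) {i j : ℕ} (hi : i < n) (hj : j < n)
    (h : D.round i = D.round j) :
    D.key i = D.key j ∧ D.color i = D.color j ∧ D.level i = D.level j := by
  have ki := key_le hV hi
  have kj := key_le hV hj
  have ci := color_lt hV hi
  have cj := color_lt hV hj
  simp only [round] at h
  have h1 := congrArg (· % (D.K + 1)) h
  have h2 := congrArg (· / (D.K + 1)) h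
  simp only [Nat.add_mul_mod_self_left] at h1
  rw [Nat.mod_eq_of_lt (by omega), Nat.mod_eq_of_lt (by omega)] at h1
  simp only [Nat.add_mul_div_left _ _ (Nat.succ_pos D.K)] at h2
  rw [Nat.div_eq_of_lt (by omega), Nat.div_eq_of_lt (by omega)] at h2
  omega

/-- Two flows that meet a common anchor and whose nodes have ranks of the same valuation have the
same node: between two different ranks there would be one of larger valuation, and its
anchor would be met by one of the two flows. -/
theorem node_eq_of_common_anchor (hV : D.Valid m n cap) {i j a : ℕ} (hi : i < n) (hj : j < n)
    (hia : D.Meets i a) (hja : D.Meets j a)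
    (hv : padicValNat 2 (D.rank (D.node i)) = padicValNat 2 (D.rank (D.node j))) :
    D.node i = D.node j := by
  have aux : ∀ i j, i < n → j < n → D.Meets i a → D.Meets j a →
      padicValNat 2 (D.rank (D.node i)) = padicValNat 2 (D.rank (D.node j)) →
      ¬ D.rank (D.node i) < D.rank (D.node j) := by
    intro i j hi hj hia hja hv hlt
    obtain ⟨_, mi, maxi⟩ := node_spec hV hi
    obtain ⟨_, mj, maxj⟩ := node_spec hV hj
    have ai := node_mem_anchors hV hi
    have aj := node_mem_anchors hV hj
    obtain ⟨z, z1, z2, z3⟩ := exists_between_padicValNat_gt _ _ (rank_pos ai) hlt hv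
    obtain ⟨k, hk, rfl⟩ := exists_rank_eq hV.val_pos (by omega : 0 < z)
      (z2.le.trans (rank_le _))
    have hk' : k < D.K ∧ D.anchor k = 1 := by simpa [anchors] using hk
    have v1 := val_lt_of_rank_lt ai z1
    have v2 := val_lt_of_rank_lt hk z2
    rcases le_or_gt (D.val k) (D.val a) with h | h
    · have := maxi k hk'.1 ⟨hk'.2, by linarith [mi.2.1], by linarith [hia.2.2]⟩
      omega
    · have := maxj k hk'.1 ⟨hk'.2, by linarith [hja.2.1], by linarith [mj.2.2]⟩
      omega
  have h1 := aux i j hi hj hia hja hv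
  have h2 := aux j i hj hi hja hia hv.symm
  have ai := node_mem_anchors hV hi
  have aj := node_mem_anchors hV hj
  have hi' := node_spec hV hi
  have hj' := node_spec hV hj
  refine anchor_injOn hi'.2.1.1 hj'.2.1.1 (hV.val_pos _ hi'.1) ?_
  rcases lt_trichotomy (D.val (D.node i)) (D.val (D.node j)) with h | h | h
  · exact absurd (rank_lt_of_val_lt aj h) h1
  · exact h
  · exact absurd (rank_lt_of_val_lt ai h) h2

/-- Flows with stacked height intervals `[bot i - size i, bot i)` below `X` have total size at
most `X`. -/
theorem sum_size_le_of_stacked (S : Finset ℕ) : ∀ (X : ℝ), 0 ≤ X →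
    (∀ i ∈ S, 0 < D.size i ∧ D.size i ≤ D.bot i ∧ D.bot i ≤ X) →
    (∀ i ∈ S, ∀ j ∈ S, i ≠ j →
      D.bot i ≤ D.bot j - D.size j ∨ D.bot j ≤ D.bot i - D.size i) →
    ∑ i ∈ S, D.size i ≤ X := by
  induction S using Finset.strongInduction with
  | H S ih =>
    intro X hX h hst
    rcases S.eq_empty_or_nonempty with rfl | hne
    · simpa using hX
    · obtain ⟨i, hi, hmax⟩ := Finset.exists_max_image S D.bot hne
      have hi' := h i hi
      have := ih (S.erase i) (Finset.erase_ssubset hi) (D.bot i - D.size i) (by linarith) (by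
        intro j hj
        have hj' := Finset.mem_erase.1 hj
        have h1 := h j hj'.2
        refine ⟨h1.1, h1.2.1, ?_⟩
        rcases hst j hj'.2 i hi hj'.1 with h2 | h2
        · exact h2
        · linarith [hmax j hj'.2]) (fun a ha b hb =>
          hst a (Finset.mem_of_mem_erase ha) b (Finset.mem_of_mem_erase hb))
      rw [← Finset.add_sum_erase S _ hi]
      linarith

variable (D n) in
/-- The flows of the round of the flow `i` on the edge `e`. -/
noncomputable def roundOnEdge (i e : ℕ) : Finset ℕ :=
  {j ∈ range n | D.round j = D.round i ∧ D.Uses j e}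

theorem mem_roundOnEdge {i e j : ℕ} :
    j ∈ D.roundOnEdge n i e ↔ j < n ∧ D.round j = D.round i ∧ D.Uses j e := by
  simp [roundOnEdge]

theorem group_lt_iff_key (i : ℕ) : D.group i < D.K ↔ D.key i = 0 := by
  rw [key]
  split_ifs with h <;> simp [h]

/-- A round of small flows: every class uses at most a quarter of its anchor, and the anchors
below twice the capacity form a geometric sum. -/
theorem sum_size_small_le (hV : D.Valid m n cap) {i e : ℕ} (hi : i < n) (hie : D.Uses i e)
    (hs : D.group i < D.K) : ∑ j ∈ D.roundOnEdge n i e, D.size j ≤ cap e := by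
  have hcap : 0 < cap e := (bot_pos hV hi).trans_le (hV.bot_le i hi e hie)
  have hmem : ∀ j ∈ D.roundOnEdge n i e, j < n ∧ D.Uses j e ∧ D.group j < D.K ∧
      D.level j = D.level i := by
    intro j hj
    obtain ⟨h1, h2, h3⟩ := mem_roundOnEdge.1 hj
    obtain ⟨k1, _, k3⟩ := round_inj hV h1 hi h2
    refine ⟨h1, h3, ?_, k3⟩
    rw [group_lt_iff_key, k1, ← group_lt_iff_key]
    exact hs
  have hfib : ∀ γ ∈ (D.roundOnEdge n i e).image D.group,
      ∑ j ∈ D.roundOnEdge n i e with D.group j = γ, D.size j ≤ D.val γ / 4 := by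
    intro γ hγ
    obtain ⟨k, hk, rfl⟩ := Finset.mem_image.1 hγ
    obtain ⟨k1, k2, k3, k4⟩ := hmem k hk
    have h4 := sum_peers_le hV k1 e
    have h5 : ∑ j ∈ D.roundOnEdge n i e with D.group j = D.group k, D.weight j
        ≤ ∑ j ∈ D.peers n k e, D.weight j := by
      refine Finset.sum_le_sum_of_subset_of_nonneg ?_ fun j hj _ =>
        (weight_pos hV (mem_peers.1 hj).1).le
      intro j hj
      obtain ⟨j1, j2⟩ := Finset.mem_filter.1 hj
      obtain ⟨l1, l2, l3, l4⟩ := hmem j j1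
      exact mem_peers.2 ⟨l1, j2, l4.trans k4.symm, l2⟩
    have h6 : ∑ j ∈ D.roundOnEdge n i e with D.group j = D.group k, D.weight j
        = 16 * ∑ j ∈ D.roundOnEdge n i e with D.group j = D.group k, D.size j := by
      rw [Finset.mul_sum]
      refine Finset.sum_congr rfl fun j hj => ?_
      rw [weight, if_pos (hmem j (Finset.mem_filter.1 hj).1).2.2.1]
    rw [unit, if_pos k3] at h4
    linarith
  rw [← Finset.sum_fiberwise_of_maps_to (fun j hj => Finset.mem_image_of_mem D.group hj)]
  refine (Finset.sum_le_sum hfib).trans ?_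
  rw [← Finset.sum_div]
  have := sum_val_anchor_le (D := D) ((D.roundOnEdge n i e).image D.group) (2 * cap e)
    (by linarith) (by
      intro γ hγ
      obtain ⟨k, hk, rfl⟩ := Finset.mem_image.1 hγ
      obtain ⟨k1, k2, k3, k4⟩ := hmem k hk
      rw [group_of_small hV k1 k3]
      obtain ⟨c1, c2, c3⟩ := cls_spec hV k1
      exact ⟨c2, hV.val_pos _ c1, by linarith [c3.1, hV.bot_le k k1 e k2]⟩)
  linarith

/-- A round of large flows: the height intervals of the flows on an edge are stacked. -/
theorem sum_size_large_le (hV : D.Valid m n cap) {i e : ℕ} (hi : i < n) (hie : D.Uses i e)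
    (hl : ¬ D.group i < D.K) : ∑ j ∈ D.roundOnEdge n i e, D.size j ≤ cap e := by
  have hcap : 0 < cap e := (bot_pos hV hi).trans_le (hV.bot_le i hi e hie)
  have hmem : ∀ j ∈ D.roundOnEdge n i e, j < n ∧ D.Uses j e ∧ ¬ D.group j < D.K ∧
      D.key j = D.key i ∧ D.color j = D.color i ∧ D.level j = D.level i := by
    intro j hj
    obtain ⟨h1, h2, h3⟩ := mem_roundOnEdge.1 hj
    obtain ⟨k1, k2, k3⟩ := round_inj hV h1 hi h2
    refine ⟨h1, h3, ?_, k1, k2, k3⟩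
    rw [group_lt_iff_key, k1, ← group_lt_iff_key]
    exact hl
  have hnode : ∀ j ∈ D.roundOnEdge n i e, ∀ k ∈ D.roundOnEdge n i e, j ≠ k →
      D.node j ≠ D.node k := by
    intro j hj k hk hjk hn
    obtain ⟨j1, j2, j3, j4, j5, j6⟩ := hmem j hj
    obtain ⟨k1, k2, k3, k4, k5, k6⟩ := hmem k hk
    have hg : D.group j = D.group k := by
      rw [group_of_large hV j1 j3, group_of_large hV k1 k3, hn]
    rcases lt_or_gt_of_ne hjk with h | h
    · exact color_ne hV k1 h k3 hg (j6.trans k6.symm) k2 j2 (j5.trans k5.symm)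
    · exact color_ne hV j1 h j3 hg.symm (k6.trans j6.symm) j2 k2 (k5.trans j5.symm)
  refine sum_size_le_of_stacked _ _ hcap.le (fun j hj => ?_) fun j hj k hk hjk => ?_
  · have h := hmem j hj
    exact ⟨hV.size_pos j h.1, hV.size_le j h.1, hV.bot_le j h.1 e h.2.1⟩
  · obtain ⟨j1, j2, j3, j4, j5, j6⟩ := hmem j hj
    obtain ⟨k1, k2, k3, k4, k5, k6⟩ := hmem k hk
    by_contra hno
    push Not at hno
    have hv : padicValNat 2 (D.rank (D.node j)) = padicValNat 2 (D.rank (D.node k)) := by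
      have := j4.trans k4.symm
      rw [key_of_large hV j1 j3, key_of_large hV k1 k3] at this
      omega
    -- an anchor near the lower one of the two bottlenecks is met by both flows
    rcases le_total (D.bot j) (D.bot k) with h | h
    · have hm := meets_cls hV j1
      obtain ⟨_, _, c3⟩ := cls_spec hV j1
      exact hnode j hj k hk hjk (node_eq_of_common_anchor hV j1 k1 hm
        ⟨hm.1, by linarith [c3.2], by linarith [c3.1]⟩ hv)
    · have hm := meets_cls hV k1
      obtain ⟨_, _, c3⟩ := cls_spec hV k1
      exact hnode j hj k hk hjk (node_eq_of_common_anchor hV j1 k1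
        ⟨hm.1, by linarith [c3.2], by linarith [c3.1]⟩ hm hv)

theorem sum_size_round_le (hV : D.Valid m n cap) (r e : ℕ) (he : 0 ≤ cap e) :
    ∑ i ∈ range n with D.round i = r ∧ D.Uses i e, D.size i ≤ cap e := by
  rcases (filter (fun i => D.round i = r ∧ D.Uses i e) (range n)).eq_empty_or_nonempty with h | h
  · rw [h]; simpa using he
  · obtain ⟨i, hi⟩ := h
    obtain ⟨h1, rfl, h3⟩ := Finset.mem_filter.1 hi
    have h1' := Finset.mem_range.1 h1
    by_cases hs : D.group i < D.K
    · exact sum_size_small_le hV h1' h3 hs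
    · exact sum_size_large_le hV h1' h3 hs

/-! ### Comparison with the optimum -/

theorem exists_bottleneck (hV : D.Valid m n cap) :
    ∃ p : ℕ → ℕ, ∀ i < n, D.Uses i (p i) ∧ p i < m ∧ cap (p i) = D.bot i := by
  have h : ∀ i, ∃ e, i < n → D.Uses i e ∧ e < m ∧ cap e = D.bot i := by
    intro i
    by_cases hi : i < n
    · obtain ⟨e, h1, h2⟩ := hV.exists_bot i hi
      exact ⟨e, fun _ => ⟨h1, h1.2.trans_le (hV.snk_le i hi), h2⟩⟩
    · exact ⟨0, fun h => absurd h hi⟩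
  choose p hp using h
  exact ⟨p, hp⟩

/-- In a feasible set, flows with a common marked bottleneck fit under its capacity. -/
theorem sum_size_le_bot (hV : D.Valid m n cap) {S T : Finset ℕ} (hS : D.FeasibleSet m cap S)
    (hSn : ∀ i ∈ S, i < n) (hT : T ⊆ S) {i₀ p : ℕ} (hp : p < m) (hpb : cap p = D.bot i₀)
    (hall : ∀ j ∈ T, D.Uses j p) : ∑ i ∈ T, D.size i ≤ D.bot i₀ := by
  rw [← hpb]
  refine le_trans (Finset.sum_le_sum_of_subset_of_nonneg ?_ fun j hj _ => ?_) (hS p hp)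
  · exact fun j hj => Finset.mem_filter.2 ⟨hT hj, hall j hj⟩
  · exact (hV.size_pos j (hSn j (Finset.mem_filter.1 hj).1)).le

theorem sum_small_feasible_le (hV : D.Valid m n cap) {S : Finset ℕ} {e : ℕ} {a : ℝ} (ha : 0 ≤ a)
    (hS : D.FeasibleSet m cap S) (hSn : ∀ i ∈ S, i < n) :
    ∑ i ∈ S with D.Uses i e ∧ D.bot i < 2 * a, D.size i ≤ 4 * a := by
  obtain ⟨p, hp⟩ := exists_bottleneck hV
  have hsub : ∀ i ∈ S.filter (fun i => D.Uses i e ∧ D.bot i < 2 * a),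
      i ∈ S ∧ D.Uses i e ∧ D.bot i < 2 * a := fun i hi => Finset.mem_filter.1 hi
  have := sum_le_two_mul_of_marked (D := D) (e := e) (p := p) (w := D.size) (B := 2 * a)
    (S := S.filter (fun i => D.Uses i e ∧ D.bot i < 2 * a)) (by linarith)
    (fun i hi => (hsub i hi).2.1) (fun i hi => (hp i (hSn i (hsub i hi).1)).1) (by
      intro T hT i₀ hi₀ hall
      have h0 := hsub i₀ (hT hi₀)
      obtain ⟨_, h1, h2⟩ := hp i₀ (hSn i₀ h0.1)
      exact (sum_size_le_bot hV hS hSn (hT.trans (Finset.filter_subset _ _)) h1 h2 hall).trans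
        h0.2.2.le)
  linarith

/-- At most `256` large flows of a feasible set use the edge `e` and meet the anchor `a`: on each
side, the flow `i₀` with the nearest bottleneck leaves less than `2 * val a` to the others, each of
which is larger than `val a / 64`. -/
theorem card_large_feasible_le (hV : D.Valid m n cap) {S : Finset ℕ} {e a : ℕ}
    (ha : 0 < D.val a) (hS : D.FeasibleSet m cap S) (hSn : ∀ i ∈ S, i < n) :
    ∑ i ∈ S with D.Uses i e ∧ D.Meets i a ∧ D.bot i < 32 * D.size i, (1 : ℝ) ≤ 256 := by
  obtain ⟨p, hp⟩ := exists_bottleneck hV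
  have hsub : ∀ i ∈ S.filter (fun i => D.Uses i e ∧ D.Meets i a ∧ D.bot i < 32 * D.size i),
      i ∈ S ∧ D.Uses i e ∧ D.Meets i a ∧ D.bot i < 32 * D.size i :=
    fun i hi => Finset.mem_filter.1 hi
  have := sum_le_two_mul_of_marked (D := D) (e := e) (p := p) (w := fun _ => 1) (B := 128)
    (S := S.filter (fun i => D.Uses i e ∧ D.Meets i a ∧ D.bot i < 32 * D.size i)) (by norm_num)
    (fun i hi => (hsub i hi).2.1) (fun i hi => (hp i (hSn i (hsub i hi).1)).1) (by
      intro T hT i₀ hi₀ hall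
      have h0 := hsub i₀ (hT hi₀)
      obtain ⟨_, h1, h2⟩ := hp i₀ (hSn i₀ h0.1)
      have hsum := sum_size_le_bot hV hS hSn (hT.trans (Finset.filter_subset _ _)) h1 h2 hall
      rw [← Finset.add_sum_erase T _ hi₀] at hsum
      have hlow : ∑ i ∈ T.erase i₀, D.val a / 64 ≤ ∑ i ∈ T.erase i₀, D.size i := by
        refine Finset.sum_le_sum fun j hj => ?_
        have hj' := hsub j (hT (Finset.mem_of_mem_erase hj))
        linarith [hj'.2.2.1.2.2, hj'.2.2.2]
      rw [Finset.sum_const, nsmul_eq_mul] at hlow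
      have hmeet := h0.2.2.1.2.1
      have hlt : (#(T.erase i₀) : ℝ) < 128 := by
        by_contra hge
        rw [not_lt] at hge
        have := mul_le_mul_of_nonneg_right hge (by linarith : 0 ≤ D.val a / 64)
        linarith
      have hlt' : #(T.erase i₀) < 128 := by exact_mod_cast hlt
      have hcard := Finset.card_erase_add_one hi₀
      have : #T ≤ 128 := by omega
      simp only [sum_const, nsmul_eq_mul, mul_one]
      exact_mod_cast this)
  linarith

/-- If a group has weight at most `X` units on every edge, then its levels are below `X`. -/
theorem level_lt (hV : D.Valid m n cap) {i X : ℕ} (hi : i < n)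
    (h : ∀ e, ∑ j ∈ D.onEdge n (D.group i) e, D.weight j ≤ X * D.unit i) : D.level i < X := by
  have hw : ∀ N e, ∀ j ∈ D.onEdge N (D.group i) e, N ≤ n → 0 ≤ D.weight j := fun N e j hj hN =>
    (weight_pos hV ((mem_onEdge.1 hj).1.trans_le hN)).le
  have hmem : ∀ e, D.Uses i e → i ∈ D.onEdge n (D.group i) e := fun e he =>
    mem_onEdge.2 ⟨hi, rfl, he⟩
  have hX : 0 < X := by
    have h1 := h (D.src i)
    have h2 := Finset.single_le_sum (fun j hj => hw n (D.src i) j hj le_rfl)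
      (hmem _ ⟨le_rfl, hV.src_lt_snk i hi⟩)
    rcases Nat.eq_zero_or_pos X with rfl | h'
    · have := weight_pos hV hi
      simp at h1
      linarith
    · exact h'
  have hfit : D.Fits i (X - 1) := by
    intro e he
    have e1 : ((X - 1 : ℕ) : ℝ) + 1 = X := by
      rw [Nat.cast_sub hX]; simp
    rw [e1]
    refine le_trans ?_ (h e)
    rw [← Finset.sum_erase_add _ _ (hmem e he)]
    refine add_le_add_left (Finset.sum_le_sum_of_subset_of_nonneg ?_ fun j hj _ =>
      hw n e j (Finset.mem_of_mem_erase hj) le_rfl) _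
    intro j hj
    have hj' := mem_onEdge.1 (Finset.mem_filter.1 hj).1
    exact Finset.mem_erase.2 ⟨hj'.1.ne, mem_onEdge.2 ⟨hj'.1.trans hi, hj'.2⟩⟩
  have := level_le_of_fits hfit
  omega

variable (D) in
/-- A partition of the first `n` flows into feasible sets. -/
def FeasibleColoring (m n : ℕ) (cap : ℕ → ℝ) (c : ℕ → ℕ) : Prop :=
  ∀ r, D.FeasibleSet m cap {i ∈ range n | c i = r}

theorem sum_onEdge_le {c : ℕ → ℕ} {γ e : ℕ} {X : ℝ}
    (h : ∀ r, ∑ j ∈ range n with c j = r ∧ D.group j = γ ∧ D.Uses j e, D.weight j ≤ X) :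
    ∑ j ∈ D.onEdge n γ e, D.weight j ≤ #((range n).image c) * X := by
  have hmaps : ∀ j ∈ D.onEdge n γ e, c j ∈ (range n).image c := fun j hj =>
    Finset.mem_image_of_mem c (Finset.mem_range.2 (mem_onEdge.1 hj).1)
  rw [← Finset.sum_fiberwise_of_maps_to hmaps]
  rw [← nsmul_eq_mul]
  refine Finset.sum_le_card_nsmul _ _ _ fun r _ => ?_
  refine le_of_eq_of_le ?_ (h r)
  refine Finset.sum_congr ?_ fun _ _ => rfl
  ext j
  simp only [mem_filter, mem_onEdge, mem_range]
  tauto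

theorem level_lt_of_small (hV : D.Valid m n cap) {c : ℕ → ℕ} (hc : D.FeasibleColoring m n cap c)
    {i : ℕ} (hi : i < n) (hs : D.group i < D.K) :
    D.level i < 64 * #((range n).image c) := by
  refine level_lt hV hi fun e => ?_
  have hpos : 0 < D.val (D.group i) := by
    have := unit_pos hV hi
    rwa [unit, if_pos hs] at this
  refine (sum_onEdge_le (c := c) (X := 64 * D.val (D.group i)) fun r => ?_).trans ?_
  · have h1 := sum_small_feasible_le hV (e := e) hpos.le (hc r)
      (fun j hj => Finset.mem_range.1 (Finset.mem_filter.1 hj).1)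
    have h2 : ∑ j ∈ range n with c j = r ∧ D.group j = D.group i ∧ D.Uses j e, D.weight j
        ≤ ∑ j ∈ {j ∈ range n | c j = r} with D.Uses j e ∧ D.bot j < 2 * D.val (D.group i),
          16 * D.size j := by
      have h3 : ∑ j ∈ range n with c j = r ∧ D.group j = D.group i ∧ D.Uses j e, D.weight j
        = ∑ j ∈ range n with c j = r ∧ D.group j = D.group i ∧ D.Uses j e, 16 * D.size j := by
        refine Finset.sum_congr rfl fun j hj => ?_
        rw [weight, if_pos (by rw [(Finset.mem_filter.1 hj).2.2.1]; exact hs)]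
      rw [h3]
      refine Finset.sum_le_sum_of_subset_of_nonneg (fun j hj => ?_) fun j hj _ => ?_
      · obtain ⟨h4, h5, h6, h7⟩ := Finset.mem_filter.1 hj
        have hj' := Finset.mem_range.1 h4
        refine Finset.mem_filter.2 ⟨Finset.mem_filter.2 ⟨h4, h5⟩, h7, ?_⟩
        rw [← h6, group_of_small hV hj' (by rw [h6]; exact hs)]
        exact (cls_spec hV hj').2.2.2
      · have hj' := Finset.mem_range.1 (Finset.mem_filter.1 (Finset.mem_filter.1 hj).1).1
        linarith [hV.size_pos j hj']
    rw [← Finset.mul_sum] at h2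
    linarith
  · rw [unit, if_pos hs]
    push_cast
    linarith

theorem level_lt_of_large (hV : D.Valid m n cap) {c : ℕ → ℕ} (hc : D.FeasibleColoring m n cap c)
    {i : ℕ} (hi : i < n) (hl : ¬ D.group i < D.K) :
    D.level i < 256 * #((range n).image c) := by
  refine level_lt hV hi fun e => ?_
  refine (sum_onEdge_le (c := c) (X := 256) fun r => ?_).trans ?_
  · refine le_trans ?_ (card_large_feasible_le hV (e := e) (a := D.node i)
      (hV.val_pos _ (node_spec hV hi).1) (hc r)
      (fun j hj => Finset.mem_range.1 (Finset.mem_filter.1 hj).1))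
    have h3 : ∑ j ∈ range n with c j = r ∧ D.group j = D.group i ∧ D.Uses j e, D.weight j
      = ∑ j ∈ range n with c j = r ∧ D.group j = D.group i ∧ D.Uses j e, (1 : ℝ) := by
      refine Finset.sum_congr rfl fun j hj => ?_
      rw [weight, if_neg (by rw [(Finset.mem_filter.1 hj).2.2.1]; exact hl)]
    rw [h3]
    refine Finset.sum_le_sum_of_subset_of_nonneg (fun j hj => ?_) fun j hj _ => zero_le_one
    obtain ⟨h4, h5, h6, h7⟩ := Finset.mem_filter.1 hj
    have hj' := Finset.mem_range.1 h4
    have hlj : ¬ D.group j < D.K := by rw [h6]; exact hl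
    refine Finset.mem_filter.2 ⟨Finset.mem_filter.2 ⟨h4, h5⟩, h7, ?_, ?_⟩
    · have h8 : D.node j = D.node i := by
        rw [group_of_large hV hj' hlj, group_of_large hV hi hl] at h6
        omega
      rw [← h8]
      exact (node_spec hV hj').2.1
    · rw [group_lt_iff hV hj', not_le] at hlj
      exact hlj
  · rw [unit, if_neg hl]
    push_cast
    linarith

theorem color_of_small {i : ℕ} (hs : D.group i < D.K) : D.color i = 0 := by
  have : D.color i ≤ 0 := by
    rw [color_eq]
    exact leastBelow_le fun h => absurd hs (not_lt.2 h)
  omega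

theorem key_lt_of_large (hV : D.Valid m n cap) {i : ℕ} (hi : i < n) (hl : ¬ D.group i < D.K) :
    D.key i - 1 < Nat.log 2 #D.anchors + 1 := by
  rw [key_of_large hV hi hl, Nat.add_sub_cancel, Nat.lt_succ_iff]
  have hr := rank_pos (node_mem_anchors hV hi)
  exact (padicValNat_le_nat_log _).trans (Nat.log_mono_right (rank_le _))

/-- The number of rounds, in terms of the number of anchors and the number of rounds of any
feasible assignment. -/
theorem card_rounds_le (hV : D.Valid m n cap) {c : ℕ → ℕ} (hc : D.FeasibleColoring m n cap c) :
    #((range n).image D.round) ≤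
      832 * (Nat.log 2 #D.anchors + 1) * #((range n).image c) := by
  set χ := #((range n).image c) with hχ
  set L := Nat.log 2 #D.anchors + 1 with hL
  let A : Finset (ℕ × ℕ × ℕ) := {0} ×ˢ range (64 * χ) ×ˢ {0}
  let B : Finset (ℕ × ℕ × ℕ) := (range L).image (· + 1) ×ˢ range (256 * χ) ×ˢ range 3
  have hsub : (range n).image D.round ⊆
      (A ∪ B).image (fun t => t.1 + (D.K + 1) * (t.2.2 + 3 * t.2.1)) := by
    intro r hr
    obtain ⟨i, hi, rfl⟩ := Finset.mem_image.1 hr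
    have hi' := Finset.mem_range.1 hi
    refine Finset.mem_image.2 ⟨(D.key i, D.level i, D.color i), ?_, rfl⟩
    rw [Finset.mem_union]
    by_cases hs : D.group i < D.K
    · left
      simp only [A, Finset.mem_product, Finset.mem_singleton, Finset.mem_range]
      exact ⟨(group_lt_iff_key i).1 hs, level_lt_of_small hV hc hi' hs, color_of_small hs⟩
    · right
      simp only [B, Finset.mem_product, Finset.mem_image, Finset.mem_range]
      have hk : D.key i ≠ 0 := fun h => hs ((group_lt_iff_key i).2 h)
      exact ⟨⟨D.key i - 1, key_lt_of_large hV hi' hs, by omega⟩, level_lt_of_large hV hc hi' hs,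
        color_lt hV hi'⟩
  refine (Finset.card_le_card hsub).trans (Finset.card_image_le.trans
    ((Finset.card_union_le _ _).trans ?_))
  have h1 : #A = 64 * χ := by simp [A]
  have h2 : #B ≤ L * (256 * χ * 3) := by
    simp only [B, Finset.card_product, Finset.card_range]
    exact Nat.mul_le_mul_right _ (Finset.card_image_le.trans (by simp))
  have h3 : χ ≤ L * χ := Nat.le_mul_of_pos_left _ (by omega)
  calc #A + #B ≤ 64 * χ + L * (256 * χ * 3) := by omega
    _ ≤ 64 * (L * χ) + L * (256 * χ * 3) := by omega
    _ = 832 * L * χ := by ring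

end Data

/-! ### The logarithmic bounds -/

theorem log_le_three_mul_max_min {a x y : ℝ} (hx : a ≤ 3 * max 1 x) (hy : a ≤ 3 * max 1 y) :
    a ≤ 3 * max 1 (min x y) := by
  rcases min_choice x y with h | h <;> rw [h] <;> assumption

theorem log_natCast_le_three_mul {a b : ℕ} (h : a ≤ b) :
    Real.log a ≤ 3 * max 1 (Real.log b) := by
  have h1 : Real.log a ≤ Real.log b := by
    rcases Nat.eq_zero_or_pos a with rfl | ha
    · simpa using Real.log_natCast_nonneg b
    · exact Real.log_le_log (by exact_mod_cast ha) (by exact_mod_cast h)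
  have h2 := le_max_right 1 (Real.log b)
  have h3 := le_max_left 1 (Real.log b)
  linarith

theorem log_le_three_mul_log_log {a : ℕ} {R : ℝ} (h : 0 < a → 2 ^ (a - 1) ≤ R) :
    Real.log a ≤ 3 * max 1 (Real.log (Real.log R)) := by
  set M := max 1 (Real.log (Real.log R)) with hM
  have hM1 : 1 ≤ M := le_max_left _ _
  rcases Nat.eq_zero_or_pos a with rfl | ha
  · simp; linarith
  have hR := h ha
  have hR1 : 1 ≤ R := le_trans (one_le_pow₀ (by norm_num)) hR
  have hx : Real.log R ≤ Real.exp M := by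
    rcases (Real.log_nonneg hR1).lt_or_eq with h0 | h0
    · rw [← Real.log_le_iff_le_exp h0]
      exact le_max_right _ _
    · rw [← h0]; exact (Real.exp_pos _).le
  have h1 : ((a - 1 : ℕ) : ℝ) * Real.log 2 ≤ Real.log R := by
    rw [← Real.log_pow]
    exact Real.log_le_log (by positivity) hR
  rw [Nat.cast_sub ha] at h1
  have h2 := Real.log_two_gt_d9
  have h3 : (a : ℝ) - 1 ≤ 3 / 2 * Real.exp M := by
    have h4 : ((a : ℝ) - 1) * (2 / 3) ≤ ((a : ℝ) - 1) * Real.log 2 := by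
      refine mul_le_mul_of_nonneg_left (by linarith) ?_
      have : (1 : ℝ) ≤ a := by exact_mod_cast ha
      linarith
    simp only [Nat.cast_one] at h1
    linarith
  have h5 : (2.7 : ℝ) ≤ Real.exp M := by
    have := Real.exp_one_gt_d9
    have := Real.exp_le_exp.2 hM1
    linarith
  have h6 : (a : ℝ) ≤ Real.exp (2 * M) := by
    rw [two_mul, Real.exp_add]
    nlinarith
  rw [← Real.log_le_iff_le_exp (by exact_mod_cast ha)] at h6
  linarith

theorem natLog_two_add_one_le {a : ℕ} {M : ℝ} (h1 : 1 ≤ M) (h : Real.log a ≤ 3 * M) :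
    ((Nat.log 2 a + 1 : ℕ) : ℝ) ≤ 6 * M := by
  have h2 : (Nat.log 2 a : ℝ) * Real.log 2 ≤ Real.log a := by
    rcases Nat.eq_zero_or_pos a with rfl | ha
    · simp
    · rw [← Real.log_pow]
      refine Real.log_le_log (by positivity) ?_
      exact_mod_cast Nat.pow_log_le_self 2 ha.ne'
  have h3 := Real.log_two_gt_d9
  have h4 : (Nat.log 2 a : ℝ) * (2 / 3) ≤ (Nat.log 2 a : ℝ) * Real.log 2 :=
    mul_le_mul_of_nonneg_left (by linarith) (Nat.cast_nonneg _)
  push_cast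
  linarith

/-! ### The algorithm on lists of flows -/

/-- The capacities as a sequence. -/
noncomputable def capOf (P : CapPath) (k : ℕ) : ℝ := if h : k < P.m then P.cap ⟨k, h⟩ else 0

variable {P : CapPath}

/-- The sources as a sequence. -/
def srcOf (F : List (Flow P)) (k : ℕ) : ℕ := if h : k < F.length then (F.get ⟨k, h⟩).src else 0

/-- The sinks as a sequence. -/
def snkOf (F : List (Flow P)) (k : ℕ) : ℕ := if h : k < F.length then (F.get ⟨k, h⟩).snk else 0

/-- The sizes as a sequence. -/
noncomputable def sizeOf (F : List (Flow P)) (k : ℕ) : ℝ :=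
  if h : k < F.length then (F.get ⟨k, h⟩).size else 0

/-- The first edge of least capacity between the vertices `s` and `t`. -/
noncomputable def bottleneckEdge (m : ℕ) (cap : ℕ → ℝ) (s t : ℕ) : ℕ :=
  leastBelow m (fun j => (s ≤ j ∧ j < t) ∧ ∀ k < m, s ≤ k ∧ k < t → cap j ≤ cap k)

/-- The bottleneck capacities as a sequence. -/
noncomputable def botOf (F : List (Flow P)) (k : ℕ) : ℝ :=
  capOf P (bottleneckEdge P.m (capOf P) (srcOf F k) (snkOf F k))

/-- Online, the anchors are selected from all capacities of the path. -/
noncomputable def onlineData (F : List (Flow P)) : Data where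
  K := P.m
  val := capOf P
  src := srcOf F
  snk := snkOf F
  size := sizeOf F
  bot := botOf F

/-- Offline, the anchors are selected from the bottleneck capacities of the flows, so that there
are at most as many anchors as flows. -/
noncomputable def offlineData (F : List (Flow P)) : Data where
  K := F.length
  val := botOf F
  src := srcOf F
  snk := snkOf F
  size := sizeOf F
  bot := botOf F

theorem capOf_pos {e : ℕ} (he : e < P.m) : 0 < capOf P e := by
  rw [capOf, dif_pos he]; exact P.cap_pos _

theorem bottleneckEdge_spec {m : ℕ} (cap : ℕ → ℝ) {s t : ℕ} (hst : s < t) (ht : t ≤ m) :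
    bottleneckEdge m cap s t < m ∧ (s ≤ bottleneckEdge m cap s t ∧ bottleneckEdge m cap s t < t) ∧
      ∀ k < m, s ≤ k ∧ k < t → cap (bottleneckEdge m cap s t) ≤ cap k := by
  obtain ⟨j, hj, hmin⟩ := Finset.exists_min_image (Finset.Ico s t) cap ⟨s, by simp [hst]⟩
  rw [Finset.mem_Ico] at hj
  exact leastBelow_spec (P := fun j => (s ≤ j ∧ j < t) ∧ ∀ k < m, s ≤ k ∧ k < t → cap j ≤ cap k)
    ⟨j, by omega, hj, fun k _ hk => hmin k (Finset.mem_Ico.2 hk)⟩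

theorem src_lt_snk_of_lt (F : List (Flow P)) {i : ℕ} (hi : i < F.length) :
    srcOf F i < snkOf F i ∧ snkOf F i ≤ P.m := by
  rw [srcOf, snkOf, dif_pos hi, dif_pos hi]
  exact ⟨(F.get ⟨i, hi⟩).src_lt_snk, (F.get ⟨i, hi⟩).snk_le⟩

theorem exists_edge_botOf (F : List (Flow P)) {i : ℕ} (hi : i < F.length) :
    ∃ e < P.m, (srcOf F i ≤ e ∧ e < snkOf F i) ∧ capOf P e = botOf F i := by
  have h := src_lt_snk_of_lt F hi
  obtain ⟨h1, h2, _⟩ := bottleneckEdge_spec (capOf P) h.1 h.2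
  exact ⟨_, h1, h2, rfl⟩

theorem botOf_le (F : List (Flow P)) {i e : ℕ} (hi : i < F.length) (h1 : srcOf F i ≤ e)
    (h2 : e < snkOf F i) : botOf F i ≤ capOf P e := by
  have h := src_lt_snk_of_lt F hi
  exact (bottleneckEdge_spec (capOf P) h.1 h.2).2.2 e (h2.trans_le h.2) ⟨h1, h2⟩

theorem size_le_botOf (F : List (Flow P)) {i : ℕ} (hi : i < F.length) :
    sizeOf F i ≤ botOf F i := by
  obtain ⟨e, he, h, hb⟩ := exists_edge_botOf F hi
  rw [← hb, capOf, dif_pos he, sizeOf, dif_pos hi]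
  rw [srcOf, snkOf, dif_pos hi, dif_pos hi] at h
  exact (F.get ⟨i, hi⟩).size_le ⟨e, he⟩ h.1 h.2

theorem size_pos_of_lt (F : List (Flow P)) {i : ℕ} (hi : i < F.length) : 0 < sizeOf F i := by
  rw [sizeOf, dif_pos hi]; exact (F.get ⟨i, hi⟩).size_pos

theorem valid_onlineData (F : List (Flow P)) :
    (onlineData F).Valid P.m F.length (capOf P) where
  src_lt_snk i hi := (src_lt_snk_of_lt F hi).1
  snk_le i hi := (src_lt_snk_of_lt F hi).2
  size_pos i hi := size_pos_of_lt F hi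
  size_le i hi := size_le_botOf F hi
  exists_bot i hi := by
    obtain ⟨e, _, h, hb⟩ := exists_edge_botOf F hi
    exact ⟨e, h, hb⟩
  bot_le i hi e he := botOf_le F hi he.1 he.2
  val_pos j hj := capOf_pos hj
  exists_val i hi := by
    obtain ⟨e, he, h, hb⟩ := exists_edge_botOf F hi
    exact ⟨e, he, hb⟩

theorem valid_offlineData (F : List (Flow P)) :
    (offlineData F).Valid P.m F.length (capOf P) where
  src_lt_snk i hi := (src_lt_snk_of_lt F hi).1
  snk_le i hi := (src_lt_snk_of_lt F hi).2
  size_pos i hi := size_pos_of_lt F hi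
  size_le i hi := size_le_botOf F hi
  exists_bot i hi := by
    obtain ⟨e, _, h, hb⟩ := exists_edge_botOf F hi
    exact ⟨e, h, hb⟩
  bot_le i hi e he := botOf_le F hi he.1 he.2
  val_pos j hj := (size_pos_of_lt F hj).trans_le (size_le_botOf F hj)
  exists_val i hi := ⟨i, hi, rfl⟩

/-- There are at most as many anchors as edges. -/
theorem card_anchors_le_edges {D : Data} (hpos : ∀ j < D.K, 0 < D.val j)
    (h : ∀ j < D.K, ∃ e < P.m, capOf P e = D.val j) : #D.anchors ≤ P.m := by
  have hex : ∀ j, ∃ e, j < D.K → e < P.m ∧ capOf P e = D.val j := by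
    intro j
    by_cases hj : j < D.K
    · obtain ⟨e, h1, h2⟩ := h j hj
      exact ⟨e, fun _ => ⟨h1, h2⟩⟩
    · exact ⟨0, fun h' => absurd h' hj⟩
  choose p hp using hex
  have hm : ∀ j ∈ D.anchors, j < D.K ∧ D.anchor j = 1 := fun j hj => by
    simpa [Data.anchors] using hj
  have := Finset.card_le_card_of_injOn (s := D.anchors) (t := range P.m) p
    (fun j hj => Finset.mem_coe.2 (Finset.mem_range.2 (hp j (hm j hj).1).1)) (by
      intro i hi j hj hij
      have hi' := hm i hi
      have hj' := hm j hj
      refine Data.anchor_injOn hi'.2 hj'.2 (hpos i hi'.1) ?_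
      rw [← (hp i hi'.1).2, ← (hp j hj'.1).2, hij])
  simpa using this

theorem two_pow_card_anchors_le_ratio {D : Data}
    (h : ∀ j < D.K, ∃ e < P.m, capOf P e = D.val j) (hA : 0 < #D.anchors) :
    2 ^ (#D.anchors - 1) ≤ P.capMax / P.capMin := by
  have hmin : 0 < P.capMin := by
    exact (Finset.lt_inf'_iff _).2 fun j _ => P.cap_pos j
  rw [le_div_iff₀ hmin]
  refine Data.two_pow_card_anchors_le (D := D) D.anchors _ _ hmin (fun j hj => ?_)
    (Finset.card_pos.1 hA)
  have hj' : j < D.K ∧ D.anchor j = 1 := by simpa [Data.anchors] using hj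
  obtain ⟨e, he, hv⟩ := h j hj'.1
  refine ⟨hj'.2, ?_, ?_⟩ <;> rw [← hv, capOf, dif_pos he]
  · exact Finset.inf'_le _ (Finset.mem_univ _)
  · exact Finset.le_sup' P.cap (Finset.mem_univ _)

theorem exists_edge_val_onlineData (F : List (Flow P)) :
    ∀ j < (onlineData F).K, ∃ e < P.m, capOf P e = (onlineData F).val j :=
  fun j hj => ⟨j, hj, rfl⟩

theorem exists_edge_val_offlineData (F : List (Flow P)) :
    ∀ j < (offlineData F).K, ∃ e < P.m, capOf P e = (offlineData F).val j := fun j hj => by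
  obtain ⟨e, he, _, hb⟩ := exists_edge_botOf F hj
  exact ⟨e, he, hb⟩

theorem log_anchors_online_le (F : List (Flow P)) :
    ((Nat.log 2 #(onlineData F).anchors + 1 : ℕ) : ℝ) ≤ 6 * onlineBound P := by
  refine natLog_two_add_one_le (le_max_left _ _) (log_le_three_mul_max_min ?_ ?_)
  · exact log_natCast_le_three_mul (card_anchors_le_edges (valid_onlineData F).val_pos
      (exists_edge_val_onlineData F))
  · exact log_le_three_mul_log_log
      (two_pow_card_anchors_le_ratio (exists_edge_val_onlineData F))

theorem log_anchors_offline_le (F : List (Flow P)) :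
    ((Nat.log 2 #(offlineData F).anchors + 1 : ℕ) : ℝ) ≤ 6 * offlineBound P F.length := by
  refine natLog_two_add_one_le (le_max_left _ _) (log_le_three_mul_max_min ?_
    (log_le_three_mul_max_min ?_ ?_))
  · refine log_natCast_le_three_mul ?_
    simpa [Data.anchors, offlineData] using
      Finset.card_filter_le (range F.length) (fun j => (offlineData F).anchor j = 1)
  · exact log_natCast_le_three_mul (card_anchors_le_edges (valid_offlineData F).val_pos
      (exists_edge_val_offlineData F))
  · exact log_le_three_mul_log_log
      (two_pow_card_anchors_le_ratio (exists_edge_val_offlineData F))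

open scoped Classical in
/-- The loads of a round, as sums over the positions of the list and over numbers. -/
theorem sum_get_eq_sum_range {F : List (Flow P)} {D : Data} (hs : D.src = srcOf F)
    (ht : D.snk = snkOf F) (hz : D.size = sizeOf F) (c : ℕ → ℕ) (r : ℕ) (j : Fin P.m) :
    ∑ i ∈ Finset.univ.filter (fun i : Fin F.length => c i = r ∧ (F.get i).Uses j), (F.get i).size =
      ∑ i ∈ range F.length with c i = r ∧ D.Uses i j, D.size i := by
  rw [Finset.sum_filter, Finset.sum_filter, Finset.sum_range]
  refine Finset.sum_congr rfl fun i _ => ?_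
  have h1 : (F.get i).Uses j ↔ D.Uses i j := by
    rw [Flow.Uses, Data.Uses, hs, ht, srcOf, snkOf, dif_pos i.2, dif_pos i.2]
  rw [hz, sizeOf, dif_pos i.2]
  simp only [h1, Fin.eta]

theorem numRounds_eq (n : ℕ) (c : ℕ → ℕ) :
    numRounds (fun i : Fin n => c i) = #((range n).image c) := by
  rw [numRounds]
  congr 1
  ext r
  simp only [Finset.mem_image, Finset.mem_univ, true_and, Finset.mem_range]
  exact ⟨fun ⟨i, hi⟩ => ⟨i, i.2, hi⟩, fun ⟨i, hi, h⟩ => ⟨⟨i, hi⟩, h⟩⟩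

/-- The guarantees for the rounds of the algorithm, in terms of the number of anchors. -/
theorem guarantees {F : List (Flow P)} {D : Data} (hV : D.Valid P.m F.length (capOf P))
    (hs : D.src = srcOf F) (ht : D.snk = snkOf F) (hz : D.size = sizeOf F) :
    Feasible F (fun i => D.round i) ∧ numRounds (fun i : Fin F.length => D.round i) ≤
      832 * (Nat.log 2 #D.anchors + 1) * chromaticNumber F := by
  classical
  constructor
  · intro r j
    have h := Data.sum_size_round_le hV r j (capOf_pos j.2).le
    have hc : capOf P j = P.cap j := by rw [capOf, dif_pos j.2]
    rw [← sum_get_eq_sum_range hs ht hz D.round r j, hc] at h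
    convert h
  · obtain ⟨col, hcol, hnum⟩ : chromaticNumber F ∈
        {k : ℕ | ∃ col : Fin F.length → ℕ, Feasible F col ∧ numRounds col = k} := by
      refine Nat.sInf_mem ?_
      obtain ⟨col, hcol⟩ := exists_feasible F
      exact ⟨_, col, hcol, rfl⟩
    let c : ℕ → ℕ := fun i => if h : i < F.length then col ⟨i, h⟩ else 0
    have hc : (fun i : Fin F.length => c i) = col := by
      funext i
      simp [c]
    rw [← hnum, ← hc, numRounds_eq, numRounds_eq]
    refine Data.card_rounds_le hV fun r e he => ?_
    have h := hcol r ⟨e, he⟩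
    rw [← hc] at h
    have h2 := sum_get_eq_sum_range hs ht hz c r ⟨e, he⟩
    rw [capOf, dif_pos he, Finset.filter_filter]
    refine le_of_eq_of_le ?_ h
    rw [← h2]

theorem mul_chromaticNumber_le {a b χ : ℕ} {B : ℝ} (h : a ≤ 832 * b * χ) (hb : (b : ℝ) ≤ 6 * B) :
    (a : ℝ) ≤ 4992 * B * χ := by
  have h1 : (a : ℝ) ≤ 832 * b * χ := by exact_mod_cast h
  refine h1.trans (mul_le_mul_of_nonneg_right ?_ (Nat.cast_nonneg _))
  linarith

/-! ### The online algorithm -/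

open scoped Classical in
/-- The rounds depend on the flows that have arrived only. -/
theorem round_congr {D D' : Data} {N : ℕ} (hK : D.K = D'.K) (hval : D.val = D'.val)
    (hsrc : ∀ i < N, D.src i = D'.src i) (hsnk : ∀ i < N, D.snk i = D'.snk i)
    (hsize : ∀ i < N, D.size i = D'.size i) (hbot : ∀ i < N, D.bot i = D'.bot i) :
    ∀ i < N, D.round i = D'.round i := by
  have hanchor : D.anchor = D'.anchor := by
    funext i
    refine fill_congr (N := i + 1) (fun j _ g => ?_) i i.lt_succ_self
    rw [Data.anchorStep, Data.anchorStep, hval]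
  have hrank : D.rank = D'.rank := by
    funext j
    simp only [Data.rank, hK, hval, hanchor]
  have hgroup : ∀ i < N, D.group i = D'.group i := by
    intro i hi
    simp only [Data.group, Data.cls, Data.node, Data.Meets, hK, hval, hanchor, hrank,
      hsize i hi, hbot i hi]
  have hweight : ∀ i < N, D.weight i = D'.weight i := by
    intro i hi
    simp only [Data.weight, hK, hgroup i hi, hsize i hi]
  have hunit : ∀ i < N, D.unit i = D'.unit i := by
    intro i hi
    simp only [Data.unit, hK, hval, hgroup i hi]
  have hlevel : ∀ i < N, D.level i = D'.level i := by
    refine fill_congr fun i hi g => ?_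
    simp only [Data.levelStep, hweight i hi, hunit i hi, hsrc i hi, hsnk i hi]
    congr 1
    funext h
    have : ∀ e, (∑ j ∈ range i, if D.group j = D.group i ∧ g j ≤ h ∧ D.Uses j e then D.weight j
        else 0) = ∑ j ∈ range i, if D'.group j = D'.group i ∧ g j ≤ h ∧ D'.Uses j e then
          D'.weight j else 0 := by
      intro e
      refine Finset.sum_congr rfl fun j hj => ?_
      have hj' : j < N := (Finset.mem_range.1 hj).trans hi
      refine if_congr ?_ (hweight j hj') rfl
      simp only [Data.Uses, hgroup i hi, hgroup j hj', hsrc j hj', hsnk j hj']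
    simp only [this]
  have hcolor : ∀ i < N, D.color i = D'.color i := by
    refine fill_congr fun i hi g => ?_
    simp only [Data.colorStep, hK, hgroup i hi, hsrc i hi, hsnk i hi, hlevel i hi]
    congr 1
    funext c
    refine propext (imp_congr Iff.rfl (forall_congr' fun j => forall_congr' fun hj => ?_))
    have hj' := hj.trans hi
    rw [hgroup j hj', hlevel j hj', hsrc j hj', hsnk j hj']
  intro i hi
  simp only [Data.round, Data.key, hK, hgroup i hi, hrank, hlevel i hi, hcolor i hi]

/-- The online algorithm runs the rounds on the list of the flows that have arrived. -/
noncomputable def onlineAlgorithm : OnlineAlgorithm :=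
  fun _ past f => (onlineData (past ++ [f])).round past.length

theorem onlineAlgorithm_assignment (F : List (Flow P)) :
    onlineAlgorithm.assignment F = fun i : Fin F.length => (onlineData F).round i := by
  funext i
  have htake : F.take i.val ++ [F.get i] = F.take (i.val + 1) := by
    rw [List.take_succ_eq_append_getElem i.2]
    rfl
  have hlen : (F.take i.val).length = i.val := by
    rw [List.length_take]; omega
  rw [OnlineAlgorithm.assignment, onlineAlgorithm, htake, hlen]
  have hsrc : ∀ k < i.val + 1, srcOf (F.take (i.val + 1)) k = srcOf F k := by
    intro k hk
    have h1 : k < F.length := by omega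
    have h2 : k < (F.take (i.val + 1)).length := by rw [List.length_take]; omega
    rw [srcOf, srcOf, dif_pos h1, dif_pos h2]
    simp
  have hsnk : ∀ k < i.val + 1, snkOf (F.take (i.val + 1)) k = snkOf F k := by
    intro k hk
    have h1 : k < F.length := by omega
    have h2 : k < (F.take (i.val + 1)).length := by rw [List.length_take]; omega
    rw [snkOf, snkOf, dif_pos h1, dif_pos h2]
    simp
  have hsize : ∀ k < i.val + 1, sizeOf (F.take (i.val + 1)) k = sizeOf F k := by
    intro k hk
    have h1 : k < F.length := by omega
    have h2 : k < (F.take (i.val + 1)).length := by rw [List.length_take]; omega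
    rw [sizeOf, sizeOf, dif_pos h1, dif_pos h2]
    simp
  refine round_congr (D := onlineData (F.take (i.val + 1))) (D' := onlineData F)
    (N := i.val + 1) rfl rfl hsrc hsnk hsize (fun k hk => ?_) i.val i.val.lt_succ_self
  simp only [onlineData, botOf, hsrc k hk, hsnk k hk]

theorem isCompetitive_onlineAlgorithm :
    IsCompetitive onlineAlgorithm (fun P => 4992 * onlineBound P) := by
  intro P F
  obtain ⟨h1, h2⟩ := guarantees (valid_onlineData F) rfl rfl rfl
  rw [onlineAlgorithm_assignment]
  exact ⟨h1, mul_chromaticNumber_le h2 (log_anchors_online_le F)⟩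

/-! ### Executions with a time bound -/

/-- The program `c`, started in `s`, halts after at most `T` steps in a state satisfying `Q`. -/
def Exec (c : Prog) (s : Store) (T : ℕ) (Q : Store → Prop) : Prop :=
  ∃ t s', Run c s t s' ∧ t ≤ T ∧ Q s'

namespace Exec

variable {c c₁ c₂ : Prog} {s : Store} {T T' T₁ T₂ : ℕ} {Q Q' Q₁ : Store → Prop}

theorem mono (h : Exec c s T Q) (hT : T ≤ T') (hQ : ∀ s', Q s' → Q' s') : Exec c s T' Q' := by
  obtain ⟨t, s', h1, h2, h3⟩ := h
  exact ⟨t, s', h1, h2.trans hT, hQ s' h3⟩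

theorem seq (h₁ : Exec c₁ s T₁ Q₁) (h₂ : ∀ s', Q₁ s' → Exec c₂ s' T₂ Q) :
    Exec (.seq c₁ c₂) s (T₁ + T₂) Q := by
  obtain ⟨t, s', h1, h2, h3⟩ := h₁
  obtain ⟨t', s'', k1, k2, k3⟩ := h₂ s' h3
  exact ⟨_, s'', Run.seq h1 k1, by omega, k3⟩

theorem setNat {a : ℕ} {i e : NatExpr} (h : Q (s.putNat a (i.eval s) (e.eval s))) :
    Exec (.setNat a i e) s 1 Q :=
  ⟨1, _, Run.setNat a i e s, le_rfl, h⟩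

theorem setReal {a : ℕ} {i : NatExpr} {e : RealExpr}
    (h : Q (s.putReal a (i.eval s) (e.eval s))) : Exec (.setReal a i e) s 1 Q :=
  ⟨1, _, Run.setReal a i e s, le_rfl, h⟩

theorem branch {b : Test} (h₁ : b.Holds s → Exec c₁ s T₁ Q) (h₂ : ¬ b.Holds s → Exec c₂ s T₂ Q) :
    Exec (.branch b c₁ c₂) s (T₁ + T₂ + 1) Q := by
  by_cases hb : b.Holds s
  · obtain ⟨t, s', h1, h2, h3⟩ := h₁ hb
    exact ⟨_, s', Run.branch_true hb h1, by omega, h3⟩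
  · obtain ⟨t, s', h1, h2, h3⟩ := h₂ hb
    exact ⟨_, s', Run.branch_false hb h1, by omega, h3⟩

/-- A loop with the invariant `I i` after `i` rounds that is left after `N` rounds. -/
theorem loop {b : Test} {N : ℕ} (I : ℕ → Store → Prop)
    (hb : ∀ i s, I i s → i ≤ N → (b.Holds s ↔ i < N))
    (hc : ∀ i s, i < N → I i s → Exec c s T (I (i + 1))) (h0 : I 0 s) :
    Exec (.loop b c) s (N * (T + 1) + 1) (I N) := by
  have key : ∀ k i s, i + k = N → I i s → Exec (.loop b c) s (k * (T + 1) + 1) (I N) := by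
    intro k
    induction k with
    | zero =>
      intro i s hi hI
      have hnot : ¬ b.Holds s := by rw [hb i s hI (by omega)]; omega
      obtain rfl : i = N := by omega
      exact ⟨1, s, Run.loop_done hnot, by omega, hI⟩
    | succ k ih =>
      intro i s hi hI
      have hyes : b.Holds s := by rw [hb i s hI (by omega)]; omega
      obtain ⟨t, s', h1, h2, h3⟩ := hc i s (by omega) hI
      obtain ⟨t', s'', k1, k2, k3⟩ := ih (i + 1) s' (by omega) h3
      refine ⟨_, s'', Run.loop_step hyes h1 k1, ?_, k3⟩
      rw [Nat.succ_mul]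
      omega
  exact key N 0 s (by omega) h0

end Exec

/-! ### Memory layout -/

/-! The arrays with an index below `16` hold the data of the problem and the tables of the
algorithm; the arrays with index `16` are used as a stack for loop variables and intermediate results. -/

/-- The part of the memory below the stack. -/
noncomputable def Store.base (s : Store) : Store where
  nat := fun a k => if a < 16 then s.nat a k else 0
  real := fun a k => if a < 16 then s.real a k else 0

/-- The size `m + n` of the instance. -/
def Store.dim (s : Store) : ℕ := s.nat 0 0 + s.nat 0 1

/-- `s'` agrees with `s` below the stack and on the first `d` entries of the stack. -/
def Agree (d : ℕ) (s s' : Store) : Prop :=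
  s'.base = s.base ∧ ∀ x < d, s'.nat 16 x = s.nat 16 x ∧ s'.real 16 x = s.real 16 x

theorem Agree.trans {d d' : ℕ} {s s' s'' : Store} (h : Agree d s s') (h' : Agree d' s' s'')
    (hd : d ≤ d') : Agree d s s'' :=
  ⟨h'.1.trans h.1, fun x hx => ⟨(h'.2 x (by omega)).1.trans (h.2 x hx).1,
    (h'.2 x (by omega)).2.trans (h.2 x hx).2⟩⟩

@[simp] theorem putNat_nat (s : Store) (a k v b j : ℕ) :
    (s.putNat a k v).nat b j = if b = a ∧ j = k then v else s.nat b j := by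
  by_cases hb : b = a
  · subst hb
    by_cases hj : j = k
    · subst hj; simp [Store.putNat]
    · simp [Store.putNat, hj]
  · simp [Store.putNat, hb]

@[simp] theorem putNat_real (s : Store) (a k v : ℕ) : (s.putNat a k v).real = s.real := rfl

@[simp] theorem putReal_nat (s : Store) (a k : ℕ) (v : ℝ) : (s.putReal a k v).nat = s.nat := rfl

@[simp] theorem putReal_real (s : Store) (a k : ℕ) (v : ℝ) (b j : ℕ) :
    (s.putReal a k v).real b j = if b = a ∧ j = k then v else s.real b j := by
  by_cases hb : b = a
  · subst hb
    by_cases hj : j = k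
    · subst hj; simp [Store.putReal]
    · simp [Store.putReal, hj]
  · simp [Store.putReal, hb]

theorem Store.ext' {s s' : Store} (h1 : ∀ a k, s.nat a k = s'.nat a k)
    (h2 : ∀ a k, s.real a k = s'.real a k) : s = s' := by
  cases s; cases s'
  simp only [Store.mk.injEq]
  exact ⟨funext fun a => funext (h1 a), funext fun a => funext (h2 a)⟩

@[simp] theorem base_putNat_stack (s : Store) (k v : ℕ) : (s.putNat 16 k v).base = s.base := by
  refine Store.ext' (fun a j => ?_) fun a j => rfl
  simp only [Store.base, putNat_nat]
  split_ifs <;> first | rfl | omega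

@[simp] theorem base_putReal_stack (s : Store) (k : ℕ) (v : ℝ) :
    (s.putReal 16 k v).base = s.base := by
  refine Store.ext' (fun a j => rfl) fun a j => ?_
  simp only [Store.base, putReal_real]
  split_ifs <;> first | rfl | omega

theorem base_putNat {a : ℕ} (ha : a < 16) (s : Store) (k v : ℕ) :
    (s.putNat a k v).base = s.base.putNat a k v := by
  refine Store.ext' (fun b j => ?_) fun b j => rfl
  simp only [Store.base, putNat_nat]
  split_ifs <;> first | rfl | omega

theorem base_putReal {a : ℕ} (ha : a < 16) (s : Store) (k : ℕ) (v : ℝ) :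
    (s.putReal a k v).base = s.base.putReal a k v := by
  refine Store.ext' (fun b j => rfl) fun b j => ?_
  simp only [Store.base, putReal_real]
  split_ifs <;> first | rfl | omega

theorem base_nat {a : ℕ} (ha : a < 16) (s : Store) (k : ℕ) : s.base.nat a k = s.nat a k := by
  simp [Store.base, ha]

theorem base_real {a : ℕ} (ha : a < 16) (s : Store) (k : ℕ) : s.base.real a k = s.real a k := by
  simp [Store.base, ha]

theorem agree_putNat {d k v : ℕ} (s : Store) (hk : d ≤ k) : Agree d s (s.putNat 16 k v) := by
  refine ⟨base_putNat_stack s k v, fun x hx => ⟨?_, rfl⟩⟩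
  rw [putNat_nat, if_neg (by omega)]

theorem agree_putReal {d k : ℕ} {v : ℝ} (s : Store) (hk : d ≤ k) :
    Agree d s (s.putReal 16 k v) := by
  refine ⟨base_putReal_stack s k v, fun x hx => ⟨rfl, ?_⟩⟩
  rw [putReal_real, if_neg (by omega)]

theorem eval_mono (p : Polynomial ℕ) {a b : ℕ} (h : a ≤ b) : p.eval a ≤ p.eval b := by
  rw [Polynomial.eval_eq_sum_range, Polynomial.eval_eq_sum_range]
  exact Finset.sum_le_sum fun i _ => Nat.mul_le_mul_left _ (Nat.pow_le_pow_left h i)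

/-! ### Functions that are computable in polynomial time -/

/-! Functions of a list of loop variables and of the memory below the stack.  They are closed under
arithmetic, case distinctions and bounded sums, hence under bounded quantifiers and searches, so
that programs need not be written down. -/

/-- Types of lists of loop variables.  A layout says at which places of the stack the variables are
found; `Holds ℓ d γ s` says that the variables have the values `γ` there, below the place `d`. -/
class Ctx (Γ : Type) where
  Layout : Type
  Holds : Layout → ℕ → Γ → Store → Prop
  weight : Γ → ℕ
  holds_mono : ∀ {ℓ d d' γ s s'}, Holds ℓ d γ s → d ≤ d' → Agree d s s' → Holds ℓ d' γ s'

instance : Ctx Unit where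
  Layout := Unit
  Holds _ _ _ _ := True
  weight _ := 0
  holds_mono _ _ _ := trivial

instance {Γ : Type} [Ctx Γ] : Ctx (Γ × ℕ) where
  Layout := Ctx.Layout Γ × ℕ
  Holds ℓ d γ s := Ctx.Holds ℓ.1 d γ.1 s ∧ ℓ.2 < d ∧ s.nat 16 ℓ.2 = γ.2
  weight γ := Ctx.weight γ.1 + γ.2
  holds_mono h hd hs :=
    ⟨Ctx.holds_mono h.1 hd hs, h.2.1.trans_le hd, (hs.2 _ h.2.1).1.trans h.2.2⟩

/-- `f` is computable in time polynomial in the size of the instance and of the variables: for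
every layout and every place `d` some program stores the value of `f` at the place `d` of the stack
and changes nothing below. -/
def NatComp {Γ : Type} [Ctx Γ] (f : Γ → Store → ℕ) : Prop :=
  ∀ (ℓ : Ctx.Layout Γ) (d : ℕ), ∃ (c : Prog) (p : Polynomial ℕ), ∀ γ s, Ctx.Holds ℓ d γ s →
    Exec c s (p.eval (s.base.dim + Ctx.weight γ))
      (fun s' => Agree d s s' ∧ s'.nat 16 d = f γ s.base)

/-- Like `NatComp` for functions with real values. -/
def RealComp {Γ : Type} [Ctx Γ] (f : Γ → Store → ℝ) : Prop :=
  ∀ (ℓ : Ctx.Layout Γ) (d : ℕ), ∃ (c : Prog) (p : Polynomial ℕ), ∀ γ s, Ctx.Holds ℓ d γ s →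
    Exec c s (p.eval (s.base.dim + Ctx.weight γ))
      (fun s' => Agree d s s' ∧ s'.real 16 d = f γ s.base)

/-- `P` is decidable in polynomial time. -/
def PropComp {Γ : Type} [Ctx Γ] (P : Γ → Store → Prop) : Prop :=
  ∃ f : Γ → Store → ℕ, NatComp f ∧ ∀ γ b, 0 < f γ b ↔ P γ b

/-- `f` is polynomially bounded. -/
def PolyBdd {Γ : Type} [Ctx Γ] (f : Γ → Store → ℕ) : Prop :=
  ∃ q : Polynomial ℕ, ∀ γ b, f γ b ≤ q.eval (b.dim + Ctx.weight γ)

section Closure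

variable {Γ : Type} [Ctx Γ]

theorem NatComp.const (k : ℕ) : NatComp (fun (_ : Γ) _ => k) := fun _ d =>
  ⟨.setNat 16 (.const d) (.const k), 1, fun γ s _ => by
    refine (Exec.setNat ?_).mono (le_of_eq Polynomial.eval_one.symm) (fun _ h => h)
    exact ⟨agree_putNat s le_rfl, by simp [NatExpr.eval]⟩⟩

theorem NatComp.var : NatComp (fun (γ : Γ × ℕ) _ => γ.2) := fun ℓ d =>
  ⟨.setNat 16 (.const d) (.read 16 (.const ℓ.2)), 1, fun γ s h => by
    refine (Exec.setNat ?_).mono (le_of_eq Polynomial.eval_one.symm) (fun _ h => h)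
    exact ⟨agree_putNat s le_rfl, by simp [NatExpr.eval, h.2.2]⟩⟩

theorem NatComp.weaken {f : Γ → Store → ℕ} (hf : NatComp f) :
    NatComp (fun (γ : Γ × ℕ) => f γ.1) := fun ℓ d => by
  obtain ⟨c, p, h⟩ := hf ℓ.1 d
  exact ⟨c, p, fun γ s hs => (h γ.1 s hs.1).mono
    (eval_mono p (Nat.add_le_add_left (Nat.le_add_right _ _) _)) fun _ h => h⟩

theorem NatComp.read {f : Γ → Store → ℕ} {a : ℕ} (ha : a < 16) (hf : NatComp f) :
    NatComp (fun γ b => b.nat a (f γ b)) := fun ℓ d => by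
  obtain ⟨c, p, h⟩ := hf ℓ d
  refine ⟨.seq c (.setNat 16 (.const d) (.read a (.read 16 (.const d)))), p + 1, fun γ s hs => ?_⟩
  rw [Polynomial.eval_add, Polynomial.eval_one]
  refine (h γ s hs).seq fun s' h' => Exec.setNat ⟨h'.1.trans (agree_putNat s' le_rfl) le_rfl, ?_⟩
  dsimp only
  rw [← h'.1.1, base_nat ha]
  simp [NatExpr.eval, h'.2, h'.1.1]

theorem RealComp.read {f : Γ → Store → ℕ} {a : ℕ} (ha : a < 16) (hf : NatComp f) :
    RealComp (fun γ b => b.real a (f γ b)) := fun ℓ d => by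
  obtain ⟨c, p, h⟩ := hf ℓ d
  refine ⟨.seq c (.setReal 16 (.const d) (.read a (.read 16 (.const d)))), p + 1, fun γ s hs => ?_⟩
  rw [Polynomial.eval_add, Polynomial.eval_one]
  refine (h γ s hs).seq fun s' h' =>
    Exec.setReal ⟨h'.1.trans (agree_putReal s' le_rfl) le_rfl, ?_⟩
  dsimp only
  rw [← h'.1.1, base_real ha]
  simp [NatExpr.eval, RealExpr.eval, h'.2, h'.1.1]

theorem RealComp.const (k : ℕ) : RealComp (fun (_ : Γ) _ => (k : ℝ)) := fun _ d =>
  ⟨.setReal 16 (.const d) (.const k), 1, fun γ s _ => by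
    refine (Exec.setReal ?_).mono (le_of_eq Polynomial.eval_one.symm) (fun _ h => h)
    exact ⟨agree_putReal s le_rfl, by simp [NatExpr.eval, RealExpr.eval]⟩⟩

/-- Two functions are evaluated one after the other at the places `d` and `d + 1`. -/
theorem NatComp.exec_pair {f g : Γ → Store → ℕ} (hf : NatComp f) (hg : NatComp g)
    (ℓ : Ctx.Layout Γ) (d : ℕ) : ∃ (c : Prog) (p : Polynomial ℕ), ∀ γ s, Ctx.Holds ℓ d γ s →
    Exec c s (p.eval (s.base.dim + Ctx.weight γ)) (fun s' => Agree d s s' ∧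
      s'.nat 16 d = f γ s.base ∧ s'.nat 16 (d + 1) = g γ s.base) := by
  obtain ⟨c, p, h⟩ := hf ℓ d
  obtain ⟨c', p', h'⟩ := hg ℓ (d + 1)
  refine ⟨.seq c c', p + p', fun γ s hs => ?_⟩
  rw [Polynomial.eval_add]
  refine (h γ s hs).seq fun s' k => ?_
  have k' := h' γ s' (Ctx.holds_mono hs (Nat.le_succ d) k.1)
  rw [k.1.1] at k'
  exact k'.mono le_rfl fun s'' k'' => ⟨k.1.trans k''.1 (Nat.le_succ d),
    (k''.1.2 d d.lt_succ_self).1.trans k.2, k''.2⟩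

theorem RealComp.exec_pair {f g : Γ → Store → ℝ} (hf : RealComp f) (hg : RealComp g)
    (ℓ : Ctx.Layout Γ) (d : ℕ) : ∃ (c : Prog) (p : Polynomial ℕ), ∀ γ s, Ctx.Holds ℓ d γ s →
    Exec c s (p.eval (s.base.dim + Ctx.weight γ)) (fun s' => Agree d s s' ∧
      s'.real 16 d = f γ s.base ∧ s'.real 16 (d + 1) = g γ s.base) := by
  obtain ⟨c, p, h⟩ := hf ℓ d
  obtain ⟨c', p', h'⟩ := hg ℓ (d + 1)
  refine ⟨.seq c c', p + p', fun γ s hs => ?_⟩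
  rw [Polynomial.eval_add]
  refine (h γ s hs).seq fun s' k => ?_
  have k' := h' γ s' (Ctx.holds_mono hs (Nat.le_succ d) k.1)
  rw [k.1.1] at k'
  exact k'.mono le_rfl fun s'' k'' => ⟨k.1.trans k''.1 (Nat.le_succ d),
    (k''.1.2 d d.lt_succ_self).2.trans k.2, k''.2⟩

theorem NatComp.add {f g : Γ → Store → ℕ} (hf : NatComp f) (hg : NatComp g) :
    NatComp (fun γ b => f γ b + g γ b) := fun ℓ d => by
  obtain ⟨c, p, h⟩ := hf.exec_pair hg ℓ d
  refine ⟨.seq c (.setNat 16 (.const d)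
    (.add (.read 16 (.const d)) (.read 16 (.const (d + 1))))), p + 1, fun γ s hs => ?_⟩
  rw [Polynomial.eval_add, Polynomial.eval_one]
  refine (h γ s hs).seq fun s' h' => Exec.setNat ⟨h'.1.trans (agree_putNat s' le_rfl) le_rfl, ?_⟩
  simp [NatExpr.eval, h'.2.1, h'.2.2]

theorem RealComp.add {f g : Γ → Store → ℝ} (hf : RealComp f) (hg : RealComp g) :
    RealComp (fun γ b => f γ b + g γ b) := fun ℓ d => by
  obtain ⟨c, p, h⟩ := hf.exec_pair hg ℓ d
  refine ⟨.seq c (.setReal 16 (.const d)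
    (.add (.read 16 (.const d)) (.read 16 (.const (d + 1))))), p + 1, fun γ s hs => ?_⟩
  rw [Polynomial.eval_add, Polynomial.eval_one]
  refine (h γ s hs).seq fun s' h' =>
    Exec.setReal ⟨h'.1.trans (agree_putReal s' le_rfl) le_rfl, ?_⟩
  simp [NatExpr.eval, RealExpr.eval, h'.2.1, h'.2.2]

theorem RealComp.sub {f g : Γ → Store → ℝ} (hf : RealComp f) (hg : RealComp g) :
    RealComp (fun γ b => f γ b - g γ b) := fun ℓ d => by
  obtain ⟨c, p, h⟩ := hf.exec_pair hg ℓ d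
  refine ⟨.seq c (.setReal 16 (.const d)
    (.sub (.read 16 (.const d)) (.read 16 (.const (d + 1))))), p + 1, fun γ s hs => ?_⟩
  rw [Polynomial.eval_add, Polynomial.eval_one]
  refine (h γ s hs).seq fun s' h' =>
    Exec.setReal ⟨h'.1.trans (agree_putReal s' le_rfl) le_rfl, ?_⟩
  simp [NatExpr.eval, RealExpr.eval, h'.2.1, h'.2.2]

theorem PropComp.natLT {f g : Γ → Store → ℕ} (hf : NatComp f) (hg : NatComp g) :
    PropComp (fun γ b => f γ b < g γ b) := by
  refine ⟨fun γ b => if f γ b < g γ b then 1 else 0, fun ℓ d => ?_, fun γ b => by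
    dsimp only; split_ifs with h <;> simp [h]⟩
  obtain ⟨c, p, h⟩ := hf.exec_pair hg ℓ d
  refine ⟨.seq c (.branch (.natLT (.read 16 (.const d)) (.read 16 (.const (d + 1))))
    (.setNat 16 (.const d) (.const 1)) (.setNat 16 (.const d) (.const 0))), p + 3, fun γ s hs => ?_⟩
  rw [Polynomial.eval_add, Polynomial.eval_ofNat]
  refine (h γ s hs).seq fun s' h' => Exec.branch (T₁ := 1) (T₂ := 1) (fun hb => ?_) fun hb => ?_
  all_goals
    refine Exec.setNat ⟨h'.1.trans (agree_putNat s' le_rfl) le_rfl, ?_⟩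
    simp only [Test.Holds, NatExpr.eval, h'.2.1, h'.2.2] at hb
    simp [NatExpr.eval, hb]

theorem PropComp.realLT {f g : Γ → Store → ℝ} (hf : RealComp f) (hg : RealComp g) :
    PropComp (fun γ b => f γ b < g γ b) := by
  classical
  refine ⟨fun γ b => if f γ b < g γ b then 1 else 0, fun ℓ d => ?_, fun γ b => by
    dsimp only; split_ifs with h <;> simp [h]⟩
  obtain ⟨c, p, h⟩ := hf.exec_pair hg ℓ d
  refine ⟨.seq c (.branch (.realLT (.read 16 (.const d)) (.read 16 (.const (d + 1))))
    (.setNat 16 (.const d) (.const 1)) (.setNat 16 (.const d) (.const 0))), p + 3, fun γ s hs => ?_⟩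
  rw [Polynomial.eval_add, Polynomial.eval_ofNat]
  refine (h γ s hs).seq fun s' h' => Exec.branch (T₁ := 1) (T₂ := 1) (fun hb => ?_) fun hb => ?_
  all_goals
    refine Exec.setNat ⟨h'.1.trans (agree_putNat s' le_rfl) le_rfl, ?_⟩
    simp only [Test.Holds, NatExpr.eval, RealExpr.eval, h'.2.1, h'.2.2] at hb
    simp [NatExpr.eval, hb]

theorem NatComp.ite {P : Γ → Store → Prop} {f g : Γ → Store → ℕ}
    {inst : ∀ γ b, Decidable (P γ b)} (hP : PropComp P) (hf : NatComp f) (hg : NatComp g) :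
    NatComp (fun γ b => if P γ b then f γ b else g γ b) := fun ℓ d => by
  obtain ⟨t, ht, hPt⟩ := hP
  obtain ⟨c, p, h⟩ := ht ℓ d
  obtain ⟨c₁, p₁, h₁⟩ := hf ℓ d
  obtain ⟨c₂, p₂, h₂⟩ := hg ℓ d
  refine ⟨.seq c (.branch (.natLT (.const 0) (.read 16 (.const d))) c₁ c₂), p + (p₁ + p₂ + 1),
    fun γ s hs => ?_⟩
  simp only [Polynomial.eval_add, Polynomial.eval_one]
  refine (h γ s hs).seq fun s' h' => ?_
  have hs' := Ctx.holds_mono hs le_rfl h'.1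
  have k₁ := h₁ γ s' hs'
  have k₂ := h₂ γ s' hs'
  rw [h'.1.1] at k₁ k₂
  refine Exec.branch (fun hb => ?_) fun hb => ?_
  all_goals simp only [Test.Holds, NatExpr.eval, h'.2, hPt] at hb
  · exact k₁.mono le_rfl fun s'' k => ⟨h'.1.trans k.1 le_rfl, by rw [if_pos hb]; exact k.2⟩
  · exact k₂.mono le_rfl fun s'' k => ⟨h'.1.trans k.1 le_rfl, by rw [if_neg hb]; exact k.2⟩

theorem RealComp.ite {P : Γ → Store → Prop} {f g : Γ → Store → ℝ}
    {inst : ∀ γ b, Decidable (P γ b)} (hP : PropComp P) (hf : RealComp f) (hg : RealComp g) :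
    RealComp (fun γ b => if P γ b then f γ b else g γ b) := fun ℓ d => by
  obtain ⟨t, ht, hPt⟩ := hP
  obtain ⟨c, p, h⟩ := ht ℓ d
  obtain ⟨c₁, p₁, h₁⟩ := hf ℓ d
  obtain ⟨c₂, p₂, h₂⟩ := hg ℓ d
  refine ⟨.seq c (.branch (.natLT (.const 0) (.read 16 (.const d))) c₁ c₂), p + (p₁ + p₂ + 1),
    fun γ s hs => ?_⟩
  simp only [Polynomial.eval_add, Polynomial.eval_one]
  refine (h γ s hs).seq fun s' h' => ?_
  have hs' := Ctx.holds_mono hs le_rfl h'.1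
  have k₁ := h₁ γ s' hs'
  have k₂ := h₂ γ s' hs'
  rw [h'.1.1] at k₁ k₂
  refine Exec.branch (fun hb => ?_) fun hb => ?_
  all_goals simp only [Test.Holds, NatExpr.eval, h'.2, hPt] at hb
  · exact k₁.mono le_rfl fun s'' k => ⟨h'.1.trans k.1 le_rfl, by rw [if_pos hb]; exact k.2⟩
  · exact k₂.mono le_rfl fun s'' k => ⟨h'.1.trans k.1 le_rfl, by rw [if_neg hb]; exact k.2⟩

/-- Bounded sums.  The bound is kept at the place `d` of the stack, the summation variable at
`d + 1` and the partial sum at `d + 2`. -/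
theorem NatComp.sum {g : Γ → Store → ℕ} {F : Γ → ℕ → Store → ℕ} (hg : NatComp g)
    (hb : PolyBdd g) (hF : NatComp (fun (γ : Γ × ℕ) => F γ.1 γ.2)) :
    NatComp (fun γ b => ∑ i ∈ range (g γ b), F γ i b) := fun ℓ d => by
  obtain ⟨q, hq⟩ := hb
  obtain ⟨c, p, h⟩ := hg ℓ d
  obtain ⟨c', p', h'⟩ := hF (ℓ, d + 1) (d + 3)
  refine ⟨.seq c (.seq (.setNat 16 (.const (d + 1)) (.const 0))
    (.seq (.setNat 16 (.const (d + 2)) (.const 0))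
    (.seq (.loop (.natLT (.read 16 (.const (d + 1))) (.read 16 (.const d)))
      (.seq c' (.seq
        (.setNat 16 (.const (d + 2)) (.add (.read 16 (.const (d + 2))) (.read 16 (.const (d + 3)))))
        (.setNat 16 (.const (d + 1)) (.add (.read 16 (.const (d + 1))) (.const 1))))))
    (.setNat 16 (.const d) (.read 16 (.const (d + 2))))))),
    p + (1 + (1 + (q * (p'.comp (Polynomial.X + q) + 3) + 1 + 1))), fun γ s hs => ?_⟩
  simp only [Polynomial.eval_add, Polynomial.eval_one, Polynomial.eval_mul, Polynomial.eval_comp,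
    Polynomial.eval_X, Polynomial.eval_ofNat]
  set S := s.base.dim + Ctx.weight γ with hS
  have hbound : g γ s.base ≤ q.eval S := hq γ s.base
  refine (h γ s hs).seq fun s₁ k₁ => (Exec.setNat (Q := fun s' => Agree d s s' ∧
    s'.nat 16 d = g γ s.base ∧ s'.nat 16 (d + 1) = 0) ?_).seq fun s₂ k₂ =>
    (Exec.setNat (Q := fun s' => Agree d s s' ∧
    s'.nat 16 d = g γ s.base ∧ s'.nat 16 (d + 1) = 0 ∧ s'.nat 16 (d + 2) = 0) ?_).seq
    fun s₃ k₃ => ?_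
  · exact ⟨k₁.1.trans (agree_putNat s₁ (Nat.le_succ d)) le_rfl, by simp [NatExpr.eval, k₁.2],
      by simp [NatExpr.eval]⟩
  · exact ⟨k₂.1.trans (agree_putNat s₂ (by simp [NatExpr.eval])) le_rfl,
      by simp [NatExpr.eval, k₂.2], by simp [NatExpr.eval, k₂.2], by simp [NatExpr.eval]⟩
  · have hloop := Exec.loop (s := s₃) (c := (.seq c' (.seq
        (.setNat 16 (.const (d + 2)) (.add (.read 16 (.const (d + 2))) (.read 16 (.const (d + 3)))))
        (.setNat 16 (.const (d + 1)) (.add (.read 16 (.const (d + 1))) (.const 1))))))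
      (b := .natLT (.read 16 (.const (d + 1))) (.read 16 (.const d)))
      (N := g γ s.base) (T := p'.eval (S + q.eval S) + (1 + 1))
      (fun i s' => Agree d s s' ∧ s'.nat 16 d = g γ s.base ∧ s'.nat 16 (d + 1) = i ∧
        s'.nat 16 (d + 2) = ∑ j ∈ range i, F γ j s.base)
      (fun i s' hI _ => by simp [Test.Holds, NatExpr.eval, hI.2.1, hI.2.2.1])
      (fun i s' hi hI => by
        have hh : Ctx.Holds (Γ := Γ × ℕ) (ℓ, d + 1) (d + 3) (γ, i) s' :=
          ⟨Ctx.holds_mono hs (by omega) hI.1, by simp, hI.2.2.1⟩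
        have hrun := h' (γ, i) s' hh
        rw [hI.1.1] at hrun
        refine (hrun.mono (eval_mono p' (?_ : _ ≤ S + q.eval S)) fun _ h => h).seq fun s'' k'' =>
          (Exec.setNat (Q := fun s' => Agree d s s' ∧
            s'.nat 16 d = g γ s.base ∧ s'.nat 16 (d + 1) = i ∧
            s'.nat 16 (d + 2) = ∑ j ∈ range (i + 1), F γ j s.base) ?_).seq
          fun s₄ k₄ => Exec.setNat ?_
        · have : Ctx.weight (Γ := Γ × ℕ) (γ, i) = Ctx.weight γ + i := rfl
          omega
        · have e1 := (k''.1.2 d (by omega)).1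
          have e2 := (k''.1.2 (d + 1) (by omega)).1
          have e3 := (k''.1.2 (d + 2) (by omega)).1
          refine ⟨(hI.1.trans k''.1 (by omega)).trans
            (agree_putNat s'' (by simp [NatExpr.eval])) le_rfl, ?_, ?_, ?_⟩
          · simp [NatExpr.eval, e1, hI.2.1]
          · simp [NatExpr.eval, e2, hI.2.2.1]
          · simp [NatExpr.eval, e3, hI.2.2.2, k''.2, Finset.sum_range_succ]
        · refine ⟨k₄.1.trans (agree_putNat s₄ (by simp [NatExpr.eval])) le_rfl, ?_, ?_, ?_⟩
          · simp [NatExpr.eval, k₄.2.1]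
          · simp [NatExpr.eval, k₄.2.2.1]
          · simp [NatExpr.eval, k₄.2.2.2])
      ⟨k₃.1, k₃.2.1, k₃.2.2.1, by simp [k₃.2.2.2]⟩
    refine (hloop.mono ?_ fun _ h => h).seq fun s₅ k₅ => Exec.setNat ?_
    · exact Nat.add_le_add_right (Nat.mul_le_mul_right _ hbound) _
    · exact ⟨k₅.1.trans (agree_putNat s₅ le_rfl) le_rfl, by simp [NatExpr.eval, k₅.2.2.2]⟩

theorem RealComp.sum {g : Γ → Store → ℕ} {F : Γ → ℕ → Store → ℝ} (hg : NatComp g)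
    (hb : PolyBdd g) (hF : RealComp (fun (γ : Γ × ℕ) => F γ.1 γ.2)) :
    RealComp (fun γ b => ∑ i ∈ range (g γ b), F γ i b) := fun ℓ d => by
  obtain ⟨q, hq⟩ := hb
  obtain ⟨c, p, h⟩ := hg ℓ d
  obtain ⟨c', p', h'⟩ := hF (ℓ, d + 1) (d + 3)
  refine ⟨.seq c (.seq (.setNat 16 (.const (d + 1)) (.const 0))
    (.seq (.setReal 16 (.const (d + 2)) (.const 0))
    (.seq (.loop (.natLT (.read 16 (.const (d + 1))) (.read 16 (.const d)))
      (.seq c' (.seq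
        (.setReal 16 (.const (d + 2))
          (.add (.read 16 (.const (d + 2))) (.read 16 (.const (d + 3)))))
        (.setNat 16 (.const (d + 1)) (.add (.read 16 (.const (d + 1))) (.const 1))))))
    (.setReal 16 (.const d) (.read 16 (.const (d + 2))))))),
    p + (1 + (1 + (q * (p'.comp (Polynomial.X + q) + 3) + 1 + 1))), fun γ s hs => ?_⟩
  simp only [Polynomial.eval_add, Polynomial.eval_one, Polynomial.eval_mul, Polynomial.eval_comp,
    Polynomial.eval_X, Polynomial.eval_ofNat]
  set S := s.base.dim + Ctx.weight γ with hS
  have hbound : g γ s.base ≤ q.eval S := hq γ s.base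
  refine (h γ s hs).seq fun s₁ k₁ => (Exec.setNat (Q := fun s' => Agree d s s' ∧
    s'.nat 16 d = g γ s.base ∧ s'.nat 16 (d + 1) = 0) ?_).seq fun s₂ k₂ =>
    (Exec.setReal (Q := fun s' => Agree d s s' ∧
    s'.nat 16 d = g γ s.base ∧ s'.nat 16 (d + 1) = 0 ∧ s'.real 16 (d + 2) = 0) ?_).seq
    fun s₃ k₃ => ?_
  · exact ⟨k₁.1.trans (agree_putNat s₁ (Nat.le_succ d)) le_rfl, by simp [NatExpr.eval, k₁.2],
      by simp [NatExpr.eval]⟩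
  · exact ⟨k₂.1.trans (agree_putReal s₂ (by simp [NatExpr.eval])) le_rfl,
      by simp [k₂.2], by simp [k₂.2], by simp [NatExpr.eval, RealExpr.eval]⟩
  · have hloop := Exec.loop (s := s₃) (c := (.seq c' (.seq
        (.setReal 16 (.const (d + 2))
          (.add (.read 16 (.const (d + 2))) (.read 16 (.const (d + 3)))))
        (.setNat 16 (.const (d + 1)) (.add (.read 16 (.const (d + 1))) (.const 1))))))
      (b := .natLT (.read 16 (.const (d + 1))) (.read 16 (.const d)))
      (N := g γ s.base) (T := p'.eval (S + q.eval S) + (1 + 1))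
      (fun i s' => Agree d s s' ∧ s'.nat 16 d = g γ s.base ∧ s'.nat 16 (d + 1) = i ∧
        s'.real 16 (d + 2) = ∑ j ∈ range i, F γ j s.base)
      (fun i s' hI _ => by simp [Test.Holds, NatExpr.eval, hI.2.1, hI.2.2.1])
      (fun i s' hi hI => by
        have hh : Ctx.Holds (Γ := Γ × ℕ) (ℓ, d + 1) (d + 3) (γ, i) s' :=
          ⟨Ctx.holds_mono hs (by omega) hI.1, by simp, hI.2.2.1⟩
        have hrun := h' (γ, i) s' hh
        rw [hI.1.1] at hrun
        refine (hrun.mono (eval_mono p' (?_ : _ ≤ S + q.eval S)) fun _ h => h).seq fun s'' k'' =>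
          (Exec.setReal (Q := fun s' => Agree d s s' ∧
            s'.nat 16 d = g γ s.base ∧ s'.nat 16 (d + 1) = i ∧
            s'.real 16 (d + 2) = ∑ j ∈ range (i + 1), F γ j s.base) ?_).seq
          fun s₄ k₄ => Exec.setNat ?_
        · have : Ctx.weight (Γ := Γ × ℕ) (γ, i) = Ctx.weight γ + i := rfl
          omega
        · have e1 := (k''.1.2 d (by omega)).1
          have e2 := (k''.1.2 (d + 1) (by omega)).1
          have e3 := (k''.1.2 (d + 2) (by omega)).2
          refine ⟨(hI.1.trans k''.1 (by omega)).trans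
            (agree_putReal s'' (by simp [NatExpr.eval])) le_rfl, ?_, ?_, ?_⟩
          · simp [e1, hI.2.1]
          · simp [e2, hI.2.2.1]
          · simp [NatExpr.eval, RealExpr.eval, e3, hI.2.2.2, k''.2, Finset.sum_range_succ]
        · refine ⟨k₄.1.trans (agree_putNat s₄ (by simp [NatExpr.eval])) le_rfl, ?_, ?_, ?_⟩
          · simp [NatExpr.eval, k₄.2.1]
          · simp [NatExpr.eval, k₄.2.2.1]
          · simp [k₄.2.2.2])
      ⟨k₃.1, k₃.2.1, k₃.2.2.1, by simp [k₃.2.2.2]⟩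
    refine (hloop.mono ?_ fun _ h => h).seq fun s₅ k₅ => Exec.setReal ?_
    · exact Nat.add_le_add_right (Nat.mul_le_mul_right _ hbound) _
    · exact ⟨k₅.1.trans (agree_putReal s₅ le_rfl) le_rfl,
        by simp [NatExpr.eval, RealExpr.eval, k₅.2.2.2]⟩

theorem PropComp.not {P : Γ → Store → Prop} (hP : PropComp P) : PropComp (fun γ b => ¬ P γ b) := by
  obtain ⟨f, hf, h⟩ := hP
  obtain ⟨g, hg, h'⟩ := PropComp.natLT hf (NatComp.const (Γ := Γ) 1)
  refine ⟨g, hg, fun γ b => ?_⟩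
  have h1 := h γ b
  have h2 := h' γ b
  simp only at h2 ⊢
  rw [h2, ← h1]
  omega

theorem PropComp.of_iff {P Q : Γ → Store → Prop} (hP : PropComp P) (h : ∀ γ b, P γ b ↔ Q γ b) :
    PropComp Q := by
  obtain ⟨f, hf, h'⟩ := hP
  exact ⟨f, hf, fun γ b => (h' γ b).trans (h γ b)⟩

theorem PropComp.or {P Q : Γ → Store → Prop} (hP : PropComp P) (hQ : PropComp Q) :
    PropComp (fun γ b => P γ b ∨ Q γ b) := by
  obtain ⟨f, hf, h⟩ := hP
  obtain ⟨g, hg, h'⟩ := hQ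
  refine ⟨_, hf.add hg, fun γ b => ?_⟩
  have h1 := h γ b
  have h2 := h' γ b
  simp only
  rw [← h1, ← h2]
  omega

theorem PropComp.and {P Q : Γ → Store → Prop} (hP : PropComp P) (hQ : PropComp Q) :
    PropComp (fun γ b => P γ b ∧ Q γ b) :=
  (hP.not.or hQ.not).not.of_iff fun γ b => by tauto

theorem PropComp.imp {P Q : Γ → Store → Prop} (hP : PropComp P) (hQ : PropComp Q) :
    PropComp (fun γ b => P γ b → Q γ b) :=
  (hP.not.or hQ).of_iff fun γ b => by tauto

theorem PropComp.natLE {f g : Γ → Store → ℕ} (hf : NatComp f) (hg : NatComp g) :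
    PropComp (fun γ b => f γ b ≤ g γ b) :=
  (PropComp.natLT hg hf).not.of_iff fun γ b => by omega

theorem PropComp.natEq {f g : Γ → Store → ℕ} (hf : NatComp f) (hg : NatComp g) :
    PropComp (fun γ b => f γ b = g γ b) :=
  ((PropComp.natLE hf hg).and (PropComp.natLE hg hf)).of_iff fun γ b => by omega

theorem PropComp.realLE {f g : Γ → Store → ℝ} (hf : RealComp f) (hg : RealComp g) :
    PropComp (fun γ b => f γ b ≤ g γ b) :=
  (PropComp.realLT hg hf).not.of_iff fun _ _ => not_lt

/-- Bounded universal quantifiers. -/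
theorem PropComp.ball {g : Γ → Store → ℕ} {P : Γ → ℕ → Store → Prop} (hg : NatComp g)
    (hb : PolyBdd g) (hP : PropComp (fun (γ : Γ × ℕ) => P γ.1 γ.2)) :
    PropComp (fun γ b => ∀ i < g γ b, P γ i b) := by
  obtain ⟨f, hf, h⟩ := hP.not
  have hs : NatComp (fun γ b => ∑ i ∈ range (g γ b), f (γ, i) b) :=
    NatComp.sum (F := fun γ i b => f (γ, i) b) hg hb hf
  refine PropComp.not (P := fun γ b => ¬ ∀ i < g γ b, P γ i b) ⟨_, hs, fun γ b => ?_⟩ |>.of_iff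
    fun γ b => not_not
  push Not
  rw [Finset.sum_pos_iff]
  simp only [Finset.mem_range]
  exact exists_congr fun i => and_congr Iff.rfl (h (γ, i) b)

/-- Bounded search. -/
theorem NatComp.leastBelow {g : Γ → Store → ℕ} {P : Γ → ℕ → Store → Prop} (hg : NatComp g)
    (hb : PolyBdd g) (hP : PropComp (fun (γ : Γ × ℕ) => P γ.1 γ.2)) :
    NatComp (fun γ b => leastBelow (g γ b) (fun i => P γ i b)) := by
  classical
  simp only [leastBelow_eq_sum]
  refine NatComp.sum (F := fun γ i b => if ∀ j < i + 1, ¬ P γ j b then 1 else 0) hg hb ?_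
  refine NatComp.ite ?_ (NatComp.const 1) (NatComp.const 0)
  obtain ⟨f, hf, h⟩ := hP
  -- the layout of the inner variable replaces the one of the outer variable
  have hP' : PropComp (fun (γ : (Γ × ℕ) × ℕ) b => P γ.1.1 γ.2 b) := by
    refine ⟨fun γ b => f (γ.1.1, γ.2) b, fun ℓ d => ?_, fun γ b => h (γ.1.1, γ.2) b⟩
    obtain ⟨c, p, hc⟩ := hf (ℓ.1.1, ℓ.2) d
    refine ⟨c, p, fun γ s hs => (hc (γ.1.1, γ.2) s ⟨hs.1.1, hs.2⟩).mono (eval_mono p ?_)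
      fun _ h => h⟩
    refine Nat.add_le_add_left ?_ _
    change Ctx.weight γ.1.1 + γ.2 ≤ Ctx.weight γ.1.1 + γ.1.2 + γ.2
    omega
  refine PropComp.ball (g := fun (γ : Γ × ℕ) _ => γ.2 + 1)
    (P := fun (γ : Γ × ℕ) j b => ¬ P γ.1 j b) (NatComp.var.add (NatComp.const 1)) ?_ hP'.not
  refine ⟨Polynomial.X + 1, fun γ b => ?_⟩
  simp only [Polynomial.eval_add, Polynomial.eval_X, Polynomial.eval_one]
  change γ.2 + 1 ≤ b.dim + (Ctx.weight γ.1 + γ.2) + 1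
  omega

theorem NatComp.sub {f g : Γ → Store → ℕ} (hf : NatComp f) (hg : NatComp g) :
    NatComp (fun γ b => f γ b - g γ b) := fun ℓ d => by
  obtain ⟨c, p, h⟩ := hf.exec_pair hg ℓ d
  refine ⟨.seq c (.setNat 16 (.const d)
    (.sub (.read 16 (.const d)) (.read 16 (.const (d + 1))))), p + 1, fun γ s hs => ?_⟩
  rw [Polynomial.eval_add, Polynomial.eval_one]
  refine (h γ s hs).seq fun s' h' => Exec.setNat ⟨h'.1.trans (agree_putNat s' le_rfl) le_rfl, ?_⟩
  simp [NatExpr.eval, h'.2.1, h'.2.2]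

theorem RealComp.natCast_mul (k : ℕ) {f : Γ → Store → ℝ} (hf : RealComp f) :
    RealComp (fun γ b => (k : ℝ) * f γ b) := by
  induction k with
  | zero => simpa using RealComp.const (Γ := Γ) 0
  | succ k ih =>
    have := ih.add hf
    simpa only [Nat.cast_succ, add_mul, one_mul] using this

theorem RealComp.ofNat_mul (k : ℕ) [k.AtLeastTwo] {f : Γ → Store → ℝ} (hf : RealComp f) :
    RealComp (fun γ b => (OfNat.ofNat k : ℝ) * f γ b) :=
  RealComp.natCast_mul k hf

theorem RealComp.one : RealComp (fun (_ : Γ) _ => (1 : ℝ)) := by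
  simpa using RealComp.const (Γ := Γ) 1

theorem RealComp.zero : RealComp (fun (_ : Γ) _ => (0 : ℝ)) := by
  simpa using RealComp.const (Γ := Γ) 0

theorem NatComp.var_one : NatComp (fun (γ : (Γ × ℕ) × ℕ) _ => γ.1.2) := NatComp.var.weaken

theorem NatComp.var_two : NatComp (fun (γ : ((Γ × ℕ) × ℕ) × ℕ) _ => γ.1.1.2) :=
  NatComp.var_one.weaken

theorem NatComp.var_three : NatComp (fun (γ : (((Γ × ℕ) × ℕ) × ℕ) × ℕ) _ => γ.1.1.1.2) :=
  NatComp.var_two.weaken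

theorem PolyBdd.const (k : ℕ) : PolyBdd (fun (_ : Γ) _ => k) :=
  ⟨Polynomial.C k, fun _ _ => by simp⟩

theorem PolyBdd.var : PolyBdd (fun (γ : Γ × ℕ) _ => γ.2) := by
  refine ⟨Polynomial.X, fun γ b => ?_⟩
  rw [Polynomial.eval_X]
  change γ.2 ≤ b.dim + (Ctx.weight γ.1 + γ.2)
  omega

theorem PolyBdd.weaken {f : Γ → Store → ℕ} (hf : PolyBdd f) :
    PolyBdd (fun (γ : Γ × ℕ) => f γ.1) := by
  obtain ⟨q, hq⟩ := hf
  exact ⟨q, fun γ b => (hq γ.1 b).trans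
    (eval_mono q (Nat.add_le_add_left (Nat.le_add_right _ _) _))⟩

theorem PolyBdd.add {f g : Γ → Store → ℕ} (hf : PolyBdd f) (hg : PolyBdd g) :
    PolyBdd (fun γ b => f γ b + g γ b) := by
  obtain ⟨q, hq⟩ := hf
  obtain ⟨q', hq'⟩ := hg
  exact ⟨q + q', fun γ b => by rw [Polynomial.eval_add]; exact add_le_add (hq γ b) (hq' γ b)⟩

theorem PolyBdd.edges : PolyBdd (fun (_ : Γ) b => b.nat 0 0) :=
  ⟨Polynomial.X, fun γ b => by
    rw [Polynomial.eval_X, Store.dim]; dsimp only; omega⟩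

theorem PolyBdd.flows : PolyBdd (fun (_ : Γ) b => b.nat 0 1) :=
  ⟨Polynomial.X, fun γ b => by
    rw [Polynomial.eval_X, Store.dim]; dsimp only; omega⟩

end Closure

/-! ### Filling tables -/

/-- The memory after the first `N` entries of the array `a` of natural numbers are set to `f`. -/
def Store.fillNat (s : Store) (a : ℕ) (f : ℕ → ℕ) (N : ℕ) : Store :=
  { s with nat := fun b k => if b = a ∧ k < N then f k else s.nat b k }

/-- The memory after the first `N` entries of the array `a` of real numbers are set to `f`. -/
def Store.fillReal (s : Store) (a : ℕ) (f : ℕ → ℝ) (N : ℕ) : Store :=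
  { s with real := fun b k => if b = a ∧ k < N then f k else s.real b k }

theorem fillNat_succ (s : Store) (a : ℕ) (f : ℕ → ℕ) (N : ℕ) :
    s.fillNat a f (N + 1) = (s.fillNat a f N).putNat a N (f N) := by
  refine Store.ext' (fun b k => ?_) fun b k => rfl
  rw [putNat_nat]
  simp only [Store.fillNat]
  by_cases hb : b = a
  · by_cases hk : k = N
    · simp [hb, hk]
    · have : k < N + 1 ↔ k < N := by omega
      simp [hb, hk, this]
  · simp [hb]

theorem fillReal_succ (s : Store) (a : ℕ) (f : ℕ → ℝ) (N : ℕ) :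
    s.fillReal a f (N + 1) = (s.fillReal a f N).putReal a N (f N) := by
  refine Store.ext' (fun b k => rfl) fun b k => ?_
  rw [putReal_real]
  simp only [Store.fillReal]
  by_cases hb : b = a
  · by_cases hk : k = N
    · simp [hb, hk]
    · have : k < N + 1 ↔ k < N := by omega
      simp [hb, hk, this]
  · simp [hb]

theorem fillNat_zero (s : Store) (a : ℕ) (f : ℕ → ℕ) : s.fillNat a f 0 = s := by
  simp [Store.fillNat]

theorem fillReal_zero (s : Store) (a : ℕ) (f : ℕ → ℝ) : s.fillReal a f 0 = s := by
  simp [Store.fillReal]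

/-- Some program leads in polynomial time from each memory state of the family `S`, which depends
on the instance, to the corresponding one of the family `S'`. -/
def Stage (S S' : ∀ P : CapPath, List (Flow P) → Store) : Prop :=
  ∃ (c : Prog) (p : Polynomial ℕ), ∀ (P : CapPath) (F : List (Flow P)) (s : Store),
    s.base = S P F → Exec c s (p.eval (P.m + F.length)) (fun s' => s'.base = S' P F)

theorem Stage.trans {S S' S'' : ∀ P : CapPath, List (Flow P) → Store} (h : Stage S S')
    (h' : Stage S' S'') : Stage S S'' := by
  obtain ⟨c, p, k⟩ := h
  obtain ⟨c', p', k'⟩ := h'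
  refine ⟨.seq c c', p + p', fun P F s hs => ?_⟩
  rw [Polynomial.eval_add]
  exact (k P F s hs).seq fun s' hs' => k' P F s' hs'

/-- The first entries of an array are computed one after the other, where the computation of an
entry may use the previous entries. -/
theorem Stage.fillNat {S : ∀ P : CapPath, List (Flow P) → Store} {a : ℕ} (ha : a < 16) (ha0 : a ≠ 0)
    (h : ∀ P : CapPath, List (Flow P) → ℕ → ℕ) {N : ∀ P : CapPath, List (Flow P) → ℕ}
    (hdim : ∀ P F, (S P F).dim = P.m + F.length) {g : Unit → Store → ℕ} (hg : NatComp g)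
    (hgb : PolyBdd g) {f : Unit × ℕ → Store → ℕ} (hf : NatComp f)
    (hN : ∀ P F, g () (S P F) = N P F)
    (hstep : ∀ P F i, i < N P F → f ((), i) ((S P F).fillNat a (h P F) i) = h P F i) :
    Stage S (fun P F => (S P F).fillNat a (h P F) (N P F)) := by
  obtain ⟨c, p, hc⟩ := hg () 0
  obtain ⟨q, hq⟩ := hgb
  obtain ⟨c', p', hc'⟩ := hf ((), 1) 2
  refine ⟨.seq c (.seq (.setNat 16 (.const 1) (.const 0))
    (.loop (.natLT (.read 16 (.const 1)) (.read 16 (.const 0)))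
      (.seq c' (.seq (.setNat a (.read 16 (.const 1)) (.read 16 (.const 2)))
        (.setNat 16 (.const 1) (.add (.read 16 (.const 1)) (.const 1))))))),
    p + (1 + (q * (p'.comp (Polynomial.X + q) + 3) + 1)), fun P F s hs => ?_⟩
  have hbound : N P F ≤ q.eval (P.m + F.length) := by
    rw [← hN, ← hdim]; exact hq () (S P F)
  have hdimi : ∀ i, ((S P F).fillNat a (h P F) i).dim = P.m + F.length := fun i => by
    rw [← hdim]
    simp [Store.dim, Store.fillNat, ha0.symm]
  have h1 := hc () s trivial
  rw [hs, hdim, hN] at h1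
  simp only [Polynomial.eval_add, Polynomial.eval_one, Polynomial.eval_mul, Polynomial.eval_comp,
    Polynomial.eval_X, Polynomial.eval_ofNat]
  refine h1.seq fun s₁ k₁ => (Exec.setNat (Q := fun s' => s'.base = S P F ∧
    s'.nat 16 0 = N P F ∧ s'.nat 16 1 = 0) ?_).seq fun s₂ k₂ => ?_
  · refine ⟨?_, ?_, ?_⟩
    · rw [base_putNat_stack, k₁.1.1, hs]
    · simp [NatExpr.eval, k₁.2]
    · simp [NatExpr.eval]
  · have hloop := Exec.loop (s := s₂)
      (c := (.seq c' (.seq (.setNat a (.read 16 (.const 1)) (.read 16 (.const 2)))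
        (.setNat 16 (.const 1) (.add (.read 16 (.const 1)) (.const 1))))))
      (b := .natLT (.read 16 (.const 1)) (.read 16 (.const 0)))
      (N := N P F) (T := p'.eval (P.m + F.length + q.eval (P.m + F.length)) + (1 + 1))
      (fun i s' => s'.base = (S P F).fillNat a (h P F) i ∧ s'.nat 16 0 = N P F ∧ s'.nat 16 1 = i)
      (fun i s' hI _ => by simp [Test.Holds, NatExpr.eval, hI.2.1, hI.2.2])
      (fun i s' hi hI => by
        have hrun := hc' ((), i) s' ⟨trivial, by norm_num, hI.2.2⟩
        rw [hI.1, hdimi, hstep P F i hi] at hrun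
        refine (hrun.mono (eval_mono p' ?_) fun _ h => h).seq fun s₃ k₃ =>
          (Exec.setNat (Q := fun s' => s'.base = (S P F).fillNat a (h P F) (i + 1) ∧
            s'.nat 16 0 = N P F ∧ s'.nat 16 1 = i) ?_).seq fun s₄ k₄ => Exec.setNat ?_
        · change _ + (0 + i) ≤ _
          omega
        · have e0 := (k₃.1.2 0 (by norm_num)).1
          have e1 := (k₃.1.2 1 (by norm_num)).1
          refine ⟨?_, ?_, ?_⟩
          · rw [base_putNat ha, k₃.1.1, hI.1, fillNat_succ]
            simp [NatExpr.eval, e1, hI.2.2, k₃.2]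
          · simp [e0, hI.2.1, ha.ne']
          · simp [e1, hI.2.2, ha.ne']
        · exact ⟨by rw [base_putNat_stack, k₄.1], by simp [NatExpr.eval, k₄.2.1],
            by simp [NatExpr.eval, k₄.2.2]⟩)
      ⟨by rw [fillNat_zero]; exact k₂.1, k₂.2.1, k₂.2.2⟩
    exact hloop.mono (Nat.add_le_add_right (Nat.mul_le_mul_right _ hbound) _) fun _ h => h.1

theorem Stage.fillReal {S : ∀ P : CapPath, List (Flow P) → Store} {a : ℕ} (ha : a < 16)
    (h : ∀ P : CapPath, List (Flow P) → ℕ → ℝ) {N : ∀ P : CapPath, List (Flow P) → ℕ}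
    (hdim : ∀ P F, (S P F).dim = P.m + F.length) {g : Unit → Store → ℕ} (hg : NatComp g)
    (hgb : PolyBdd g) {f : Unit × ℕ → Store → ℝ} (hf : RealComp f)
    (hN : ∀ P F, g () (S P F) = N P F)
    (hstep : ∀ P F i, i < N P F → f ((), i) ((S P F).fillReal a (h P F) i) = h P F i) :
    Stage S (fun P F => (S P F).fillReal a (h P F) (N P F)) := by
  obtain ⟨c, p, hc⟩ := hg () 0
  obtain ⟨q, hq⟩ := hgb
  obtain ⟨c', p', hc'⟩ := hf ((), 1) 2
  refine ⟨.seq c (.seq (.setNat 16 (.const 1) (.const 0))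
    (.loop (.natLT (.read 16 (.const 1)) (.read 16 (.const 0)))
      (.seq c' (.seq (.setReal a (.read 16 (.const 1)) (.read 16 (.const 2)))
        (.setNat 16 (.const 1) (.add (.read 16 (.const 1)) (.const 1))))))),
    p + (1 + (q * (p'.comp (Polynomial.X + q) + 3) + 1)), fun P F s hs => ?_⟩
  have hbound : N P F ≤ q.eval (P.m + F.length) := by
    rw [← hN, ← hdim]; exact hq () (S P F)
  have hdimi : ∀ i, ((S P F).fillReal a (h P F) i).dim = P.m + F.length := fun i => hdim P F
  have h1 := hc () s trivial
  rw [hs, hdim, hN] at h1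
  simp only [Polynomial.eval_add, Polynomial.eval_one, Polynomial.eval_mul, Polynomial.eval_comp,
    Polynomial.eval_X, Polynomial.eval_ofNat]
  refine h1.seq fun s₁ k₁ => (Exec.setNat (Q := fun s' => s'.base = S P F ∧
    s'.nat 16 0 = N P F ∧ s'.nat 16 1 = 0) ?_).seq fun s₂ k₂ => ?_
  · refine ⟨?_, ?_, ?_⟩
    · rw [base_putNat_stack, k₁.1.1, hs]
    · simp [NatExpr.eval, k₁.2]
    · simp [NatExpr.eval]
  · have hloop := Exec.loop (s := s₂)
      (c := (.seq c' (.seq (.setReal a (.read 16 (.const 1)) (.read 16 (.const 2)))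
        (.setNat 16 (.const 1) (.add (.read 16 (.const 1)) (.const 1))))))
      (b := .natLT (.read 16 (.const 1)) (.read 16 (.const 0)))
      (N := N P F) (T := p'.eval (P.m + F.length + q.eval (P.m + F.length)) + (1 + 1))
      (fun i s' => s'.base = (S P F).fillReal a (h P F) i ∧ s'.nat 16 0 = N P F ∧ s'.nat 16 1 = i)
      (fun i s' hI _ => by simp [Test.Holds, NatExpr.eval, hI.2.1, hI.2.2])
      (fun i s' hi hI => by
        have hrun := hc' ((), i) s' ⟨trivial, by norm_num, hI.2.2⟩
        rw [hI.1, hdimi, hstep P F i hi] at hrun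
        refine (hrun.mono (eval_mono p' ?_) fun _ h => h).seq fun s₃ k₃ =>
          (Exec.setReal (Q := fun s' => s'.base = (S P F).fillReal a (h P F) (i + 1) ∧
            s'.nat 16 0 = N P F ∧ s'.nat 16 1 = i) ?_).seq fun s₄ k₄ => Exec.setNat ?_
        · change _ + (0 + i) ≤ _
          omega
        · have e0 := (k₃.1.2 0 (by norm_num)).1
          have e1 := (k₃.1.2 1 (by norm_num)).1
          refine ⟨?_, ?_, ?_⟩
          · rw [base_putReal ha, k₃.1.1, hI.1, fillReal_succ]
            simp [NatExpr.eval, RealExpr.eval, e1, hI.2.2, k₃.2]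
          · simp [e0, hI.2.1]
          · simp [e1, hI.2.2]
        · exact ⟨by rw [base_putNat_stack, k₄.1], by simp [NatExpr.eval, k₄.2.1],
            by simp [NatExpr.eval, k₄.2.2]⟩)
      ⟨by rw [fillReal_zero]; exact k₂.1, k₂.2.1, k₂.2.2⟩
    exact hloop.mono (Nat.add_le_add_right (Nat.mul_le_mul_right _ hbound) _) fun _ h => h.1

/-! ### The offline program -/

theorem leastBelow_congr {n : ℕ} {P Q : ℕ → Prop} (h : ∀ j < n, P j ↔ Q j) :
    leastBelow n P = leastBelow n Q := by
  classical
  rw [leastBelow_eq_sum, leastBelow_eq_sum]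
  refine Finset.sum_congr rfl fun j hj => if_congr ?_ rfl rfl
  rw [Finset.mem_range] at hj
  exact forall_congr' fun k => forall_congr' fun hk => not_congr (h k (by omega))

@[simp] theorem fillNat_nat (s : Store) (a : ℕ) (f : ℕ → ℕ) (N b k : ℕ) :
    (s.fillNat a f N).nat b k = if b = a ∧ k < N then f k else s.nat b k := rfl

@[simp] theorem fillNat_real (s : Store) (a : ℕ) (f : ℕ → ℕ) (N : ℕ) :
    (s.fillNat a f N).real = s.real := rfl

@[simp] theorem fillReal_nat (s : Store) (a : ℕ) (f : ℕ → ℝ) (N : ℕ) :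
    (s.fillReal a f N).nat = s.nat := rfl

@[simp] theorem fillReal_real (s : Store) (a : ℕ) (f : ℕ → ℝ) (N b k : ℕ) :
    (s.fillReal a f N).real b k = if b = a ∧ k < N then f k else s.real b k := rfl

section Entries

variable {P : CapPath} (F : List (Flow P))

@[simp] theorem inputStore_edges : (inputStore F).nat 0 0 = P.m := by simp [inputStore]

@[simp] theorem inputStore_flows : (inputStore F).nat 0 1 = F.length := by simp [inputStore]

@[simp] theorem inputStore_src : (inputStore F).nat 1 = srcOf F := by
  funext k; simp [inputStore, srcOf]

@[simp] theorem inputStore_snk : (inputStore F).nat 2 = snkOf F := by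
  funext k; simp [inputStore, snkOf]

@[simp] theorem inputStore_cap : (inputStore F).real 0 = capOf P := by
  funext k; simp [inputStore, capOf]

@[simp] theorem inputStore_size : (inputStore F).real 1 = sizeOf F := by
  funext k; simp [inputStore, sizeOf]

theorem offlineData_K : (offlineData F).K = F.length := rfl

theorem offlineData_val : (offlineData F).val = botOf F := rfl

theorem offlineData_size : (offlineData F).size = sizeOf F := rfl

theorem inputStore_nat_eq_zero {a : ℕ} (ha : 2 < a) (k : ℕ) : (inputStore F).nat a k = 0 := by
  have h0 : a ≠ 0 := by omega
  have h1 : a ≠ 1 := by omega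
  have h2 : a ≠ 2 := by omega
  simp [inputStore, h0, h1, h2]

theorem inputStore_real_eq_zero {a : ℕ} (ha : 1 < a) (k : ℕ) : (inputStore F).real a k = 0 := by
  have h0 : a ≠ 0 := by omega
  have h1 : a ≠ 1 := by omega
  simp [inputStore, h0, h1]

theorem base_inputStore : (inputStore F).base = inputStore F := by
  refine Store.ext' (fun a k => ?_) fun a k => ?_
  · by_cases ha : a < 16
    · exact base_nat ha _ k
    · rw [inputStore_nat_eq_zero F (by omega)]
      simp [Store.base, ha]
  · by_cases ha : a < 16
    · exact base_real ha _ k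
    · rw [inputStore_real_eq_zero F (by omega)]
      simp [Store.base, ha]

/-- The memory when the bottleneck edges are known. -/
noncomputable def withBottlenecks : Store :=
  (inputStore F).fillNat 4 (fun k => bottleneckEdge P.m (capOf P) (srcOf F k) (snkOf F k)) F.length

/-- The memory when the bottleneck capacities are known. -/
noncomputable def withBots : Store := (withBottlenecks F).fillReal 2 (botOf F) F.length

/-- The memory when the anchors are known. -/
noncomputable def withAnchors : Store :=
  (withBots F).fillNat 5 (offlineData F).anchor F.length

/-- The memory when the two-adic valuations are known. -/
noncomputable def withValuations : Store :=
  (withAnchors F).fillNat 6 (padicValNat 2) (F.length + 1)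

/-- The memory when the ranks are known. -/
noncomputable def withRanks : Store :=
  (withValuations F).fillNat 7 (offlineData F).rank F.length

/-- The memory when the groups are known. -/
noncomputable def withGroups : Store :=
  (withRanks F).fillNat 8 (offlineData F).group F.length

/-- The memory when the weights are known. -/
noncomputable def withWeights : Store :=
  (withGroups F).fillReal 3 (offlineData F).weight F.length

/-- The memory when the units are known. -/
noncomputable def withUnits : Store :=
  (withWeights F).fillReal 4 (offlineData F).unit F.length

/-- The memory when the levels are known. -/
noncomputable def withLevels : Store :=
  (withUnits F).fillNat 9 (offlineData F).level F.length

/-- The memory when the colours are known. -/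
noncomputable def withColors : Store :=
  (withLevels F).fillNat 10 (offlineData F).color F.length

/-- The memory when the rounds are known. -/
noncomputable def withRounds : Store :=
  (withColors F).fillNat 3 (offlineData F).round F.length

end Entries

section Comp

variable {Γ : Type} [Ctx Γ]

theorem NatComp.flows : NatComp (fun (_ : Γ) b => b.nat 0 1) :=
  NatComp.read (by norm_num) (NatComp.const 1)

theorem NatComp.edges : NatComp (fun (_ : Γ) b => b.nat 0 0) :=
  NatComp.read (by norm_num) (NatComp.const 0)

end Comp

theorem stage_bottlenecks : Stage (fun _ F => inputStore F) (fun _ F => withBottlenecks F) := by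
  refine Stage.fillNat (a := 4) (N := fun _ F => F.length) (by norm_num) (by norm_num)
    (fun P F k => bottleneckEdge P.m (capOf P) (srcOf F k) (snkOf F k))
    (fun P F => by simp [Store.dim]) NatComp.flows PolyBdd.flows
    (f := fun γ b => leastBelow (b.nat 0 0) (fun j => (b.nat 1 γ.2 ≤ j ∧ j < b.nat 2 γ.2) ∧
      ∀ k < b.nat 0 0, b.nat 1 γ.2 ≤ k ∧ k < b.nat 2 γ.2 → b.real 0 j ≤ b.real 0 k)) ?_
    (fun P F => by simp) (fun P F i hi => ?_)
  · refine NatComp.leastBelow NatComp.edges PolyBdd.edges (PropComp.and ?_ ?_)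
    · exact (PropComp.natLE (NatComp.read (by norm_num) NatComp.var_one) NatComp.var).and
        (PropComp.natLT NatComp.var (NatComp.read (by norm_num) NatComp.var_one))
    · refine PropComp.ball NatComp.edges PolyBdd.edges (PropComp.imp
        ((PropComp.natLE (NatComp.read (by norm_num) NatComp.var_two) NatComp.var).and
        (PropComp.natLT NatComp.var (NatComp.read (by norm_num) NatComp.var_two)))
        (PropComp.realLE (RealComp.read (by norm_num) NatComp.var_one)
          (RealComp.read (by norm_num) NatComp.var)))
  · simp [bottleneckEdge]

theorem stage_bots : Stage (fun _ F => withBottlenecks F) (fun _ F => withBots F) := by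
  refine Stage.fillReal (a := 2) (N := fun _ F => F.length) (by norm_num)
    (fun P F => botOf F)
    (fun P F => by simp [Store.dim, withBottlenecks]) NatComp.flows PolyBdd.flows
    (f := fun γ b => b.real 0 (b.nat 4 γ.2))
    (RealComp.read (by norm_num) (NatComp.read (by norm_num) NatComp.var))
    (fun P F => by simp [withBottlenecks]) (fun P F i hi => ?_)
  simp [withBottlenecks, hi, botOf]

open scoped Classical in
theorem stage_anchors : Stage (fun _ F => withBots F) (fun _ F => withAnchors F) := by
  refine Stage.fillNat (a := 5) (N := fun _ F => F.length) (by norm_num) (by norm_num)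
    (fun P F => (offlineData F).anchor)
    (fun P F => by simp [Store.dim, withBots, withBottlenecks]) NatComp.flows PolyBdd.flows
    (f := fun γ b => if ∀ j < γ.2, b.nat 5 j = 1 → ¬ (b.real 2 j < 2 * b.real 2 γ.2 ∧
      b.real 2 γ.2 < 2 * b.real 2 j) then 1 else 0) ?_
    (fun P F => by simp [withBots, withBottlenecks]) (fun P F i hi => ?_)
  · refine NatComp.ite (PropComp.ball NatComp.var PolyBdd.var ?_) (NatComp.const 1)
      (NatComp.const 0)
    have h1 : RealComp (fun (γ : (Unit × ℕ) × ℕ) b => b.real 2 γ.2) :=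
      RealComp.read (by norm_num) NatComp.var
    have h2 : RealComp (fun (γ : (Unit × ℕ) × ℕ) b => b.real 2 γ.1.2) :=
      RealComp.read (by norm_num) NatComp.var_one
    exact PropComp.imp (PropComp.natEq (NatComp.read (by norm_num) NatComp.var) (NatComp.const 1))
      ((PropComp.realLT h1 (h2.ofNat_mul 2)).and (PropComp.realLT h2 (h1.ofNat_mul 2))).not
  · rw [Data.anchor, fill_eq, Data.anchorStep]
    refine if_congr (forall_congr' fun j => forall_congr' fun hj => ?_) rfl rfl
    have hj' := hj.trans hi
    simp [withBots, hi, hj, hj', Near, offlineData_val]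

theorem padicValNat_two_eq_sum (k : ℕ) :
    padicValNat 2 k = ∑ j ∈ range k, if j + j = k then padicValNat 2 j + 1 else 0 := by
  obtain ⟨a, rfl | rfl⟩ := Nat.even_or_odd' k
  · rcases Nat.eq_zero_or_pos a with rfl | ha
    · simp
    · rw [Finset.sum_eq_single a]
      · rw [if_pos (by omega), padicValNat_two_two_mul (by omega)]
      · intro j _ hj
        rw [if_neg (by omega)]
      · intro h
        rw [Finset.mem_range] at h
        omega
  · rw [padicValNat_two_odd, Finset.sum_eq_zero]
    intro j _
    rw [if_neg (by omega)]

theorem stage_valuations : Stage (fun _ F => withAnchors F) (fun _ F => withValuations F) := by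
  refine Stage.fillNat (a := 6) (N := fun _ F => F.length + 1) (by norm_num) (by norm_num)
    (fun P F => padicValNat 2)
    (fun P F => by simp [Store.dim, withAnchors, withBots, withBottlenecks])
    (NatComp.flows.add (NatComp.const 1)) (PolyBdd.flows.add (PolyBdd.const 1))
    (f := fun γ b => ∑ j ∈ range γ.2, if j + j = γ.2 then b.nat 6 j + 1 else 0) ?_
    (fun P F => by simp [withAnchors, withBots, withBottlenecks]) (fun P F i hi => ?_)
  · exact NatComp.sum NatComp.var PolyBdd.var (NatComp.ite
      (PropComp.natEq (NatComp.var.add NatComp.var) NatComp.var_one)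
      ((NatComp.read (by norm_num) NatComp.var).add (NatComp.const 1)) (NatComp.const 0))
  · rw [padicValNat_two_eq_sum i]
    refine Finset.sum_congr rfl fun j hj => ?_
    simp [Finset.mem_range.1 hj]

open scoped Classical in
theorem stage_ranks : Stage (fun _ F => withValuations F) (fun _ F => withRanks F) := by
  refine Stage.fillNat (a := 7) (N := fun _ F => F.length) (by norm_num) (by norm_num)
    (fun P F => (offlineData F).rank)
    (fun P F => by simp [Store.dim, withValuations, withAnchors, withBots, withBottlenecks])
    NatComp.flows PolyBdd.flows
    (f := fun γ b => ∑ k ∈ range (b.nat 0 1),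
      if b.nat 5 k = 1 ∧ b.real 2 k ≤ b.real 2 γ.2 then 1 else 0) ?_
    (fun P F => by simp [withValuations, withAnchors, withBots, withBottlenecks])
    (fun P F i hi => ?_)
  · exact NatComp.sum NatComp.flows PolyBdd.flows (NatComp.ite
      ((PropComp.natEq (NatComp.read (by norm_num) NatComp.var) (NatComp.const 1)).and
      (PropComp.realLE (RealComp.read (by norm_num) NatComp.var)
        (RealComp.read (by norm_num) NatComp.var_one))) (NatComp.const 1) (NatComp.const 0))
  · have h0 : ((withValuations F).fillNat 7 (offlineData F).rank i).nat 0 1 = F.length := by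
      simp [withValuations, withAnchors, withBots, withBottlenecks]
    dsimp only
    rw [Data.rank, h0]
    refine Finset.sum_congr rfl fun j hj => if_congr ?_ rfl rfl
    have hj' : j < F.length := Finset.mem_range.1 hj
    simp [withValuations, withAnchors, withBots, hi, hj', offlineData_val]

open scoped Classical in
theorem stage_groups : Stage (fun _ F => withRanks F) (fun _ F => withGroups F) := by
  refine Stage.fillNat (a := 8) (N := fun _ F => F.length) (by norm_num) (by norm_num)
    (fun P F => (offlineData F).group)
    (fun P F => by
      simp [Store.dim, withRanks, withValuations, withAnchors, withBots, withBottlenecks])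
    NatComp.flows PolyBdd.flows
    (f := fun γ b => if 32 * b.real 1 γ.2 ≤ b.real 2 γ.2 then
        leastBelow (b.nat 0 1) (fun j => b.nat 5 j = 1 ∧
          (b.real 2 j < 2 * b.real 2 γ.2 ∧ b.real 2 γ.2 < 2 * b.real 2 j))
      else b.nat 0 1 + leastBelow (b.nat 0 1) (fun j => (b.nat 5 j = 1 ∧
          (b.real 2 γ.2 - b.real 1 γ.2 < 2 * b.real 2 j ∧ b.real 2 j < 2 * b.real 2 γ.2)) ∧
          ∀ k < b.nat 0 1, (b.nat 5 k = 1 ∧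
          (b.real 2 γ.2 - b.real 1 γ.2 < 2 * b.real 2 k ∧ b.real 2 k < 2 * b.real 2 γ.2)) →
          b.nat 6 (b.nat 7 k) ≤ b.nat 6 (b.nat 7 j))) ?_
    (fun P F => by simp [withRanks, withValuations, withAnchors, withBots, withBottlenecks])
    (fun P F i hi => ?_)
  · refine NatComp.ite (PropComp.realLE
      ((RealComp.read (by norm_num) NatComp.var).ofNat_mul 32)
      (RealComp.read (by norm_num) NatComp.var)) ?_ (NatComp.flows.add ?_)
    · refine NatComp.leastBelow NatComp.flows PolyBdd.flows (PropComp.and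
        (PropComp.natEq (NatComp.read (by norm_num) NatComp.var) (NatComp.const 1)) ?_)
      have h1 : RealComp (fun (γ : (Unit × ℕ) × ℕ) b => b.real 2 γ.2) :=
        RealComp.read (by norm_num) NatComp.var
      have h2 : RealComp (fun (γ : (Unit × ℕ) × ℕ) b => b.real 2 γ.1.2) :=
        RealComp.read (by norm_num) NatComp.var_one
      exact (PropComp.realLT h1 (h2.ofNat_mul 2)).and (PropComp.realLT h2 (h1.ofNat_mul 2))
    · refine NatComp.leastBelow NatComp.flows PolyBdd.flows (PropComp.and ?_
        (PropComp.ball NatComp.flows PolyBdd.flows (PropComp.imp ?_ ?_)))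
      · have h1 : RealComp (fun (γ : (Unit × ℕ) × ℕ) b => b.real 2 γ.2) :=
          RealComp.read (by norm_num) NatComp.var
        have h2 : RealComp (fun (γ : (Unit × ℕ) × ℕ) b => b.real 2 γ.1.2) :=
          RealComp.read (by norm_num) NatComp.var_one
        have h3 : RealComp (fun (γ : (Unit × ℕ) × ℕ) b => b.real 1 γ.1.2) :=
          RealComp.read (by norm_num) NatComp.var_one
        exact (PropComp.natEq (NatComp.read (by norm_num) NatComp.var) (NatComp.const 1)).and
          ((PropComp.realLT (h2.sub h3) (h1.ofNat_mul 2)).and (PropComp.realLT h1 (h2.ofNat_mul 2)))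
      · have h1 : RealComp (fun (γ : ((Unit × ℕ) × ℕ) × ℕ) b => b.real 2 γ.2) :=
          RealComp.read (by norm_num) NatComp.var
        have h2 : RealComp (fun (γ : ((Unit × ℕ) × ℕ) × ℕ) b => b.real 2 γ.1.1.2) :=
          RealComp.read (by norm_num) NatComp.var_two
        have h3 : RealComp (fun (γ : ((Unit × ℕ) × ℕ) × ℕ) b => b.real 1 γ.1.1.2) :=
          RealComp.read (by norm_num) NatComp.var_two
        exact (PropComp.natEq (NatComp.read (by norm_num) NatComp.var) (NatComp.const 1)).and
          ((PropComp.realLT (h2.sub h3) (h1.ofNat_mul 2)).and (PropComp.realLT h1 (h2.ofNat_mul 2)))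
      · exact PropComp.natLE
          (NatComp.read (by norm_num) (NatComp.read (by norm_num) NatComp.var))
          (NatComp.read (by norm_num) (NatComp.read (by norm_num) NatComp.var_one))
  · set b := (withRanks F).fillNat 8 (offlineData F).group i with hb
    have h0 : b.nat 0 1 = F.length := by
      simp [hb, withRanks, withValuations, withAnchors, withBots, withBottlenecks]
    have hs : b.real 1 i = sizeOf F i := by
      simp [hb, withRanks, withValuations, withAnchors, withBots, withBottlenecks]
    have hbot : ∀ k < F.length, b.real 2 k = botOf F k := fun k hk => by
      simp [hb, withRanks, withValuations, withAnchors, withBots, hk]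
    have hanchor : ∀ k < F.length, b.nat 5 k = (offlineData F).anchor k := fun k hk => by
      simp [hb, withRanks, withValuations, withAnchors, hk]
    have hval : ∀ k < F.length, b.nat 6 (b.nat 7 k) = padicValNat 2 ((offlineData F).rank k) :=
      fun k hk => by
        have h7 : b.nat 7 k = (offlineData F).rank k := by simp [hb, withRanks, hk]
        have hr : (offlineData F).rank k < F.length + 1 := by
          refine Nat.lt_succ_of_le ((Data.rank_le k).trans ?_)
          simpa [Data.anchors, offlineData] using
            Finset.card_filter_le (range F.length) (fun j => (offlineData F).anchor j = 1)
        rw [h7]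
        simp [hb, withRanks, withValuations, hr]
    dsimp only
    rw [Data.group, h0, hs, hbot i hi, Data.cls, Data.node]
    refine if_congr Iff.rfl (leastBelow_congr fun j hj => ?_)
      (congrArg (F.length + ·) (leastBelow_congr fun j hj => ?_))
    · rw [hanchor j hj, hbot j hj]
      rfl
    · rw [hanchor j hj, hbot j hj, hval j hj]
      refine and_congr Iff.rfl (forall_congr' fun k => forall_congr' fun hk => ?_)
      have hk' : k < F.length := hk
      rw [hanchor k hk', hbot k hk', hval k hk']
      rfl

theorem stage_weights : Stage (fun _ F => withGroups F) (fun _ F => withWeights F) := by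
  refine Stage.fillReal (a := 3) (N := fun _ F => F.length) (by norm_num)
    (fun P F => (offlineData F).weight)
    (fun P F => by
      simp [Store.dim, withGroups, withRanks, withValuations, withAnchors, withBots,
        withBottlenecks])
    NatComp.flows PolyBdd.flows
    (f := fun γ b => if b.nat 8 γ.2 < b.nat 0 1 then 16 * b.real 1 γ.2 else 1)
    (RealComp.ite (PropComp.natLT (NatComp.read (by norm_num) NatComp.var) NatComp.flows)
      ((RealComp.read (by norm_num) NatComp.var).ofNat_mul 16) RealComp.one)
    (fun P F => by
      simp [withGroups, withRanks, withValuations, withAnchors, withBots, withBottlenecks])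
    (fun P F i hi => ?_)
  rw [Data.weight, offlineData_K]
  refine if_congr ?_ ?_ rfl <;>
    simp [withGroups, withRanks, withValuations, withAnchors, withBots, withBottlenecks, hi,
      offlineData_size]

theorem stage_units : Stage (fun _ F => withWeights F) (fun _ F => withUnits F) := by
  refine Stage.fillReal (a := 4) (N := fun _ F => F.length) (by norm_num)
    (fun P F => (offlineData F).unit)
    (fun P F => by
      simp [Store.dim, withWeights, withGroups, withRanks, withValuations, withAnchors, withBots,
        withBottlenecks])
    NatComp.flows PolyBdd.flows
    (f := fun γ b => if b.nat 8 γ.2 < b.nat 0 1 then b.real 2 (b.nat 8 γ.2) else 1)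
    (RealComp.ite (PropComp.natLT (NatComp.read (by norm_num) NatComp.var) NatComp.flows)
      (RealComp.read (by norm_num) (NatComp.read (by norm_num) NatComp.var)) RealComp.one)
    (fun P F => by
      simp [withWeights, withGroups, withRanks, withValuations, withAnchors, withBots,
        withBottlenecks])
    (fun P F i hi => ?_)
  set b := (withWeights F).fillReal 4 (offlineData F).unit i with hb
  have h0 : b.nat 0 1 = F.length := by
    simp [hb, withWeights, withGroups, withRanks, withValuations, withAnchors, withBots,
      withBottlenecks]
  have hg : b.nat 8 i = (offlineData F).group i := by simp [hb, withWeights, withGroups, hi]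
  dsimp only
  rw [Data.unit, h0, hg, offlineData_K]
  by_cases h : (offlineData F).group i < F.length
  · rw [if_pos h, if_pos h]
    simp [hb, withWeights, withGroups, withRanks, withValuations, withAnchors, withBots, h,
      offlineData_val]
  · rw [if_neg h, if_neg h]

open scoped Classical in
theorem stage_levels : Stage (fun _ F => withUnits F) (fun _ F => withLevels F) := by
  refine Stage.fillNat (a := 9) (N := fun _ F => F.length) (by norm_num) (by norm_num)
    (fun P F => (offlineData F).level)
    (fun P F => by
      simp [Store.dim, withUnits, withWeights, withGroups, withRanks, withValuations, withAnchors,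
        withBots, withBottlenecks])
    NatComp.flows PolyBdd.flows
    (f := fun γ b => leastBelow (γ.2 + 1) (fun h => ∀ e < b.nat 0 0,
      e < b.nat 2 γ.2 → b.nat 1 γ.2 ≤ e →
      (∑ j ∈ range γ.2, if b.nat 8 j = b.nat 8 γ.2 ∧ b.nat 9 j ≤ h ∧ b.nat 1 j ≤ e ∧ e < b.nat 2 j
        then b.real 3 j else 0) + b.real 3 γ.2 ≤ ∑ _x ∈ range (h + 1), b.real 4 γ.2)) ?_
    (fun P F => by
      simp [withUnits, withWeights, withGroups, withRanks, withValuations, withAnchors, withBots,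
        withBottlenecks])
    (fun P F i hi => ?_)
  · refine NatComp.leastBelow (NatComp.var.add (NatComp.const 1))
      (PolyBdd.var.add (PolyBdd.const 1)) (PropComp.ball NatComp.edges PolyBdd.edges
      (PropComp.imp (PropComp.natLT NatComp.var (NatComp.read (by norm_num) NatComp.var_two))
      (PropComp.imp (PropComp.natLE (NatComp.read (by norm_num) NatComp.var_two) NatComp.var)
      (PropComp.realLE (RealComp.add (RealComp.sum NatComp.var_two PolyBdd.var.weaken.weaken
        (RealComp.ite ?_ (RealComp.read (by norm_num) NatComp.var) RealComp.zero))
        (RealComp.read (by norm_num) NatComp.var_two))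
        (RealComp.sum (NatComp.var_one.add (NatComp.const 1))
          (PolyBdd.var.weaken.add (PolyBdd.const 1))
          (RealComp.read (by norm_num) NatComp.var_three))))))
    exact (PropComp.natEq (NatComp.read (by norm_num) NatComp.var)
      (NatComp.read (by norm_num) NatComp.var_three)).and
      ((PropComp.natLE (NatComp.read (by norm_num) NatComp.var) NatComp.var_two).and
      ((PropComp.natLE (NatComp.read (by norm_num) NatComp.var) NatComp.var_one).and
      (PropComp.natLT NatComp.var_one (NatComp.read (by norm_num) NatComp.var))))
  · set b := (withUnits F).fillNat 9 (offlineData F).level i with hb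
    have h0 : b.nat 0 0 = P.m := by
      simp [hb, withUnits, withWeights, withGroups, withRanks, withValuations, withAnchors,
        withBots, withBottlenecks]
    have hsrc : ∀ k, b.nat 1 k = srcOf F k := fun k => by
      simp [hb, withUnits, withWeights, withGroups, withRanks, withValuations, withAnchors,
        withBots, withBottlenecks]
    have hsnk : ∀ k, b.nat 2 k = snkOf F k := fun k => by
      simp [hb, withUnits, withWeights, withGroups, withRanks, withValuations, withAnchors,
        withBots, withBottlenecks]
    have hg : ∀ k < F.length, b.nat 8 k = (offlineData F).group k := fun k hk => by
      simp [hb, withUnits, withWeights, withGroups, hk]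
    have hw : ∀ k < F.length, b.real 3 k = (offlineData F).weight k := fun k hk => by
      simp [hb, withUnits, withWeights, hk]
    have hu : b.real 4 i = (offlineData F).unit i := by
      simp [hb, withUnits, hi]
    have hl : ∀ k < i, b.nat 9 k = (offlineData F).level k := fun k hk => by
      simp [hb, hk]
    rw [Data.level, fill_eq, Data.levelStep]
    dsimp only
    rw [h0, hsnk, hsrc, hg i hi, hw i hi, hu]
    congr 1
    funext h
    have hsum : ∀ e, (∑ j ∈ range i, if b.nat 8 j = (offlineData F).group i ∧ b.nat 9 j ≤ h ∧
        b.nat 1 j ≤ e ∧ e < b.nat 2 j then b.real 3 j else 0) =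
        ∑ j ∈ range i, if (offlineData F).group j = (offlineData F).group i ∧
          (if j < i then fill (offlineData F).levelStep j else 0) ≤ h ∧ (offlineData F).Uses j e
          then (offlineData F).weight j else 0 := by
      intro e
      refine Finset.sum_congr rfl fun j hj => ?_
      have hj' := Finset.mem_range.1 hj
      rw [hg j (hj'.trans hi), hw j (hj'.trans hi), hl j hj', hsrc, hsnk, if_pos hj']
      exact if_congr Iff.rfl rfl rfl
    simp only [hsum]
    have hsm := (src_lt_snk_of_lt F hi).2
    exact propext ⟨fun H e he => H e (he.trans_le hsm) he, fun H e _ he => H e he⟩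

theorem stage_colors : Stage (fun _ F => withLevels F) (fun _ F => withColors F) := by
  refine Stage.fillNat (a := 10) (N := fun _ F => F.length) (by norm_num) (by norm_num)
    (fun P F => (offlineData F).color)
    (fun P F => by
      simp [Store.dim, withLevels, withUnits, withWeights, withGroups, withRanks, withValuations,
        withAnchors, withBots, withBottlenecks])
    NatComp.flows PolyBdd.flows
    (f := fun γ b => leastBelow 3 (fun c => b.nat 0 1 ≤ b.nat 8 γ.2 → ∀ j < γ.2,
      b.nat 8 j = b.nat 8 γ.2 → b.nat 9 j = b.nat 9 γ.2 → b.nat 10 j = c →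
        ¬ (b.nat 1 j < b.nat 2 γ.2 ∧ b.nat 1 γ.2 < b.nat 2 j))) ?_
    (fun P F => by
      simp [withLevels, withUnits, withWeights, withGroups, withRanks, withValuations, withAnchors,
        withBots, withBottlenecks])
    (fun P F i hi => ?_)
  · have hr : ∀ {a : ℕ}, a < 16 → NatComp (fun (γ : ((Unit × ℕ) × ℕ) × ℕ) b => b.nat a γ.2) :=
      fun ha => NatComp.read ha NatComp.var
    have hr' : ∀ {a : ℕ}, a < 16 →
        NatComp (fun (γ : ((Unit × ℕ) × ℕ) × ℕ) b => b.nat a γ.1.1.2) :=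
      fun ha => NatComp.read ha NatComp.var_two
    refine NatComp.leastBelow (NatComp.const 3) (PolyBdd.const 3) (PropComp.imp
      (PropComp.natLE NatComp.flows (NatComp.read (by norm_num) NatComp.var_one))
      (PropComp.ball NatComp.var_one PolyBdd.var.weaken ?_))
    exact PropComp.imp (PropComp.natEq (hr (by norm_num)) (hr' (by norm_num)))
      (PropComp.imp (PropComp.natEq (hr (by norm_num)) (hr' (by norm_num)))
      (PropComp.imp (PropComp.natEq (hr (by norm_num)) NatComp.var_one)
      ((PropComp.natLT (hr (by norm_num)) (hr' (by norm_num))).and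
        (PropComp.natLT (hr' (by norm_num)) (hr (by norm_num)))).not))
  · set b := (withLevels F).fillNat 10 (offlineData F).color i with hb
    have h0 : b.nat 0 1 = F.length := by
      simp [hb, withLevels, withUnits, withWeights, withGroups, withRanks, withValuations,
        withAnchors, withBots, withBottlenecks]
    have hsrc : ∀ k, b.nat 1 k = srcOf F k := fun k => by
      simp [hb, withLevels, withUnits, withWeights, withGroups, withRanks, withValuations,
        withAnchors, withBots, withBottlenecks]
    have hsnk : ∀ k, b.nat 2 k = snkOf F k := fun k => by
      simp [hb, withLevels, withUnits, withWeights, withGroups, withRanks, withValuations,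
        withAnchors, withBots, withBottlenecks]
    have hg : ∀ k < F.length, b.nat 8 k = (offlineData F).group k := fun k hk => by
      simp [hb, withLevels, withUnits, withWeights, withGroups, hk]
    have hl : ∀ k < F.length, b.nat 9 k = (offlineData F).level k := fun k hk => by
      simp [hb, withLevels, hk]
    have hc : ∀ k < i, b.nat 10 k = (offlineData F).color k := fun k hk => by
      simp [hb, hk]
    rw [Data.color_eq]
    dsimp only
    rw [h0, hg i hi, hl i hi, hsrc i, hsnk i]
    refine leastBelow_congr fun c _ => imp_congr Iff.rfl
      (forall_congr' fun j => forall_congr' fun hj => ?_)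
    rw [hg j (hj.trans hi), hl j (hj.trans hi), hc j hj, hsrc, hsnk]
    rfl

theorem stage_rounds : Stage (fun _ F => withColors F) (fun _ F => withRounds F) := by
  refine Stage.fillNat (a := 3) (N := fun _ F => F.length) (by norm_num) (by norm_num)
    (fun P F => (offlineData F).round)
    (fun P F => by
      simp [Store.dim, withColors, withLevels, withUnits, withWeights, withGroups, withRanks,
        withValuations, withAnchors, withBots, withBottlenecks])
    NatComp.flows PolyBdd.flows
    (f := fun γ b => (if b.nat 8 γ.2 < b.nat 0 1 then 0 else
        b.nat 6 (b.nat 7 (b.nat 8 γ.2 - b.nat 0 1)) + 1) +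
      ∑ _x ∈ range (b.nat 0 1 + 1),
        (b.nat 10 γ.2 + (b.nat 9 γ.2 + (b.nat 9 γ.2 + b.nat 9 γ.2)))) ?_
    (fun P F => by
      simp [withColors, withLevels, withUnits, withWeights, withGroups, withRanks, withValuations,
        withAnchors, withBots, withBottlenecks])
    (fun P F i hi => ?_)
  · refine NatComp.add (NatComp.ite
      (PropComp.natLT (NatComp.read (by norm_num) NatComp.var) NatComp.flows) (NatComp.const 0)
      ((NatComp.read (by norm_num) (NatComp.read (by norm_num)
        ((NatComp.read (by norm_num) NatComp.var).sub NatComp.flows))).add (NatComp.const 1)))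
      (NatComp.sum (NatComp.flows.add (NatComp.const 1)) (PolyBdd.flows.add (PolyBdd.const 1)) ?_)
    -- the machine cannot multiply: the product with `K + 1` is a bounded sum
    have h9 : NatComp (fun (γ : (Unit × ℕ) × ℕ) b => b.nat 9 γ.1.2) :=
      NatComp.read (by norm_num) NatComp.var_one
    exact (NatComp.read (by norm_num) NatComp.var_one).add (h9.add (h9.add h9))
  · set b := (withColors F).fillNat 3 (offlineData F).round i with hb
    have h0 : b.nat 0 1 = F.length := by
      simp [hb, withColors, withLevels, withUnits, withWeights, withGroups, withRanks,
        withValuations, withAnchors, withBots, withBottlenecks]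
    have hg : b.nat 8 i = (offlineData F).group i := by
      simp [hb, withColors, withLevels, withUnits, withWeights, withGroups, hi]
    have hl : b.nat 9 i = (offlineData F).level i := by
      simp [hb, withColors, withLevels, hi]
    have hc : b.nat 10 i = (offlineData F).color i := by
      simp [hb, withColors, hi]
    dsimp only
    rw [Data.round, Data.key, offlineData_K, h0, hg, hl, hc, Finset.sum_const,
      Finset.card_range, smul_eq_mul]
    refine congrArg₂ (· + ·) ?_ (congrArg₂ (· * ·) rfl (by omega))
    by_cases h : (offlineData F).group i < F.length
    · rw [if_pos h, if_pos h]
    · have hV := valid_offlineData F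
      have hnode : (offlineData F).group i - F.length = (offlineData F).node i := by
        rw [Data.group_of_large hV hi h]
        exact Nat.add_sub_cancel_left _ _
      have hn : (offlineData F).node i < F.length := (Data.node_spec hV hi).1
      have h7 : b.nat 7 ((offlineData F).node i) =
          (offlineData F).rank ((offlineData F).node i) := by
        simp [hb, withColors, withLevels, withUnits, withWeights, withGroups, withRanks, hn]
      have hr : (offlineData F).rank ((offlineData F).node i) < F.length + 1 := by
        refine Nat.lt_succ_of_le ((Data.rank_le _).trans ?_)
        simpa [Data.anchors, offlineData] using
          Finset.card_filter_le (range F.length) (fun j => (offlineData F).anchor j = 1)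
      rw [if_neg h, if_neg h, hnode, h7]
      simp [hb, withColors, withLevels, withUnits, withWeights, withGroups, withRanks,
        withValuations, hr]

theorem exists_offlineProgram :
    ∃ c : Prog, IsPolyTimeApprox c (fun P n => 4992 * offlineBound P n) := by
  obtain ⟨c, p, h⟩ := stage_bottlenecks.trans (stage_bots.trans (stage_anchors.trans
    (stage_valuations.trans (stage_ranks.trans (stage_groups.trans (stage_weights.trans
    (stage_units.trans (stage_levels.trans (stage_colors.trans stage_rounds)))))))))
  refine ⟨c, p, fun P F => ?_⟩
  obtain ⟨t, s, h1, h2, h3⟩ := h P F (inputStore F) (base_inputStore F)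
  obtain ⟨g1, g2⟩ := guarantees (valid_offlineData F) rfl rfl rfl
  have hout : outputAssignment s F.length = fun i : Fin F.length => (offlineData F).round i := by
    funext i
    rw [outputAssignment, ← base_nat (by norm_num), h3]
    simp [withRounds]
  rw [← hout] at g1 g2
  exact ⟨t, s, h1, h2, g1, mul_chromaticNumber_le g2 (log_anchors_offline_le F)⟩

end RoundUFPP

theorem mainTheorem3 :
    (∃ (A : RoundUFPP.OnlineAlgorithm) (C : ℝ),
      RoundUFPP.IsCompetitive A (fun P => C * RoundUFPP.onlineBound P)) ∧
    (∃ (c : RoundUFPP.Prog) (C : ℝ),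
      RoundUFPP.IsPolyTimeApprox c (fun P n => C * RoundUFPP.offlineBound P n)) := by
  obtain ⟨c, hc⟩ := RoundUFPP.exists_offlineProgram
  exact ⟨⟨RoundUFPP.onlineAlgorithm, 4992, RoundUFPP.isCompetitive_onlineAlgorithm⟩, c, 4992, hc⟩
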